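/- **Theorem 1.** Fix $d\in\mathbb N$. An $s$-$t$ cut instance consists of a finite undirected graph $G'=(V\cup\{s,t\},E')$ with $n=|V|$ and costs $c':E'\to\mathbb R^d$. A cut is a set $S\subseteq V$; its cost vector is $\sum_{e\in\delta(S)}c'(e)$, where $\delta(S)$ is the set of edges with one end in $S\cup\{s\}$ and the other in $(V\setminus S)\cup\{t\}$. A solution dominates another one if its cost is at most as large in every coordinate and smaller in at least one; a solution is Pareto-optimal among the feasible ones if no feasible solution dominates it. Let a nice tree decomposition of width $w$ with $O(n w)$ nodes of $G=G'[V]$ be given (rooted, with empty root bag and leaf, introduce, forget and join nodes). For a node $\tau$ with bag $X_\tau$ let $V_\tau$ be the set of vertices introduced at or below $\tau$, and for $S\subseteq X_\tau$ let $\mathcal P_\tau^S$ be the set of Pareto-optimal solutions among the $p\subseteq V_\tau$ with $p\cap X_\tau=S$, where $p$ has the cost of the cut $p$ in $G'$. Let $p_{\max}=\max_{\tau,S}|\mathcal P_\tau^S|$. (i) The set of all Pareto-optimal $s$-$t$ cuts can be computed from $(G',c')$, given by its adjacency matrix with constant-time access, and the decomposition in time $$O\big(n\,w\cdot 2^{w}\cdot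 p_{\max}^2\cdot\log^{\max\{d-2,1\}}(p_{\max}^2)\big),$$ counted in unit-cost operations (comparisons of labels; additions, subtractions and comparisons of real numbers; pointer operations). Here each of the factors $n$, $w$ and $\log(p_{\max}^2)$ is to be read as $1$ where it is smaller than $1$. There is one program for each $d$, and the constant depends only on $d$ and on the constant in the bound $O(nw)$ for the number of nodes. (ii) For every Pareto-optimal cut $p\subseteq V$ and every node $\tau$, the solution $p\cap V_\tau$ is Pareto-optimal for the subproblem of $\tau$ and $p\cap X_\tau$, that is, $p\cap V_\tau\in\mathcal P_\tau^{p\cap X_\tau}$. -/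

import Mathlib

namespace ParetoCut

/-! ## Instances, cuts and Pareto optimality -/

/-- The vertex set `V ∪ {s, t}` with `V = {0, …, n - 1}`: `inl v` is an inner vertex. -/
abbrev Vert (n : ℕ) : Type := Fin n ⊕ Bool

/-- The source `s`. -/
def src {n : ℕ} : Vert n := Sum.inr false

/-- The sink `t`. -/
def snk {n : ℕ} : Vert n := Sum.inr true

/-- An `s`-`t` cut instance: an undirected graph `G' = (V ∪ {s, t}, E')` with edge costs in `ℝ^d`.
Only the values of `cost` on edges of `graph` are ever used. -/
structure CutInstance (n d : ℕ) where
  graph : SimpleGraph (Vert n)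
  cost : Sym2 (Vert n) → Fin d → ℝ

/-- The induced subgraph `G = G'[V]`. -/
def CutInstance.innerGraph {n d : ℕ} (I : CutInstance n d) : SimpleGraph (Fin n) :=
  I.graph.comap Sum.inl

/-- `S ∪ {s}`. -/
def srcSide {n : ℕ} (S : Finset (Fin n)) : Set (Vert n) := {src} ∪ Sum.inl '' {v | v ∈ S}

/-- `(V \ S) ∪ {t}`. -/
def snkSide {n : ℕ} (S : Finset (Fin n)) : Set (Vert n) := {snk} ∪ Sum.inl '' {v | v ∉ S}

open Classical in
/-- The set `δ(S)` of edges cut by `S`. -/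
noncomputable def CutInstance.cutEdges {n d : ℕ} (I : CutInstance n d) (S : Finset (Fin n)) :
    Finset (Sym2 (Vert n)) :=
  Finset.univ.filter fun e =>
    e ∈ I.graph.edgeSet ∧ ∃ u ∈ srcSide S, ∃ v ∈ snkSide S, e = s(u, v)

/-- The cost vector of the cut `S`. -/
noncomputable def CutInstance.cutCost {n d : ℕ} (I : CutInstance n d) (S : Finset (Fin n)) :
    Fin d → ℝ :=
  ∑ e ∈ I.cutEdges S, I.cost e

/-- A cost vector dominates another (all objectives are minimized). -/
def Dominates {d : ℕ} (x y : Fin d → ℝ) : Prop := (∀ i, x i ≤ y i) ∧ ∃ j, x j < y j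

/-- `S` is a Pareto-optimal `s`-`t` cut of the whole instance. -/
def CutInstance.IsParetoCut {n d : ℕ} (I : CutInstance n d) (S : Finset (Fin n)) : Prop :=
  ∀ S' : Finset (Fin n), ¬ Dominates (I.cutCost S') (I.cutCost S)

/-! ## Nice tree decompositions -/

/-- Rooted binary trees with the four node types of a nice tree decomposition; a tree stands for
its root node together with everything below it. -/
inductive NiceTree (n : ℕ) : Type
  | leaf : NiceTree n
  | introduce (v : Fin n) (T : NiceTree n) : NiceTree n
  | forget (v : Fin n) (T : NiceTree n) : NiceTree n
  | join (T₁ T₂ : NiceTree n) : NiceTree n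

namespace NiceTree

variable {n : ℕ}

/-- The bag `X_t` of the root node `t`. -/
def bag : NiceTree n → Finset (Fin n)
  | leaf => ∅
  | introduce v T => insert v T.bag
  | forget v T => T.bag.erase v
  | join T₁ _ => T₁.bag

/-- The vertices `V_t` introduced at the root node `t` or below it. -/
def verts : NiceTree n → Finset (Fin n)
  | leaf => ∅
  | introduce v T => insert v T.verts
  | forget _ T => T.verts
  | join T₁ T₂ => T₁.verts ∪ T₂.verts

/-- The node types are used properly: a new vertex is introduced, a vertex of the bag is
forgotten, and the two children of a join node have the same bag. -/
def WellFormed : NiceTree n → Prop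
  | leaf => True
  | introduce v T => v ∉ T.bag ∧ T.WellFormed
  | forget v T => v ∈ T.bag ∧ T.WellFormed
  | join T₁ T₂ => T₁.bag = T₂.bag ∧ T₁.WellFormed ∧ T₂.WellFormed

/-- All nodes, each given as the subtree rooted at it; a subtree that occurs at several places is
listed several times. -/
def nodes : NiceTree n → List (NiceTree n)
  | leaf => [leaf]
  | introduce v T => introduce v T :: T.nodes
  | forget v T => forget v T :: T.nodes
  | join T₁ T₂ => join T₁ T₂ :: (T₁.nodes ++ T₂.nodes)

/-- The node at an address, the address being the list of turns taken on the way down from the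
root (`false`: first or only child, `true`: second child). -/
def at? : NiceTree n → List Bool → Option (NiceTree n)
  | T, [] => some T
  | introduce _ T, false :: a => T.at? a
  | forget _ T, false :: a => T.at? a
  | join T₁ _, false :: a => T₁.at? a
  | join _ T₂, true :: a => T₂.at? a
  | _, _ :: _ => none

/-- The parent-child adjacency between addresses. -/
def addressGraph : SimpleGraph (List Bool) := SimpleGraph.fromRel fun a b => ∃ c, b = a ++ [c]

/-- The addresses of the nodes whose bags contain `v`. -/
def occurrences (T : NiceTree n) (v : Fin n) : Set (List Bool) :=
  {a | ∃ U, T.at? a = some U ∧ v ∈ U.bag}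

/-- `T` is a nice tree decomposition of `G`: its root bag is empty, every vertex and every edge of
`G` is contained in a bag, and the nodes whose bags contain a given vertex form a connected
subtree. -/
structure IsNiceTreeDecomposition (T : NiceTree n) (G : SimpleGraph (Fin n)) : Prop where
  wellFormed : T.WellFormed
  root_bag : T.bag = ∅
  vertex_covered : ∀ v, ∃ U ∈ T.nodes, v ∈ U.bag
  edge_covered : ∀ u v, G.Adj u v → ∃ U ∈ T.nodes, u ∈ U.bag ∧ v ∈ U.bag
  connected : ∀ v, (addressGraph.induce (T.occurrences v)).Connected

/-- The width: the maximal size of a bag, minus one. -/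
def width (T : NiceTree n) : ℕ := (T.nodes.map fun U => U.bag.card).foldr max 0 - 1

end NiceTree

/-! ## Subproblems -/

/-- The feasible solutions of the subproblem `(t, S)`: the `p ⊆ V_t` with `p ∩ X_t = S`, where `U`
is the subtree rooted at `t`. -/
def feasible {n : ℕ} (U : NiceTree n) (S : Finset (Fin n)) : Finset (Finset (Fin n)) :=
  U.verts.powerset.filter fun p => p ∩ U.bag = S

open Classical in
/-- The Pareto set `P_t^S` of the subproblem `(t, S)`. A solution `p` is charged the cost of the
cut `p` in the whole graph, so that the vertices outside `V_t` lie on the side of the sink. -/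
noncomputable def paretoSet {n d : ℕ} (I : CutInstance n d) (U : NiceTree n)
    (S : Finset (Fin n)) : Finset (Finset (Fin n)) :=
  (feasible U S).filter fun p =>
    ∀ q ∈ feasible U S, ¬ Dominates (I.cutCost q) (I.cutCost p)

/-- `p_max`: the maximal size of the Pareto set of a subproblem `(t, S)`, `S ⊆ X_t`. -/
noncomputable def pMax {n d : ℕ} (I : CutInstance n d) (T : NiceTree n) : ℕ :=
  (T.nodes.map fun U => U.bag.powerset.sup fun S => (paretoSet I U S).card).foldr max 0

/-! ## The model of computation

A first-order functional language over binary trees with labels (natural numbers) and real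
numbers as atoms, and read-only arrays as input. Evaluating any construct of the language costs one
unit on top of the evaluation of its parts. Every construct is a constant-time operation of the
real RAM: reading a variable, a constant, building and taking apart a pair, random access to an
array, addition, subtraction and comparison of two reals, comparison of two labels, branching, and
calling a function. There is no arithmetic on labels. -/

/-- Values. Arrays cannot be built by a program; they occur in its input only. -/
inductive Val : Type
  | nil : Val
  | label (i : ℕ) : Val
  | real (x : ℝ) : Val
  | pair (a b : Val) : Val
  | array (f : ℕ → Val) : Val

/-- Expressions; `var i` is the `i`-th entry of the environment (de Bruijn index). -/
inductive Expr : Type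
  | var (i : ℕ) : Expr
  | nil : Expr
  | label (i : ℕ) : Expr
  | zero : Expr
  | pair (e₁ e₂ : Expr) : Expr
  | fst (e : Expr) : Expr
  | snd (e : Expr) : Expr
  | read (e₁ e₂ : Expr) : Expr
  | add (e₁ e₂ : Expr) : Expr
  | sub (e₁ e₂ : Expr) : Expr
  | ifPair (e e₁ e₂ : Expr) : Expr
  | ifLe (e e' e₁ e₂ : Expr) : Expr
  | letIn (e₁ e₂ : Expr) : Expr
  | call (f : ℕ) (e : Expr) : Expr

/-- A program is a finite list of mutually recursive unary functions, given by their bodies. -/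
abbrev Program : Type := List Expr

/-- `Eval P ρ e a k`: in the environment `ρ` the expression `e` evaluates to `a` in `k` steps. -/
inductive Eval (P : Program) : List Val → Expr → Val → ℕ → Prop
  | var {ρ i a} (h : ρ[i]? = some a) : Eval P ρ (.var i) a 1
  | nil {ρ} : Eval P ρ .nil .nil 1
  | label {ρ i} : Eval P ρ (.label i) (.label i) 1
  | zero {ρ} : Eval P ρ .zero (.real 0) 1
  | pair {ρ e₁ e₂ a b j k} (h₁ : Eval P ρ e₁ a j) (h₂ : Eval P ρ e₂ b k) :
      Eval P ρ (.pair e₁ e₂) (.pair a b) (j + k + 1)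
  | fst {ρ e a b k} (h : Eval P ρ e (.pair a b) k) : Eval P ρ (.fst e) a (k + 1)
  | snd {ρ e a b k} (h : Eval P ρ e (.pair a b) k) : Eval P ρ (.snd e) b (k + 1)
  | read {ρ e₁ e₂ f i j k} (h₁ : Eval P ρ e₁ (.array f) j) (h₂ : Eval P ρ e₂ (.label i) k) :
      Eval P ρ (.read e₁ e₂) (f i) (j + k + 1)
  | add {ρ e₁ e₂ x y j k} (h₁ : Eval P ρ e₁ (.real x) j) (h₂ : Eval P ρ e₂ (.real y) k) :
      Eval P ρ (.add e₁ e₂) (.real (x + y)) (j + k + 1)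
  | sub {ρ e₁ e₂ x y j k} (h₁ : Eval P ρ e₁ (.real x) j) (h₂ : Eval P ρ e₂ (.real y) k) :
      Eval P ρ (.sub e₁ e₂) (.real (x - y)) (j + k + 1)
  | ifPair_pos {ρ e e₁ e₂ a b c j k} (h : Eval P ρ e (.pair a b) j) (h₁ : Eval P ρ e₁ c k) :
      Eval P ρ (.ifPair e e₁ e₂) c (j + k + 1)
  | ifPair_neg {ρ e e₁ e₂ a c j k} (h : Eval P ρ e a j) (ha : ∀ b b', a ≠ .pair b b')
      (h₂ : Eval P ρ e₂ c k) : Eval P ρ (.ifPair e e₁ e₂) c (j + k + 1)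
  | ifLe_real_pos {ρ e e' e₁ e₂ x y c i j k} (h : Eval P ρ e (.real x) i)
      (h' : Eval P ρ e' (.real y) j) (hxy : x ≤ y) (h₁ : Eval P ρ e₁ c k) :
      Eval P ρ (.ifLe e e' e₁ e₂) c (i + j + k + 1)
  | ifLe_real_neg {ρ e e' e₁ e₂ x y c i j k} (h : Eval P ρ e (.real x) i)
      (h' : Eval P ρ e' (.real y) j) (hxy : ¬ x ≤ y) (h₂ : Eval P ρ e₂ c k) :
      Eval P ρ (.ifLe e e' e₁ e₂) c (i + j + k + 1)
  | ifLe_label_pos {ρ e e' e₁ e₂ x y c i j k} (h : Eval P ρ e (.label x) i)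
      (h' : Eval P ρ e' (.label y) j) (hxy : x ≤ y) (h₁ : Eval P ρ e₁ c k) :
      Eval P ρ (.ifLe e e' e₁ e₂) c (i + j + k + 1)
  | ifLe_label_neg {ρ e e' e₁ e₂ x y c i j k} (h : Eval P ρ e (.label x) i)
      (h' : Eval P ρ e' (.label y) j) (hxy : ¬ x ≤ y) (h₂ : Eval P ρ e₂ c k) :
      Eval P ρ (.ifLe e e' e₁ e₂) c (i + j + k + 1)
  | letIn {ρ e₁ e₂ a b j k} (h₁ : Eval P ρ e₁ a j) (h₂ : Eval P (a :: ρ) e₂ b k) :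
      Eval P ρ (.letIn e₁ e₂) b (j + k + 1)
  | call {ρ f e body a b j k} (hf : P[f]? = some body) (h : Eval P ρ e a j)
      (hb : Eval P [a] body b k) : Eval P ρ (.call f e) b (j + k + 1)

/-- `P`, started on the input `a` in its function number `0`, halts after `k` steps with the
output `b`. -/
def Program.Runs (P : Program) (a b : Val) (k : ℕ) : Prop :=
  Eval P [a] (.call 0 (.var 0)) b k

/-! ## Input and output formats -/

/-- A list of values as a value. -/
def Val.ofList : List Val → Val
  | [] => .nil
  | a :: l => .pair a (Val.ofList l)

open Classical in
/-- The entry of the adjacency matrix for a pair of vertices: the list of the `d` costs of the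
edge, or `nil` if there is no edge. -/
noncomputable def CutInstance.entry {n d : ℕ} (I : CutInstance n d) (x y : Vert n) : Val :=
  if I.graph.Adj x y then .ofList (List.ofFn fun i => .real (I.cost s(x, y) i)) else .nil

/-- The row of the adjacency matrix that belongs to the vertex `x`, with one column for each
vertex of `V`. -/
noncomputable def CutInstance.row {n d : ℕ} (I : CutInstance n d) (x : Vert n) : Val :=
  .array fun j => if h : j < n then I.entry x (.inl ⟨j, h⟩) else .nil

/-- The graph as a value: the rows of all vertices of `V`, the row of `s`, the row of `t`, and the
entry for the pair `s`, `t`. -/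
noncomputable def CutInstance.encode {n d : ℕ} (I : CutInstance n d) : Val :=
  .pair (.array fun i => if h : i < n then I.row (.inl ⟨i, h⟩) else .nil)
    (.pair (I.row src) (.pair (I.row snk) (I.entry src snk)))

/-- The tree decomposition as a value. -/
def NiceTree.encode {n : ℕ} : NiceTree n → Val
  | leaf => .pair (.label 0) .nil
  | introduce v T => .pair (.label 1) (.pair (.label v) T.encode)
  | forget v T => .pair (.label 2) (.pair (.label v) T.encode)
  | join T₁ T₂ => .pair (.label 3) (.pair T₁.encode T₂.encode)

/-- The value `a` is an explicit list, without repetitions, of precisely those sets `S` that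
satisfy `Q`, each of them written out as a list of its elements without repetitions. -/
def Enumerates {n : ℕ} (a : Val) (Q : Finset (Fin n) → Prop) : Prop :=
  ∃ L : List (List (Fin n)),
    a = .ofList (L.map fun l => .ofList (l.map fun v => .label v)) ∧
    (∀ l ∈ L, l.Nodup) ∧ (L.map List.toFinset).Nodup ∧
    ∀ S, S ∈ L.map List.toFinset ↔ Q S

end ParetoCut

/-!
Dynamic programming over the tree decomposition computes, for every node `U` and every subset `S` of
its bag, a list of all Pareto-optimal solutions of the subproblem `(U, S)`. A solution carries only
the cost of those edges with an end in `U.forgotten`, the vertices introduced below `U` that have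
left the bag. For fixed `(U, S)` this differs from the cost of the cut by a constant vector
(`partCost_univ_sub`), so that domination is the same (`cutCost_lt_iff`). A solution of a child that
is dominated stays dominated after the same extension, hence the Pareto-optimal solutions of a node
are found among the extensions and combinations of those of its children
(`IsFrontList.of_candidates`, and its applications to forget and join nodes). Introducing a vertex
leaves the lists unchanged, forgetting `v` merges the lists without and with `v` and charges the
edges at `v`, and a join node combines each pair of solutions, whose costs add up since no edge
joins the forgotten vertices of the two sides. So at most `2 * pMax ^ 2` candidates arise for each
`S`. At the root, all vertices are forgotten and the list for `S = ∅` is the answer.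

The same comparison of costs gives part (ii): if a solution of `(U, p ∩ U.bag)` dominated
`p ∩ U.verts`, then exchanging the two within `p` would give a cut that dominates `p`, because all
edges at forgotten vertices lie within `U.verts` (`inter_mem_paretoSet`).

The running time rests on two data structures and one algorithm.
* The table of a node is a binary tree that branches over the vertices of the bag in the order of
  their labels, so that each node operation visits the `O(2 ^ w)` entries in a single traversal, and
  the costs of edges between `v` and the bag are summed on the way down (`spec_forget`).
* A solution set is an expression built from unions, which takes constant time for a combination; it
  is written out at the very end.
* The Pareto-optimal vectors of a list of length `m` with `D ≥ 3` coordinates are found in time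
  `O(m * log m ^ (D - 2))` (`spec_pareto`). Every vector takes part once as a victim and once as a
  killer. Lexicographic sorting disposes of one coordinate; divide and conquer disposes of each
  further one at the price of a logarithm (`spec_filter`), and the last two are treated together by
  a sweep that is fused with merge sort (`spec_sweepSort`). Instances with fewer than three
  objectives are filled up with zeros.

Programs are verified with a weakest precondition calculus that tracks results and numbers of steps
(`wp_sound`). `Spec P f a b K` states that the function `f` maps `a` to `b` within `K` steps;
`spec_solve` is the specification of the recursion over the tree decomposition, and `program_runs`
that of the whole program.
-/

namespace ParetoCut

set_option maxRecDepth 4000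

/-! ### Verifying programs -/

/-- The function number `f` of `P`, applied to `a`, returns `b` after at most `K` steps. -/
def Spec (P : Program) (f : ℕ) (a b : Val) (K : ℕ) : Prop :=
  ∃ body, P[f]? = some body ∧ ∃ k ≤ K, Eval P [a] body b k

/-- A call of the function number `f` with argument `a` ends in a result and a number of steps
that satisfy `Q`. -/
def CallPost (P : Program) (f : ℕ) (a : Val) (Q : Val → ℕ → Prop) : Prop :=
  ∃ b K, Spec P f a b K ∧ ∀ k ≤ K, Q b k

/-- The weakest precondition: `wp P e ρ Q` unfolds to conditions under which the evaluation of `e`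
in `ρ` ends in a result and a number of steps that satisfy `Q`. -/
def wp (P : Program) : Expr → List Val → (Val → ℕ → Prop) → Prop
  | .var i, ρ, Q => match ρ[i]? with
    | some a => Q a 1
    | none => False
  | .nil, _, Q => Q .nil 1
  | .label i, _, Q => Q (.label i) 1
  | .zero, _, Q => Q (.real 0) 1
  | .pair e₁ e₂, ρ, Q => wp P e₁ ρ fun a j => wp P e₂ ρ fun b k => Q (.pair a b) (j + k + 1)
  | .fst e, ρ, Q => wp P e ρ fun a k => match a with
    | .pair b _ => Q b (k + 1)
    | _ => False
  | .snd e, ρ, Q => wp P e ρ fun a k => match a with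
    | .pair _ c => Q c (k + 1)
    | _ => False
  | .read e₁ e₂, ρ, Q => wp P e₁ ρ fun a j => wp P e₂ ρ fun b k => match a, b with
    | .array f, .label i => Q (f i) (j + k + 1)
    | _, _ => False
  | .add e₁ e₂, ρ, Q => wp P e₁ ρ fun a j => wp P e₂ ρ fun b k => match a, b with
    | .real x, .real y => Q (.real (x + y)) (j + k + 1)
    | _, _ => False
  | .sub e₁ e₂, ρ, Q => wp P e₁ ρ fun a j => wp P e₂ ρ fun b k => match a, b with
    | .real x, .real y => Q (.real (x - y)) (j + k + 1)
    | _, _ => False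
  | .ifPair e e₁ e₂, ρ, Q => wp P e ρ fun a j => match a with
    | .pair _ _ => wp P e₁ ρ fun c k => Q c (j + k + 1)
    | _ => wp P e₂ ρ fun c k => Q c (j + k + 1)
  | .ifLe e e' e₁ e₂, ρ, Q => wp P e ρ fun a i => wp P e' ρ fun b j => match a, b with
    | .real x, .real y => (x ≤ y → wp P e₁ ρ fun c k => Q c (i + j + k + 1)) ∧
        (¬ x ≤ y → wp P e₂ ρ fun c k => Q c (i + j + k + 1))
    | .label x, .label y => (x ≤ y → wp P e₁ ρ fun c k => Q c (i + j + k + 1)) ∧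
        (¬ x ≤ y → wp P e₂ ρ fun c k => Q c (i + j + k + 1))
    | _, _ => False
  | .letIn e₁ e₂, ρ, Q => wp P e₁ ρ fun a j => wp P e₂ (a :: ρ) fun b k => Q b (j + k + 1)
  | .call f e, ρ, Q => wp P e ρ fun a j => CallPost P f a fun b k => Q b (j + k + 1)

theorem CallPost.mk {P : Program} {f : ℕ} {a b : Val} {K : ℕ} {Q : Val → ℕ → Prop}
    (h : Spec P f a b K) (hQ : ∀ k ≤ K, Q b k) : CallPost P f a Q :=
  ⟨b, K, h, hQ⟩

theorem wp_sound (P : Program) (e : Expr) : ∀ (ρ : List Val) (Q : Val → ℕ → Prop),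
    wp P e ρ Q → ∃ a k, Eval P ρ e a k ∧ Q a k := by
  induction e with
  | var i =>
    intro ρ Q h
    simp only [wp] at h
    split at h
    · exact ⟨_, _, .var ‹_›, h⟩
    · exact h.elim
  | nil => exact fun ρ Q h => ⟨_, _, .nil, h⟩
  | label i => exact fun ρ Q h => ⟨_, _, .label, h⟩
  | zero => exact fun ρ Q h => ⟨_, _, .zero, h⟩
  | pair e₁ e₂ ih₁ ih₂ =>
    intro ρ Q h
    obtain ⟨a, j, h₁, h⟩ := ih₁ _ _ h
    obtain ⟨b, k, h₂, h⟩ := ih₂ _ _ h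
    exact ⟨_, _, .pair h₁ h₂, h⟩
  | fst e ih =>
    intro ρ Q h
    obtain ⟨a, k, h₁, h⟩ := ih _ _ h
    split at h
    · exact ⟨_, _, .fst h₁, h⟩
    · exact h.elim
  | snd e ih =>
    intro ρ Q h
    obtain ⟨a, k, h₁, h⟩ := ih _ _ h
    split at h
    · exact ⟨_, _, .snd h₁, h⟩
    · exact h.elim
  | read e₁ e₂ ih₁ ih₂ =>
    intro ρ Q h
    obtain ⟨a, j, h₁, h⟩ := ih₁ _ _ h
    obtain ⟨b, k, h₂, h⟩ := ih₂ _ _ h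
    split at h
    · exact ⟨_, _, .read h₁ h₂, h⟩
    · exact h.elim
  | add e₁ e₂ ih₁ ih₂ =>
    intro ρ Q h
    obtain ⟨a, j, h₁, h⟩ := ih₁ _ _ h
    obtain ⟨b, k, h₂, h⟩ := ih₂ _ _ h
    split at h
    · exact ⟨_, _, .add h₁ h₂, h⟩
    · exact h.elim
  | sub e₁ e₂ ih₁ ih₂ =>
    intro ρ Q h
    obtain ⟨a, j, h₁, h⟩ := ih₁ _ _ h
    obtain ⟨b, k, h₂, h⟩ := ih₂ _ _ h
    split at h
    · exact ⟨_, _, .sub h₁ h₂, h⟩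
    · exact h.elim
  | ifPair e e₁ e₂ ih ih₁ ih₂ =>
    intro ρ Q h
    obtain ⟨a, j, h₁, h⟩ := ih _ _ h
    split at h
    · obtain ⟨x, k, h₂, h⟩ := ih₁ _ _ h
      exact ⟨_, _, .ifPair_pos h₁ h₂, h⟩
    · obtain ⟨x, k, h₂, h⟩ := ih₂ _ _ h
      exact ⟨_, _, .ifPair_neg h₁ ‹_› h₂, h⟩
  | ifLe e e' e₁ e₂ ih ih' ih₁ ih₂ =>
    intro ρ Q h
    obtain ⟨a, i, h₁, h⟩ := ih _ _ h
    obtain ⟨b, j, h₂, h⟩ := ih' _ _ h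
    split at h
    · rename_i x y _
      obtain ⟨hp, hn⟩ := h
      by_cases hxy : x ≤ y
      · obtain ⟨c, k, h₃, h⟩ := ih₁ _ _ (hp hxy)
        exact ⟨_, _, .ifLe_real_pos h₁ h₂ hxy h₃, h⟩
      · obtain ⟨c, k, h₃, h⟩ := ih₂ _ _ (hn hxy)
        exact ⟨_, _, .ifLe_real_neg h₁ h₂ hxy h₃, h⟩
    · rename_i x y _
      obtain ⟨hp, hn⟩ := h
      by_cases hxy : x ≤ y
      · obtain ⟨c, k, h₃, h⟩ := ih₁ _ _ (hp hxy)
        exact ⟨_, _, .ifLe_label_pos h₁ h₂ hxy h₃, h⟩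
      · obtain ⟨c, k, h₃, h⟩ := ih₂ _ _ (hn hxy)
        exact ⟨_, _, .ifLe_label_neg h₁ h₂ hxy h₃, h⟩
    · exact h.elim
  | letIn e₁ e₂ ih₁ ih₂ =>
    intro ρ Q h
    obtain ⟨a, j, h₁, h⟩ := ih₁ _ _ h
    obtain ⟨b, k, h₂, h⟩ := ih₂ _ _ h
    exact ⟨_, _, .letIn h₁ h₂, h⟩
  | call f e ih =>
    intro ρ Q h
    obtain ⟨a, j, h₁, b, K, ⟨body, hf, k, hk, hb⟩, h⟩ := ih _ _ h
    exact ⟨_, _, .call hf h₁ hb, h k hk⟩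

/-- A function is verified by computing the weakest precondition of its body. -/
theorem Spec.of_wp {P : Program} {f : ℕ} {body : Expr} {a b : Val} {K : ℕ}
    (hf : P[f]? = some body) (h : wp P body [a] fun b' k => b' = b ∧ k ≤ K) : Spec P f a b K := by
  obtain ⟨b', k, he, rfl, hk⟩ := wp_sound P body _ _ h
  exact ⟨body, hf, k, hk, he⟩

theorem Spec.mono {P : Program} {f : ℕ} {a b : Val} {K K' : ℕ} (h : Spec P f a b K)
    (hK : K ≤ K') : Spec P f a b K' := by
  obtain ⟨body, hf, k, hk, he⟩ := h
  exact ⟨body, hf, k, hk.trans hK, he⟩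

/-! ### The program -/

namespace Fn

-- The positions of the functions in the list `program j`.

abbrev solve : ℕ := 1
abbrev ins : ℕ := 2
abbrev forget : ℕ := 3
abbrev comb : ℕ := 4
abbrev join : ℕ := 5
abbrev cross : ℕ := 6
abbrev cross₁ : ℕ := 7
abbrev addVec : ℕ := 8
abbrev pareto : ℕ := 9
abbrev lexLe : ℕ := 10
abbrev halve : ℕ := 11
abbrev merge : ℕ := 12
abbrev sort : ℕ := 13
abbrev snoc : ℕ := 14
abbrev double : ℕ := 15
abbrev mapSnd : ℕ := 16
abbrev unwrap : ℕ := 17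
abbrev wrap : ℕ := 18
abbrev selA : ℕ := 19
abbrev selB : ℕ := 20
abbrev sweep : ℕ := 21
abbrev sweepSort : ℕ := 22
abbrev filter : ℕ := 23
abbrev flatten : ℕ := 24
abbrev out : ℕ := 25

end Fn

namespace Body

open ParetoCut.Expr

/-- The innermost variable: the argument of the function, or the value of a local definition. -/
abbrev x₀ : Expr := var 0

/-- The argument of the function inside a local definition. -/
abbrev x₁ : Expr := var 1

/-- The truth value `true`; `false` is `nil`. -/
abbrev tt : Expr := pair nil nil

/-- The zero vector of length `D`. -/
def zeros : ℕ → Expr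
  | 0 => nil
  | D + 1 => pair zero (zeros D)

/-- The number `j` in unary. -/
def unary : ℕ → Expr
  | 0 => nil
  | j + 1 => pair nil (unary j)

/-- Argument `(x, y)`: the sum of two vectors, where a shorter `y` is filled up with zeros. -/
def addVec : Expr :=
  ifPair x₀.fst
    (ifPair x₀.snd
      (pair (add x₀.fst.fst x₀.snd.fst) (call Fn.addVec (pair x₀.fst.snd x₀.snd.snd)))
      x₀.fst)
    nil

/-- Argument `(x, y)`: is `x` at most `y` lexicographically? -/
def lexLe : Expr :=
  ifPair x₀.fst
    (ifPair x₀.snd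
      (ifLe x₀.fst.fst x₀.snd.fst
        (ifLe x₀.snd.fst x₀.fst.fst (call Fn.lexLe (pair x₀.fst.snd x₀.snd.snd)) tt)
        nil)
      nil)
    tt

/-- Argument `(l, l')`: the list `l`, split after half the length of `l'`. Without arithmetic on
labels, `l'` serves as the counter: two of its entries are dropped for each entry taken from `l`. -/
def halve : Expr :=
  ifPair x₀.snd
    (ifPair x₀.snd.snd
      (letIn (call Fn.halve (pair x₀.fst.snd x₀.snd.snd.snd))
        (pair (pair x₁.fst.fst x₀.fst) x₀.snd))
      (pair nil x₀.fst))
    (pair nil x₀.fst)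

/-- Argument `(l, l')`: merges two lists of items that are sorted by their keys. -/
def merge : Expr :=
  ifPair x₀.fst
    (ifPair x₀.snd
      (ifPair (call Fn.lexLe (pair x₀.fst.fst.fst x₀.snd.fst.fst))
        (pair x₀.fst.fst (call Fn.merge (pair x₀.fst.snd x₀.snd)))
        (pair x₀.snd.fst (call Fn.merge (pair x₀.fst x₀.snd.snd))))
      x₀.fst)
    x₀.snd

/-- Sorts a list of items by their keys. -/
def sort : Expr :=
  ifPair x₀
    (ifPair x₀.snd
      (letIn (call Fn.halve (pair x₀ x₀))
        (call Fn.merge (pair (call Fn.sort x₀.fst) (call Fn.sort x₀.snd))))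
      x₀)
    x₀

/-- Appends a zero to a vector. -/
def snoc : Expr :=
  ifPair x₀ (pair x₀.fst (call Fn.snoc x₀.snd)) (pair zero nil)

/-- Replaces each solution of a list by a victim, which may turn out to be dominated, and a killer,
which may dominate others. Both consist of a sorting key and an element for `filter`, and that
element consists of its own key, the tag (`true` for killers) and the solution as payload. -/
def double : Expr :=
  ifPair x₀
    (pair (pair x₀.fst.fst (pair (call Fn.snoc x₀.fst.fst.snd) (pair nil x₀.fst)))
      (pair (pair (call Fn.snoc x₀.fst.fst) (pair x₀.fst.fst.snd (pair tt x₀.fst)))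
        (call Fn.double x₀.snd)))
    nil

/-- The second components of the items of a list. -/
def mapSnd : Expr :=
  ifPair x₀ (pair x₀.fst.snd (call Fn.mapSnd x₀.snd)) nil

/-- Argument `(l, l')`: the payloads of the elements of `l`, followed by `l'`. -/
def unwrap : Expr :=
  ifPair x₀.fst (pair x₀.fst.fst.snd.snd (call Fn.unwrap (pair x₀.fst.snd x₀.snd))) x₀.snd

/-- Makes each element of a list the payload of an element whose key lacks the first coordinate. -/
def wrap : Expr :=
  ifPair x₀
    (pair (pair x₀.fst.fst.snd (pair x₀.fst.snd.fst x₀.fst)) (call Fn.wrap x₀.snd)) nil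

/-- Argument `(l, l')`: the killers of `l`, followed by `l'`. -/
def selA : Expr :=
  ifPair x₀.fst
    (ifPair x₀.fst.fst.snd.fst
      (pair x₀.fst.fst (call Fn.selA (pair x₀.fst.snd x₀.snd)))
      (call Fn.selA (pair x₀.fst.snd x₀.snd)))
    x₀.snd

/-- The victims of a list. -/
def selB : Expr :=
  ifPair x₀
    (ifPair x₀.fst.snd.fst (call Fn.selB x₀.snd) (pair x₀.fst (call Fn.selB x₀.snd)))
    nil

/-- The part of `sweep` that deals with the first element of the second list. -/
def sweepStep : Expr :=
  letIn (call Fn.sweep (pair x₀.fst (pair x₀.snd.fst.snd x₀.snd.snd)))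
    (ifPair x₁.snd.fst.fst.snd.fst
      (pair x₁.snd.fst.fst x₀)
      (ifPair x₁.snd.snd
        (ifLe x₁.snd.snd.fst x₁.snd.fst.fst.fst.snd.fst x₀ (pair x₁.snd.fst.fst x₀))
        (pair x₁.snd.fst.fst x₀)))

/-- Argument `(l, l', m)`: merges two lists that are sorted by their first coordinates, and
removes the victims of `l'` whose second coordinate is not below `m` and not below those of all
killers of `l` that come earlier. -/
def sweep : Expr :=
  ifPair x₀.fst
    (ifPair x₀.snd.fst
      (ifLe x₀.fst.fst.fst.fst x₀.snd.fst.fst.fst.fst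
        (pair x₀.fst.fst
          (call Fn.sweep (pair x₀.fst.snd (pair x₀.snd.fst
            (ifPair x₀.fst.fst.snd.fst
              (ifPair x₀.snd.snd
                (ifLe x₀.snd.snd.fst x₀.fst.fst.fst.snd.fst x₀.snd.snd
                  (pair x₀.fst.fst.fst.snd.fst nil))
                (pair x₀.fst.fst.fst.snd.fst nil))
              x₀.snd.snd)))))
        sweepStep)
      x₀.fst)
    (ifPair x₀.snd.fst sweepStep nil)

/-- Sorts a list by the first coordinate, and removes the victims that have a killer before them
in the list that is at most as large in the first two coordinates. -/
def sweepSort : Expr :=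
  ifPair x₀
    (ifPair x₀.snd
      (letIn (call Fn.halve (pair x₀ x₀))
        (call Fn.sweep (pair (call Fn.sweepSort x₀.fst) (pair (call Fn.sweepSort x₀.snd) nil))))
      x₀)
    x₀

/-- Argument `(j, l)`: the victims of `l` that have no killer before them in the list which is at
most as large in all of the `j + 2` coordinates. -/
def filter : Expr :=
  ifPair x₀.fst
    (ifPair x₀.snd
      (ifPair x₀.snd.snd
        (letIn (call Fn.halve (pair x₀.snd x₀.snd))
          (call Fn.unwrap
            (pair
              (call Fn.filter (pair x₁.fst.snd
                (call Fn.wrap (call Fn.sort (call Fn.selA (pair x₀.fst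
                  (call Fn.filter (pair x₁.fst x₀.snd))))))))
              (call Fn.filter (pair x₁.fst x₀.fst)))))
        (call Fn.selB x₀.snd))
      nil)
    (call Fn.selB (call Fn.sweepSort x₀.snd))

/-- The Pareto-optimal solutions of a list, for vectors of length `j + 3`. -/
def pareto (j : ℕ) : Expr :=
  call Fn.unwrap
    (pair (call Fn.filter (pair (unary j) (call Fn.mapSnd (call Fn.sort (call Fn.double x₀)))))
      nil)

/-- Argument `(a, l, l')`: the combinations of `a` with the solutions of `l`, followed by `l'`. -/
def cross₁ : Expr :=
  ifPair x₀.snd.fst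
    (pair
      (pair (call Fn.addVec (pair x₀.fst.fst x₀.snd.fst.fst.fst))
        (pair nil (pair x₀.fst.snd x₀.snd.fst.fst.snd)))
      (call Fn.cross₁ (pair x₀.fst (pair x₀.snd.fst.snd x₀.snd.snd))))
    x₀.snd.snd

/-- Argument `(l, l')`: all combinations of a solution of `l` with a solution of `l'`. -/
def cross : Expr :=
  ifPair x₀.fst
    (call Fn.cross₁ (pair x₀.fst.fst
      (pair x₀.snd (call Fn.cross (pair x₀.fst.snd x₀.snd)))))
    nil

/-- Argument `(t, t')`: the table of a join node. -/
def join : Expr :=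
  ifPair x₀.fst.fst
    (pair x₀.fst.fst
      (pair (call Fn.join (pair x₀.fst.snd.fst x₀.snd.snd.fst))
        (call Fn.join (pair x₀.fst.snd.snd x₀.snd.snd.snd))))
    (pair nil (call Fn.pareto (call Fn.cross (pair x₀.fst.snd x₀.snd.snd))))

/-- Argument `(v, t)`: the table of a node that introduces `v`. -/
def ins : Expr :=
  ifPair x₀.snd.fst
    (ifLe x₀.fst x₀.snd.fst.fst
      (pair (pair x₀.fst nil) (pair x₀.snd x₀.snd))
      (pair x₀.snd.fst
        (pair (call Fn.ins (pair x₀.fst x₀.snd.snd.fst))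
          (call Fn.ins (pair x₀.fst x₀.snd.snd.snd)))))
    (pair (pair x₀.fst nil) (pair x₀.snd x₀.snd))

/-- Argument `(r, v, x, y, t, t')`: combines the tables `t` for the solutions without `v` and `t'`
for those with `v`. The vectors `x` and `y` are the costs of the edges at `v` seen so far that are
cut without and with `v`, and `r` is the row of `v`. -/
def comb : Expr :=
  ifPair x₀.snd.snd.snd.snd.fst.fst
    (letIn (read x₀.fst x₀.snd.snd.snd.snd.fst.fst.fst)
      (pair x₁.snd.snd.snd.snd.fst.fst
        (pair
          (call Fn.comb (pair x₁.fst (pair x₁.snd.fst (pair x₁.snd.snd.fst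
            (pair (call Fn.addVec (pair x₁.snd.snd.snd.fst x₀))
              (pair x₁.snd.snd.snd.snd.fst.snd.fst x₁.snd.snd.snd.snd.snd.snd.fst))))))
          (call Fn.comb (pair x₁.fst (pair x₁.snd.fst
            (pair (call Fn.addVec (pair x₁.snd.snd.fst x₀)) (pair x₁.snd.snd.snd.fst
              (pair x₁.snd.snd.snd.snd.fst.snd.snd x₁.snd.snd.snd.snd.snd.snd.snd)))))))))
    (pair nil
      (call Fn.pareto
        (call Fn.cross₁ (pair (pair x₀.snd.snd.fst nil) (pair x₀.snd.snd.snd.snd.fst.snd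
          (call Fn.cross₁ (pair
            (pair x₀.snd.snd.snd.fst (pair (pair x₀.snd.fst nil) nil))
            (pair x₀.snd.snd.snd.snd.snd.snd nil))))))))

/-- Argument `(r, v, x, y, t)`: the table of a node that forgets `v`, where `t` is (a part of) the
table of its child, and `r`, `x`, `y` are as for `comb`. -/
def forget : Expr :=
  ifLe x₀.snd.fst x₀.snd.snd.snd.snd.fst.fst
    (call Fn.comb (pair x₀.fst (pair x₀.snd.fst (pair x₀.snd.snd.fst (pair x₀.snd.snd.snd.fst
      x₀.snd.snd.snd.snd.snd)))))
    (letIn (read x₀.fst x₀.snd.snd.snd.snd.fst.fst)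
      (pair x₁.snd.snd.snd.snd.fst
        (pair
          (call Fn.forget (pair x₁.fst (pair x₁.snd.fst (pair x₁.snd.snd.fst
            (pair (call Fn.addVec (pair x₁.snd.snd.snd.fst x₀))
              x₁.snd.snd.snd.snd.snd.fst)))))
          (call Fn.forget (pair x₁.fst (pair x₁.snd.fst
            (pair (call Fn.addVec (pair x₁.snd.snd.fst x₀)) (pair x₁.snd.snd.snd.fst
              x₁.snd.snd.snd.snd.snd.snd))))))))

/-- Argument `(g, t)`: the table of the root of the tree decomposition `t` of the graph `g`. -/
def solve (D : ℕ) : Expr :=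
  ifLe x₀.snd.fst (label 0)
    (pair nil (pair (pair (zeros D) nil) nil))
    (ifLe x₀.snd.fst (label 1)
      (call Fn.ins (pair x₀.snd.snd.fst (call Fn.solve (pair x₀.fst x₀.snd.snd.snd))))
      (ifLe x₀.snd.fst (label 2)
        (call Fn.forget
          (pair (read x₀.fst.fst x₀.snd.snd.fst) (pair x₀.snd.snd.fst
            (pair (call Fn.addVec (pair (zeros D) (read x₀.fst.snd.fst x₀.snd.snd.fst)))
              (pair (call Fn.addVec (pair (zeros D) (read x₀.fst.snd.snd.fst x₀.snd.snd.fst)))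
                (call Fn.solve (pair x₀.fst x₀.snd.snd.snd)))))))
        (call Fn.join
          (pair (call Fn.solve (pair x₀.fst x₀.snd.snd.fst))
            (call Fn.solve (pair x₀.fst x₀.snd.snd.snd))))))

/-- Argument `(t, l)`: the list of the elements of the set represented by `t`, followed by `l`. -/
def flatten : Expr :=
  ifPair x₀.fst
    (ifPair x₀.fst.fst
      (pair x₀.fst.fst.fst x₀.snd)
      (call Fn.flatten (pair x₀.fst.snd.fst (call Fn.flatten (pair x₀.fst.snd.snd x₀.snd)))))
    x₀.snd

/-- Writes out the sets of a list of solutions. -/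
def out : Expr :=
  ifPair x₀ (pair (call Fn.flatten (pair x₀.fst.snd nil)) (call Fn.out x₀.snd)) nil

/-- The main function. -/
def main : Expr :=
  call Fn.out (snd (call Fn.solve x₀))

end Body

/-- The program for vectors of length `j + 3`. -/
def program (j : ℕ) : Program :=
  [Body.main, Body.solve (j + 3), Body.ins, Body.forget, Body.comb, Body.join, Body.cross,
    Body.cross₁, Body.addVec, Body.pareto j, Body.lexLe, Body.halve, Body.merge, Body.sort,
    Body.snoc, Body.double, Body.mapSnd, Body.unwrap, Body.wrap, Body.selA, Body.selB, Body.sweep,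
    Body.sweepSort, Body.filter, Body.flatten, Body.out]

/-! ### Vectors and lists -/

/-- A vector as a value. -/
def encR (x : List ℝ) : Val := .ofList (x.map .real)

/-- A list as a value, for a given encoding of the entries. -/
def encL {α : Type*} (enc : α → Val) (l : List α) : Val := .ofList (l.map enc)

/-- A truth value as a value. -/
def encB (b : Bool) : Val := if b then .pair .nil .nil else .nil

@[simp] theorem encR_nil : encR [] = .nil := rfl
@[simp] theorem encR_cons (x : ℝ) (l : List ℝ) : encR (x :: l) = .pair (.real x) (encR l) := rfl
@[simp] theorem encB_true : encB true = .pair .nil .nil := rfl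
@[simp] theorem encB_false : encB false = .nil := rfl

section
variable {α : Type*}

@[simp] theorem encL_nil (enc : α → Val) : encL enc [] = .nil := rfl
@[simp] theorem encL_cons (enc : α → Val) (x : α) (l : List α) :
    encL enc (x :: l) = .pair (enc x) (encL enc l) := rfl

theorem encL_congr {enc enc' : α → Val} {l : List α} (h : ∀ x ∈ l, enc x = enc' x) :
    encL enc l = encL enc' l := by
  unfold encL
  rw [List.map_congr_left h]
end

/-- The sum of vectors, where the second one is filled up with zeros. -/
def addL : List ℝ → List ℝ → List ℝ
  | x :: l, y :: l' => (x + y) :: addL l l'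
  | x :: l, [] => x :: l
  | [], _ => []

theorem spec_addVec (j : ℕ) (l : List ℝ) : ∀ l' : List ℝ,
    Spec (program j) Fn.addVec (.pair (encR l) (encR l')) (encR (addL l l'))
      (30 * (l.length + 1)) := by
  induction l with
  | nil =>
    intro l'
    apply Spec.of_wp (body := Body.addVec) rfl
    simp [Body.addVec, wp, addL]
  | cons x l ih =>
    intro l'
    apply Spec.of_wp (body := Body.addVec) rfl
    cases l' with
    | nil => simp [Body.addVec, wp, addL]; omega
    | cons y l' =>
      simp [Body.addVec, wp, addL]
      refine .mk (ih l') fun k hk => ⟨rfl, ?_⟩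
      omega

/-! ### Sorting -/

/-- The lexicographic order of vectors. -/
def LexLE : List ℝ → List ℝ → Prop
  | [], _ => True
  | _ :: _, [] => False
  | x :: l, y :: l' => x < y ∨ x = y ∧ LexLE l l'

theorem LexLE.total (l : List ℝ) : ∀ l', LexLE l l' ∨ LexLE l' l := by
  induction l with
  | nil => exact fun _ => .inl trivial
  | cons x l ih =>
    rintro (_ | ⟨y, l'⟩)
    · exact .inr trivial
    · rcases lt_trichotomy x y with h | rfl | h
      · exact .inl (.inl h)
      · exact (ih l').imp (fun h => .inr ⟨rfl, h⟩) fun h => .inr ⟨rfl, h⟩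
      · exact .inr (.inl h)

theorem LexLE.trans : ∀ {l₁ l₂ l₃ : List ℝ}, LexLE l₁ l₂ → LexLE l₂ l₃ → LexLE l₁ l₃
  | [], _, _, _, _ => trivial
  | _ :: _, _ :: _, _ :: _, .inl h, .inl h' => .inl (h.trans h')
  | _ :: _, _ :: _, _ :: _, .inl h, .inr ⟨h', _⟩ => .inl (h' ▸ h)
  | _ :: _, _ :: _, _ :: _, .inr ⟨h, _⟩, .inl h' => .inl (h ▸ h')
  | _ :: _, _ :: _, _ :: _, .inr ⟨h, k⟩, .inr ⟨h', k'⟩ => .inr ⟨h.trans h', k.trans k'⟩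

theorem LexLE.antisymm : ∀ {l l' : List ℝ}, LexLE l l' → LexLE l' l → l = l'
  | [], [], _, _ => rfl
  | _ :: _, _ :: _, .inl h, .inl h' => absurd h' h.not_gt
  | _ :: _, _ :: _, .inl h, .inr ⟨h', _⟩ => absurd h' h.ne'
  | _ :: _, _ :: _, .inr ⟨h, _⟩, .inl h' => absurd h h'.ne'
  | _ :: _, _ :: _, .inr ⟨h, k⟩, .inr ⟨_, k'⟩ => by rw [h, k.antisymm k']

open Classical in
theorem spec_lexLe (j : ℕ) (l : List ℝ) : ∀ l' : List ℝ,
    Spec (program j) Fn.lexLe (.pair (encR l) (encR l')) (encB (decide (LexLE l l')))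
      (30 * (l.length + 1)) := by
  induction l with
  | nil =>
    intro l'
    apply Spec.of_wp (body := Body.lexLe) rfl
    rw [decide_eq_true (p := LexLE [] l') trivial]
    simp [Body.lexLe, wp]
  | cons x l ih =>
    intro l'
    apply Spec.of_wp (body := Body.lexLe) rfl
    cases l' with
    | nil =>
      rw [decide_eq_false (p := LexLE (x :: l) []) id]
      simp [Body.lexLe, wp]
      omega
    | cons y l' =>
      simp only [Body.lexLe, wp, encR_cons]
      simp
      refine ⟨fun h => ⟨fun h' => ?_, fun h' => ?_⟩, fun h => ?_⟩
      · obtain rfl := le_antisymm h h'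
        refine .mk (ih l') fun k hk => ⟨by simp [LexLE], by omega⟩
      · exact ⟨by simp [LexLE, h'], by omega⟩
      · exact ⟨by simp [LexLE, h.not_gt, h.ne'], by omega⟩

section
variable {α β : Type*}

theorem spec_halve (j : ℕ) (enc : α → Val) (enc' : β → Val) : ∀ (l : List α) (l' : List β),
    l'.length / 2 ≤ l.length →
    Spec (program j) Fn.halve (.pair (encL enc l) (encL enc' l'))
      (.pair (encL enc (l.take (l'.length / 2))) (encL enc (l.drop (l'.length / 2))))
      (30 * (l'.length + 1))
  | l, [], _ => by
    apply Spec.of_wp (body := Body.halve) rfl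
    simp [Body.halve, wp]
  | l, [x], _ => by
    apply Spec.of_wp (body := Body.halve) rfl
    simp [Body.halve, wp]
  | [], _ :: _ :: _, h => by simp at h
  | a :: l, x :: y :: l', h => by
    have h2 : (x :: y :: l').length / 2 = l'.length / 2 + 1 := by simp; omega
    rw [h2] at h ⊢
    apply Spec.of_wp (body := Body.halve) rfl
    have ih := spec_halve j enc enc' l l' (by simpa using h)
    simp [Body.halve, wp]
    refine .mk ih fun k hk => ?_
    simp
    omega

/-- The items that sorting works on: the encoding of a key, followed by something else. -/
def encItem (key : α → List ℝ) (rest : α → Val) (x : α) : Val := .pair (encR (key x)) (rest x)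

theorem spec_merge (j E : ℕ) (key : α → List ℝ) (rest : α → Val) (l : List α) : ∀ l' : List α,
    (∀ x ∈ l, (key x).length ≤ E) →
    l.Pairwise (fun x y => LexLE (key x) (key y)) →
    l'.Pairwise (fun x y => LexLE (key x) (key y)) →
    ∃ r : List α, r.Perm (l ++ l') ∧ r.Pairwise (fun x y => LexLE (key x) (key y)) ∧
      Spec (program j) Fn.merge
        (.pair (encL (encItem key rest) l) (encL (encItem key rest) l'))
        (encL (encItem key rest) r) (100 * (E + 1) * (l.length + l'.length + 1)) := by
  classical
  induction l with
  | nil =>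
    intro l' _ _ hl'
    refine ⟨l', by simp, hl', ?_⟩
    apply Spec.of_wp (body := Body.merge) rfl
    simp [Body.merge, wp]
    nlinarith
  | cons x l ihl =>
    intro l'
    induction l' with
    | nil =>
      intro _ hl _
      refine ⟨x :: l, by simp, hl, ?_⟩
      apply Spec.of_wp (body := Body.merge) rfl
      simp [Body.merge, wp]
      nlinarith
    | cons y l' ihl' =>
      intro hE hl hl'
      have hx := hE x (by simp)
      by_cases h : LexLE (key x) (key y)
      · obtain ⟨r, hr, hs, hc⟩ := ihl (y :: l') (fun z hz => hE z (by simp [hz])) hl.of_cons hl'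
        refine ⟨x :: r, by simpa using hr, ?_, ?_⟩
        · refine List.pairwise_cons.2 ⟨fun z hz => ?_, hs⟩
          rcases List.mem_append.1 (hr.mem_iff.1 hz) with hz | hz
          · exact List.rel_of_pairwise_cons hl hz
          · rcases List.mem_cons.1 hz with rfl | hz
            · exact h
            · exact h.trans (List.rel_of_pairwise_cons hl' hz)
        · apply Spec.of_wp (body := Body.merge) rfl
          simp only [encL_cons] at hc
          simp [Body.merge, wp, encItem]
          refine .mk (spec_lexLe j _ _) fun k hk => ?_
          simp [h]
          refine .mk hc fun k' hk' => ?_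
          simp at hk' ⊢
          nlinarith
      · have h' := (LexLE.total (key x) (key y)).resolve_left h
        obtain ⟨r, hr, hs, hc⟩ := ihl' hE hl hl'.of_cons
        refine ⟨y :: r, ?_, ?_, ?_⟩
        · exact (hr.cons y).trans List.perm_middle.symm
        · refine List.pairwise_cons.2 ⟨fun z hz => ?_, hs⟩
          rcases List.mem_append.1 (hr.mem_iff.1 hz) with hz | hz
          · rcases List.mem_cons.1 hz with rfl | hz
            · exact h'
            · exact h'.trans (List.rel_of_pairwise_cons hl hz)
          · exact List.rel_of_pairwise_cons hl' hz
        · apply Spec.of_wp (body := Body.merge) rfl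
          simp only [encL_cons] at hc
          simp [Body.merge, wp, encItem]
          refine .mk (spec_lexLe j _ _) fun k hk => ?_
          simp [h]
          refine .mk hc fun k' hk' => ?_
          simp at hk' ⊢
          nlinarith

/-- Merge sort takes time `O(m log m)`; the logarithm enters through `m ≤ 2 ^ t`. -/
theorem spec_sort (j E : ℕ) (key : α → List ℝ) (rest : α → Val) (t : ℕ) : ∀ l : List α,
    (∀ x ∈ l, (key x).length ≤ E) → l.length ≤ 2 ^ t →
    ∃ r : List α, r.Perm l ∧ r.Pairwise (fun x y => LexLE (key x) (key y)) ∧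
      Spec (program j) Fn.sort (encL (encItem key rest) l) (encL (encItem key rest) r)
        (300 * (E + 1) * (max l.length 1 * (t + 1))) := by
  induction t with
  | zero =>
    intro l _ hl
    refine ⟨l, .refl _, ?_, ?_⟩
    · match l, hl with
      | [], _ => simp
      | [x], _ => simp
    · apply Spec.of_wp (body := Body.sort) rfl
      match l, hl with
      | [], _ => simp [Body.sort, wp]; nlinarith
      | [x], _ => simp [Body.sort, wp]; nlinarith
  | succ t ih =>
    intro l hE hl
    rcases Nat.lt_or_ge l.length 2 with h2 | h2
    · refine ⟨l, .refl _, ?_, ?_⟩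
      · match l, h2 with
        | [], _ => simp
        | [x], _ => simp
      · apply Spec.of_wp (body := Body.sort) rfl
        match l, h2 with
        | [], _ => simp [Body.sort, wp]; nlinarith
        | [x], _ => simp [Body.sort, wp]; nlinarith
    · set h := l.length / 2 with hh
      have e₁ : (l.take h).length = h := by simp; omega
      have e₂ : (l.drop h).length = l.length - h := by simp
      rw [pow_succ] at hl
      obtain ⟨r₁, p₁, s₁, c₁⟩ := ih (l.take h) (fun x hx => hE x (List.mem_of_mem_take hx))
        (by omega)
      obtain ⟨r₂, p₂, s₂, c₂⟩ := ih (l.drop h) (fun x hx => hE x (List.mem_of_mem_drop hx))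
        (by omega)
      obtain ⟨r, p, s, c⟩ := spec_merge j E key rest r₁ r₂
        (fun x hx => hE x (List.mem_of_mem_take (p₁.mem_iff.1 hx))) s₁ s₂
      have hd := spec_halve j (encItem key rest) (encItem key rest) l l (by omega)
      refine ⟨r, p.trans ((p₁.append p₂).trans (by simp)), s, ?_⟩
      apply Spec.of_wp (body := Body.sort) rfl
      rw [p₁.length_eq, p₂.length_eq, e₁, e₂] at c
      rw [e₁, max_eq_left (by omega)] at c₁
      rw [e₂, max_eq_left (by omega)] at c₂
      obtain ⟨m₂, hm₂⟩ : ∃ m₂, m₂ = l.length - h := ⟨_, rfl⟩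
      have hm : l.length = h + m₂ := by omega
      rw [← hm₂] at c c₂
      rw [max_eq_left (by omega), hm]
      rw [← hh, hm] at hd
      have h1 : 1 ≤ h := by omega
      clear_value h
      match l, h2 with
      | x :: y :: l, _ =>
        simp [Body.sort, wp]
        simp only [encL_cons] at hd
        refine .mk hd fun k hk => ?_
        simp
        refine .mk c₁ fun k₁ hk₁ => ?_
        refine .mk c₂ fun k₂ hk₂ => ?_
        refine .mk c fun k₃ hk₃ => ⟨rfl, ?_⟩
        clear hd c₁ c₂ c hE hl e₁ e₂ hm hm₂ hh
        nlinarith [Nat.zero_le (E * (h + m₂)), Nat.zero_le E]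
end

/-! ### Removing victims -/

section
variable {α : Type*}

open Classical in
/-- The elements `x` of a list with `tag x = false` (the victims) for which there is no `a` with
`tag a = true` (a killer) and `R a x` that precedes `x` in the list or belongs to `s`. -/
noncomputable def survivors (R : α → α → Prop) (tag : α → Bool) : Set α → List α → List α
  | _, [] => []
  | s, x :: l =>
    if tag x = false ∧ ¬ ∃ a ∈ s, tag a = true ∧ R a x then
      x :: survivors R tag (insert x s) l
    else survivors R tag (insert x s) l

variable (R : α → α → Prop) (tag : α → Bool)

theorem survivors_append (l₁ l₂ : List α) : ∀ s : Set α,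
    survivors R tag s (l₁ ++ l₂) =
      survivors R tag s l₁ ++ survivors R tag (s ∪ {x | x ∈ l₁}) l₂ := by
  induction l₁ with
  | nil => intro s; simp [survivors]
  | cons x l ih =>
    intro s
    have : insert x s ∪ {y | y ∈ l} = s ∪ {y | y ∈ x :: l} := by
      ext y; simp; tauto
    simp only [List.cons_append, survivors, ih, this]
    split_ifs <;> simp

open Classical in
theorem survivors_union (s' : Set α) (l : List α) : ∀ s : Set α,
    survivors R tag (s ∪ s') l =
      (survivors R tag s l).filter fun x => ¬ ∃ a ∈ s', tag a = true ∧ R a x := by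
  induction l with
  | nil => intro s; simp [survivors]
  | cons x l ih =>
    intro s
    have h : insert x (s ∪ s') = insert x s ∪ s' := by ext y; simp; tauto
    simp only [survivors, h, ih]
    by_cases h₀ : tag x = false
    · by_cases h₁ : ∃ a ∈ s, tag a = true ∧ R a x
      · have h₂ : ∃ a ∈ s ∪ s', tag a = true ∧ R a x := by
          obtain ⟨a, ha, h⟩ := h₁; exact ⟨a, .inl ha, h⟩
        simp only [h₀, h₁, h₂, not_true_eq_false, and_false, if_false]
      · by_cases h₂ : ∃ a ∈ s', tag a = true ∧ R a x
        · have h₃ : ∃ a ∈ s ∪ s', tag a = true ∧ R a x := by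
            obtain ⟨a, ha, h⟩ := h₂; exact ⟨a, .inr ha, h⟩
          rw [if_neg fun h => h.2 h₃, if_pos ⟨h₀, h₁⟩, List.filter_cons_of_neg (by simpa using h₂)]
        · have h₃ : ¬ ∃ a ∈ s ∪ s', tag a = true ∧ R a x := by
            rintro ⟨a, ha | ha, h⟩
            exacts [h₁ ⟨a, ha, h⟩, h₂ ⟨a, ha, h⟩]
          rw [if_pos ⟨h₀, h₃⟩, if_pos ⟨h₀, h₁⟩, List.filter_cons_of_pos (by simpa using h₂)]
    · rw [if_neg fun h => h₀ h.1, if_neg fun h => h₀ h.1]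

theorem mem_of_mem_survivors {x : α} {l : List α} : ∀ {s : Set α},
    x ∈ survivors R tag s l → x ∈ l ∧ tag x = false := by
  induction l with
  | nil => intro s h; simp [survivors] at h
  | cons y l ih =>
    intro s h
    rw [survivors] at h
    split_ifs at h with hy
    · rcases List.mem_cons.1 h with rfl | h
      · exact ⟨by simp, hy.1⟩
      · exact ⟨by simp [(ih h).1], (ih h).2⟩
    · exact ⟨by simp [(ih h).1], (ih h).2⟩

theorem length_survivors_le (l : List α) : ∀ s : Set α,
    (survivors R tag s l).length + (l.filter fun x => tag x).length ≤ l.length := by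
  induction l with
  | nil => intro s; simp [survivors]
  | cons y l ih =>
    intro s
    have := ih (insert y s)
    rw [survivors]
    split_ifs with hy
    · simp [hy.1]; omega
    · by_cases h : tag y = true <;> simp [h] <;> omega

open Classical in
theorem survivors_congr {R' : α → α → Prop} {l : List α} : ∀ {s : Set α},
    (∀ a, a ∈ s ∨ a ∈ l → ∀ b ∈ l, tag a = true → tag b = false → (R a b ↔ R' a b)) →
    survivors R tag s l = survivors R' tag s l := by
  induction l with
  | nil => intro s _; simp [survivors]
  | cons y l ih =>
    intro s h
    have h₁ : tag y = false →
        ((∃ a ∈ s, tag a = true ∧ R a y) ↔ ∃ a ∈ s, tag a = true ∧ R' a y) := by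
      refine fun hy => exists_congr fun a => and_congr_right fun ha => and_congr_right fun h' => ?_
      exact h a (.inl ha) y (by simp) h' hy
    have h₂ : survivors R tag (insert y s) l = survivors R' tag (insert y s) l := by
      refine ih fun a ha b hb => h a ?_ b (by simp [hb])
      rcases ha with (rfl | ha) | ha
      · simp
      · simp [ha]
      · simp [ha]
    rw [survivors, survivors, h₂]
    exact if_congr (and_congr_right fun hy => not_congr (h₁ hy)) rfl rfl

open Classical in
/-- If the order of the list takes care of the difference between `R` and `R'`, then the survivors
with respect to `R'` and earlier killers are those with respect to `R` and all killers. -/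
theorem survivors_eq_filter {R' : α → α → Prop} {l : List α} : ∀ {s : Set α},
    (∀ a ∈ s, ∀ b ∈ l, tag a = true → tag b = false → (R' a b ↔ R a b)) →
    l.Pairwise (fun x y => (tag x = true → tag y = false → (R' x y ↔ R x y)) ∧
      (tag y = true → tag x = false → ¬ R y x)) →
    survivors R' tag s l =
      l.filter fun x => tag x = false ∧ ¬ ∃ a, (a ∈ s ∨ a ∈ l) ∧ tag a = true ∧ R a x := by
  induction l with
  | nil => intro s _ _; simp [survivors]
  | cons y l ih =>
    intro s hs hl
    rw [List.pairwise_cons] at hl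
    have h₁ : tag y = false → ((∃ a ∈ s, tag a = true ∧ R' a y) ↔
        ∃ a, (a ∈ s ∨ a ∈ y :: l) ∧ tag a = true ∧ R a y) := by
      intro hy
      constructor
      · rintro ⟨a, ha, h, h'⟩
        exact ⟨a, .inl ha, h, (hs a ha y (by simp) h hy).1 h'⟩
      · rintro ⟨a, ha | ha, h, h'⟩
        · exact ⟨a, ha, h, (hs a ha y (by simp) h hy).2 h'⟩
        · rcases List.mem_cons.1 ha with rfl | ha
          · simp [hy] at h
          · exact absurd h' ((hl.1 a ha).2 h hy)
    have h₂ := ih (s := insert y s) (by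
      rintro a (rfl | ha) b hb
      · exact (hl.1 b hb).1
      · exact hs a ha b (by simp [hb])) hl.2
    have h₃ : ∀ x, (∃ a, (a ∈ insert y s ∨ a ∈ l) ∧ tag a = true ∧ R a x) ↔
        ∃ a, (a ∈ s ∨ a ∈ y :: l) ∧ tag a = true ∧ R a x := by
      refine fun x => exists_congr fun a => and_congr_left fun _ => ?_
      simp; tauto
    simp only [h₃] at h₂
    rw [survivors, h₂, List.filter_cons]
    by_cases hy : tag y = false
    · simp only [hy, h₁ hy, decide_eq_true_eq]
    · rw [if_neg fun h => hy h.1, if_neg (by simp [hy])]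

/-! ### Two coordinates: a sweep fused with merge sort -/

/-- A bound that may be missing, as a value. -/
def encO : Option ℝ → Val
  | none => .nil
  | some m => .pair (.real m) .nil

/-- Elements with a key of two or more coordinates, a tag and a payload. -/
def encPt (h s : α → ℝ) (rest : α → Val) (tag : α → Bool) (pay : α → Val) (x : α) : Val :=
  .pair (.pair (.real (h x)) (.pair (.real (s x)) (rest x))) (.pair (encB (tag x)) (pay x))

/-- The condition under which the sweep keeps an element. -/
def Keep (s : α → ℝ) (tag : α → Bool) (μ : Option ℝ) (y : α) : Prop :=
  tag y = true ∨ ∀ m ∈ μ, s y < m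

variable (h s : α → ℝ) (rest pay : α → Val)

open Classical in
/-- The part of a sweep that moves on in the second list: `r` stands for the result of the recursive
call, in front of which `y` is kept or not. -/
theorem wp_sweepStep (j K : ℕ) (x' Y : Val) (y : α) (μ : Option ℝ) (r : List α)
    (Q : Val → ℕ → Prop)
    (hs : Spec (program j) Fn.sweep (.pair x' (.pair Y (encO μ)))
      (encL (encPt h s rest tag pay) r) K)
    (hQ : ∀ k ≤ K + 60, Q (encL (encPt h s rest tag pay)
      (if Keep s tag μ y then y :: r else r)) k) :
    wp (program j) Body.sweepStep
      [.pair x' (.pair (.pair (encPt h s rest tag pay y) Y) (encO μ))] Q := by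
  by_cases ht : tag y = true
  · have hk : Keep s tag μ y := .inl ht
    simp [Body.sweepStep, wp, encPt, ht]
    refine .mk hs fun k hk' => ?_
    have := hQ (k + 50) (by omega)
    simp [hk, encPt, ht] at hQ ⊢
    exact hQ _ (by omega)
  · cases μ with
    | none =>
      have hk : Keep s tag none y := .inr (by simp)
      simp [Body.sweepStep, wp, encPt, ht, encO]
      refine .mk hs fun k hk' => ?_
      simp [hk, encPt, ht] at hQ ⊢
      exact hQ _ (by omega)
    | some m =>
      simp [Body.sweepStep, wp, encPt, ht, encO]
      refine .mk hs fun k hk' => ?_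
      by_cases hm : m ≤ s y
      · have hk : ¬ Keep s tag (some m) y := by simp [Keep, ht, hm]
        simp [hk, hm, hm.not_gt] at hQ ⊢
        exact hQ _ (by omega)
      · have hk : Keep s tag (some m) y := .inr (by simpa using hm)
        simp [hk, hm, not_le.1 hm, encPt, ht] at hQ ⊢
        exact hQ _ (by omega)

/-- `y` has a killer in `l`, or it is above the bound `μ` left by earlier killers. -/
def Killed (μ : Option ℝ) (l : List α) (y : α) : Prop :=
  (∃ m ∈ μ, m ≤ s y) ∨ ∃ a ∈ l, tag a = true ∧ h a ≤ h y ∧ s a ≤ s y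

open Classical in
/-- A sweep with an exhausted first list: the bound `μ` does not change any more. -/
theorem spec_sweep_nil (j : ℕ) (μ : Option ℝ) (l' : List α) :
    l'.Pairwise (fun x y => h x ≤ h y) →
    Spec (program j) Fn.sweep (.pair .nil
        (.pair (encL (encPt h s rest tag pay) l') (encO μ)))
      (encL (encPt h s rest tag pay) (l'.filter fun y => Keep s tag μ y))
      (100 * (l'.length + 1)) := by
  induction l' with
  | nil =>
    intro _
    apply Spec.of_wp (body := Body.sweep) rfl
    simp [Body.sweep, wp]
  | cons y l' ih =>
    intro hl
    apply Spec.of_wp (body := Body.sweep) rfl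
    simp [Body.sweep, wp]
    refine wp_sweepStep tag h s rest pay j _ _ _ y μ _ _ (ih hl.of_cons) fun k hk => ⟨?_, ?_⟩
    · rw [List.filter_cons]
      simp only [decide_eq_true_eq]
    · omega

open Classical in
/-- The sweep merges two lists sorted by `h`. Whatever precedes `y` in the merged list is at most as
large in the coordinate `h`, so that `y` has a killer in `l` if and only if the minimum of `s` over
the killers seen so far, which is the bound `μ`, is at most `s y`. -/
theorem spec_sweep (j : ℕ) (l : List α) : ∀ (l' : List α) (μ : Option ℝ),
    l.Pairwise (fun x y => h x ≤ h y) → l'.Pairwise (fun x y => h x ≤ h y) →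
    ∃ r : List α,
      r.Perm (l ++ l'.filter fun y => tag y = true ∨ ¬ Killed tag h s μ l y) ∧
      r.Pairwise (fun x y => h x ≤ h y) ∧
      Spec (program j) Fn.sweep (.pair (encL (encPt h s rest tag pay) l)
          (.pair (encL (encPt h s rest tag pay) l') (encO μ)))
        (encL (encPt h s rest tag pay) r) (100 * (l.length + l'.length + 1)) := by
  induction l with
  | nil =>
    intro l' μ _ hl'
    refine ⟨_, ?_, hl'.filter _, by simpa using spec_sweep_nil tag h s rest pay j μ l' hl'⟩
    simp [Keep, Killed]
  | cons x l ihl =>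
    intro l'
    induction l' with
    | nil =>
      intro μ hl _
      refine ⟨x :: l, by simp, hl, ?_⟩
      apply Spec.of_wp (body := Body.sweep) rfl
      simp [Body.sweep, wp]
      omega
    | cons y l' ihl' =>
      intro μ hl hl'
      by_cases hxy : h x ≤ h y
      · -- The bound after `x` has been passed: only killers lower it.
        set μ' : Option ℝ := if tag x = true then
          match μ with
          | none => some (s x)
          | some m => if m ≤ s x then some m else some (s x)
          else μ with hμ'
        obtain ⟨r, hr, hs, hc⟩ := ihl (y :: l') μ' hl.of_cons hl'
        have hle : ∀ z ∈ y :: l', h x ≤ h z := by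
          intro z hz
          rcases List.mem_cons.1 hz with rfl | hz
          · exact hxy
          · exact hxy.trans (List.rel_of_pairwise_cons hl' hz)
        refine ⟨x :: r, ?_, ?_, ?_⟩
        · refine (hr.cons x).trans (.of_eq ?_)
          simp only [List.cons_append]
          congr 2
          refine List.filter_congr fun z hz => ?_
          have : Killed tag h s μ' l z ↔ Killed tag h s μ (x :: l) z := by
            have hz := hle z hz
            simp only [Killed, List.mem_cons, exists_eq_or_imp, hz, true_and]
            rw [← or_assoc]
            refine or_congr_left ?_
            by_cases ht : tag x = true
            · rw [hμ', if_pos ht]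
              cases μ with
              | none => simp [ht]
              | some m =>
                simp only [ht]
                split_ifs with hm
                · simp only [Option.mem_def, Option.some.injEq, exists_eq_left', true_and]
                  exact ⟨.inl, fun h => h.elim id hm.trans⟩
                · simp only [Option.mem_def, Option.some.injEq, exists_eq_left', true_and]
                  exact ⟨.inr, fun h => h.elim (fun h => (not_le.1 hm).le.trans h) id⟩
            · rw [hμ', if_neg ht]
              simp [ht]
          rw [this]
        · refine List.pairwise_cons.2 ⟨fun z hz => ?_, hs⟩
          rcases List.mem_append.1 (hr.mem_iff.1 hz) with hz | hz
          · exact List.rel_of_pairwise_cons hl hz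
          · exact hle z (List.mem_of_mem_filter hz)
        · apply Spec.of_wp (body := Body.sweep) rfl
          simp only [encL_cons] at hc
          have key : ∀ k ≤ 100 * (l.length + (y :: l').length + 1),
              k + 80 ≤ 100 * ((x :: l).length + (y :: l').length + 1) := by
            intro k hk; simp at hk ⊢; omega
          by_cases ht : tag x = true
          · cases μ with
            | none =>
              simp only [ht, if_true] at hμ'
              simp only [hμ', encO, encPt] at hc
              simp [Body.sweep, wp, encPt, ht, encO, hxy]
              refine .mk hc fun k hk => ⟨rfl, ?_⟩
              have := key k hk
              simp at this
              omega
            | some m =>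
              by_cases hm : m ≤ s x
              · simp only [ht, if_true, hm] at hμ'
                simp only [hμ', encO, encPt] at hc
                simp [Body.sweep, wp, encPt, ht, encO, hxy, hm]
                refine .mk hc fun k hk => ⟨rfl, ?_⟩
                have := key k hk
                simp at this
                omega
              · simp only [ht, if_true, hm, if_false] at hμ'
                simp only [hμ', encO, encPt] at hc
                simp [Body.sweep, wp, encPt, ht, encO, hxy, hm]
                refine .mk hc fun k hk => ⟨rfl, ?_⟩
                have := key k hk
                simp at this
                omega
          · simp only [ht] at hμ'
            simp only [hμ', encPt] at hc
            simp [Body.sweep, wp, encPt, ht, hxy]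
            simp at hc
            refine .mk hc fun k hk => ⟨rfl, ?_⟩
            have := key k hk
            simp at this
            omega
      · have hyx : h y < h x := not_le.1 hxy
        obtain ⟨r, hr, hs, hc⟩ := ihl' μ hl hl'.of_cons
        have hK : (tag y = true ∨ ¬ Killed tag h s μ (x :: l) y) ↔ Keep s tag μ y := by
          have : ¬ ∃ a ∈ x :: l, tag a = true ∧ h a ≤ h y ∧ s a ≤ s y := by
            rintro ⟨a, ha, -, h', -⟩
            rcases List.mem_cons.1 ha with rfl | ha
            · exact hxy h'
            · exact hxy ((List.rel_of_pairwise_cons hl ha).trans h')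
          simp only [Killed, this, or_false, Keep]
          simp
        refine ⟨if Keep s tag μ y then y :: r else r, ?_, ?_, ?_⟩
        · rw [List.filter_cons]
          simp only [decide_eq_true_eq, hK]
          split_ifs
          · exact (hr.cons y).trans List.perm_middle.symm
          · exact hr
        · split_ifs
          · refine List.pairwise_cons.2 ⟨fun z hz => ?_, hs⟩
            rcases List.mem_append.1 (hr.mem_iff.1 hz) with hz | hz
            · rcases List.mem_cons.1 hz with rfl | hz
              · exact hyx.le
              · exact hyx.le.trans (List.rel_of_pairwise_cons hl hz)
            · exact List.rel_of_pairwise_cons hl' (List.mem_of_mem_filter hz)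
          · exact hs
        · apply Spec.of_wp (body := Body.sweep) rfl
          simp [Body.sweep, wp, encPt, hxy]
          refine wp_sweepStep tag h s rest pay j _
            (encL (encPt h s rest tag pay) (x :: l)) (encL (encPt h s rest tag pay) l') y μ r
            _ hc fun k hk => ⟨rfl, ?_⟩
          simp at hk
          omega

end

section
variable {α : Type*}

section
variable (h s : α → ℝ) (rest pay : α → Val) (tag : α → Bool)

/-- Conquer step for two coordinates: the survivors of `l₁ ++ l₂` are those of `l₁` and those of
`l₂` without a killer in `l₁`. -/
theorem perm_sweep {R : α → α → Prop} (hR : ∀ a b, R a b ↔ h a ≤ h b ∧ s a ≤ s b)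
    {l₁ l₂ r₁ r₂ r : List α}
    (p₁ : r₁.Perm (l₁.filter (fun x => tag x) ++ survivors R tag ∅ l₁))
    (p₂ : r₂.Perm (l₂.filter (fun x => tag x) ++ survivors R tag ∅ l₂))
    (p : open Classical in
      r.Perm (r₁ ++ r₂.filter fun y => tag y = true ∨ ¬ Killed tag h s none r₁ y)) :
    r.Perm ((l₁ ++ l₂).filter (fun x => tag x) ++ survivors R tag ∅ (l₁ ++ l₂)) := by
  classical
  have hk : ∀ y, Killed tag h s none r₁ y ↔ ∃ a ∈ {x | x ∈ l₁}, tag a = true ∧ R a y := by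
    intro y
    simp only [Killed, Option.mem_def, reduceCtorEq, false_and, exists_false, false_or, hR,
      p₁.mem_iff, List.mem_append, List.mem_filter, Set.mem_ofPred_eq]
    refine exists_congr fun a => ⟨?_, fun ⟨h, h', h''⟩ => ⟨.inl ⟨h, h'⟩, h', h''⟩⟩
    rintro ⟨⟨h, -⟩ | h, h', h''⟩
    · exact ⟨h, h', h''⟩
    · exact ⟨(mem_of_mem_survivors R tag h).1, h', h''⟩
  rw [survivors_append, survivors_union, List.filter_append]
  refine p.trans ?_
  have e₁ : (l₂.filter fun x => tag x).filter
      (fun y => tag y = true ∨ ¬ Killed tag h s none r₁ y) = l₂.filter fun x => tag x := by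
    rw [List.filter_eq_self]
    intro a ha
    simp [(List.mem_filter.1 ha).2]
  have e₂ : (survivors R tag ∅ l₂).filter
      (fun y => tag y = true ∨ ¬ Killed tag h s none r₁ y) =
      (survivors R tag ∅ l₂).filter fun x => ¬ ∃ a ∈ {x | x ∈ l₁}, tag a = true ∧ R a x := by
    refine List.filter_congr fun y hy => ?_
    have := (mem_of_mem_survivors R tag hy).2
    simp only [hk, this]
    simp
  have p₃ := p₂.filter (fun y => tag y = true ∨ ¬ Killed tag h s none r₁ y)
  rw [List.filter_append, e₁, e₂] at p₃
  refine (p₁.append p₃).trans ?_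
  simp only [List.append_assoc]
  refine List.Perm.append_left _ ?_
  simp only [← List.append_assoc]
  exact List.perm_append_comm.append_right _

/-- Merge sort by `h`, with the sweep in place of merging. Each level of the recursion takes linear
time, so that two coordinates are dealt with at the price of one logarithm. -/
theorem spec_sweepSort (j : ℕ) {R : α → α → Prop} (hR : ∀ a b, R a b ↔ h a ≤ h b ∧ s a ≤ s b)
    (t : ℕ) : ∀ l : List α, l.length ≤ 2 ^ t →
    ∃ r : List α, r.Perm (l.filter (fun x => tag x) ++ survivors R tag ∅ l) ∧
      r.Pairwise (fun x y => h x ≤ h y) ∧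
      Spec (program j) Fn.sweepSort (encL (encPt h s rest tag pay) l)
        (encL (encPt h s rest tag pay) r) (300 * (max l.length 1 * (t + 1))) := by
  have small : ∀ (t : ℕ) (l : List α), l.length < 2 →
      ∃ r : List α, r.Perm (l.filter (fun x => tag x) ++ survivors R tag ∅ l) ∧
      r.Pairwise (fun x y => h x ≤ h y) ∧
      Spec (program j) Fn.sweepSort (encL (encPt h s rest tag pay) l)
        (encL (encPt h s rest tag pay) r) (300 * (max l.length 1 * (t + 1))) := by
    intro t l hl
    refine ⟨l, ?_, ?_, ?_⟩
    · match l, hl with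
      | [], _ => simp [survivors]
      | [x], _ => by_cases h : tag x = true <;> simp [survivors, h]
    · match l, hl with
      | [], _ => simp
      | [x], _ => simp
    · apply Spec.of_wp (body := Body.sweepSort) rfl
      match l, hl with
      | [], _ => simp [Body.sweepSort, wp]; omega
      | [x], _ => simp [Body.sweepSort, wp]; omega
  induction t with
  | zero => exact fun l hl => small 0 l (by simp at hl; omega)
  | succ t ih =>
    intro l hl
    rcases Nat.lt_or_ge l.length 2 with h2 | h2
    · exact small _ l h2
    · set m := l.length / 2 with hm
      have e₁ : (l.take m).length = m := by simp; omega
      have e₂ : (l.drop m).length = l.length - m := by simp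
      rw [pow_succ] at hl
      obtain ⟨r₁, p₁, s₁, c₁⟩ := ih (l.take m) (by omega)
      obtain ⟨r₂, p₂, s₂, c₂⟩ := ih (l.drop m) (by omega)
      obtain ⟨r, p, hs, c⟩ := spec_sweep tag h s rest pay j r₁ r₂ none s₁ s₂
      have hd := spec_halve j (encPt h s rest tag pay) (encPt h s rest tag pay) l l (by omega)
      refine ⟨r, ?_, hs, ?_⟩
      · have := perm_sweep h s tag hR p₁ p₂ p
        rwa [List.take_append_drop] at this
      apply Spec.of_wp (body := Body.sweepSort) rfl
      have q₁ : r₁.length ≤ m := by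
        have := length_survivors_le R tag (l.take m) ∅
        rw [p₁.length_eq, List.length_append]
        omega
      have q₂ : r₂.length ≤ l.length - m := by
        have := length_survivors_le R tag (l.drop m) ∅
        rw [p₂.length_eq, List.length_append]
        omega
      rw [e₁, max_eq_left (by omega)] at c₁
      rw [e₂, max_eq_left (by omega)] at c₂
      obtain ⟨m₂, hm₂⟩ : ∃ m₂, m₂ = l.length - m := ⟨_, rfl⟩
      have hml : l.length = m + m₂ := by omega
      rw [← hm₂] at c₂ q₂
      rw [max_eq_left (by omega), hml]
      rw [← hm, hml] at hd
      have h1 : 1 ≤ m := by omega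
      clear_value m
      match l, h2 with
      | x :: y :: l, _ =>
        simp [Body.sweepSort, wp]
        simp only [encL_cons] at hd
        refine .mk hd fun k hk => ?_
        simp
        refine .mk c₁ fun k₁ hk₁ => ?_
        refine .mk c₂ fun k₂ hk₂ => ?_
        refine .mk c fun k₃ hk₃ => ⟨rfl, ?_⟩
        clear hd c₁ c₂ c hl e₁ e₂ hml hm₂ hm
        nlinarith

end

/-! ### More coordinates: divide and conquer -/

/-- Elements with a key, a tag and a payload. -/
def encElem (key : α → List ℝ) (tag : α → Bool) (pay : α → Val) (x : α) : Val :=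
  encItem key (fun x => .pair (encB (tag x)) (pay x)) x

variable (key : α → List ℝ) (tag : α → Bool) (pay : α → Val)

theorem spec_selA (j : ℕ) (l l' : List α) :
    Spec (program j) Fn.selA
      (.pair (encL (encElem key tag pay) l) (encL (encElem key tag pay) l'))
      (encL (encElem key tag pay) (l.filter (fun x => tag x) ++ l')) (30 * (l.length + 1)) := by
  induction l with
  | nil =>
    apply Spec.of_wp (body := Body.selA) rfl
    simp [Body.selA, wp]
  | cons x l ih =>
    apply Spec.of_wp (body := Body.selA) rfl
    by_cases h : tag x = true
    · simp [Body.selA, wp, encElem, encItem, h]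
      refine .mk ih fun k hk => ⟨rfl, ?_⟩
      omega
    · simp [Body.selA, wp, encElem, encItem, h]
      refine .mk ih fun k hk => ⟨rfl, ?_⟩
      omega

theorem spec_selB (j : ℕ) (l : List α) :
    Spec (program j) Fn.selB (encL (encElem key tag pay) l)
      (encL (encElem key tag pay) (l.filter fun x => !tag x)) (30 * (l.length + 1)) := by
  induction l with
  | nil =>
    apply Spec.of_wp (body := Body.selB) rfl
    simp [Body.selB, wp]
  | cons x l ih =>
    apply Spec.of_wp (body := Body.selB) rfl
    by_cases h : tag x = true
    · simp [Body.selB, wp, encElem, encItem, h]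
      refine .mk ih fun k hk => ⟨rfl, ?_⟩
      omega
    · simp [Body.selB, wp, encElem, encItem, h]
      refine .mk ih fun k hk => ⟨rfl, ?_⟩
      omega

theorem spec_wrap (j : ℕ) (l : List α) (hl : ∀ x ∈ l, key x ≠ []) :
    Spec (program j) Fn.wrap (encL (encElem key tag pay) l)
      (encL (encElem (fun x => (key x).tail) tag (encElem key tag pay)) l)
      (30 * (l.length + 1)) := by
  induction l with
  | nil =>
    apply Spec.of_wp (body := Body.wrap) rfl
    simp [Body.wrap, wp]
  | cons x l ih =>
    apply Spec.of_wp (body := Body.wrap) rfl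
    obtain ⟨y, k, hk⟩ := List.exists_cons_of_ne_nil (hl x (by simp))
    simp [Body.wrap, wp, encElem, encItem, hk]
    refine .mk (ih fun x hx => hl x (by simp [hx])) fun k hk => ⟨rfl, ?_⟩
    omega

theorem spec_unwrap (j : ℕ) (l l' : List α) :
    Spec (program j) Fn.unwrap (.pair (encL (encElem key tag pay) l) (encL pay l'))
      (encL pay (l ++ l')) (30 * (l.length + 1)) := by
  induction l with
  | nil =>
    apply Spec.of_wp (body := Body.unwrap) rfl
    simp [Body.unwrap, wp]
  | cons x l ih =>
    apply Spec.of_wp (body := Body.unwrap) rfl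
    simp [Body.unwrap, wp, encElem, encItem]
    refine .mk ih fun k hk => ⟨rfl, ?_⟩
    omega

/-- `l` is at most as large as `l'` in every coordinate of `l`. -/
def LeV : List ℝ → List ℝ → Prop
  | [], _ => True
  | _ :: _, [] => False
  | x :: l, y :: l' => x ≤ y ∧ LeV l l'

theorem LeV.lexLE : ∀ {l l' : List ℝ}, LeV l l' → LexLE l l'
  | [], _, _ => trivial
  | _ :: _, _ :: _, ⟨h, h'⟩ => h.lt_or_eq.imp id fun h => ⟨h, h'.lexLE⟩

/-- The unary representation of a number. -/
def unaryVal : ℕ → Val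
  | 0 => .nil
  | j + 1 => .pair .nil (unaryVal j)

/-- The constant in the running time of `Body.filter`. -/
def filterConst : ℕ → ℕ
  | 0 => 500
  | j + 1 => filterConst j + 300 * (j + 5) + 500

/-- Conquer step for more coordinates: a victim of the second half has to be checked against the
killers `a` of the first half. After lexicographic sorting `a` can be at most as large in all
coordinates only if it comes first, and then the first coordinate needs no comparison any more.
There are no ties, since the keys of killers and victims have different lengths. -/
theorem perm_merge {n : ℕ} {l₁ l₂ r₁ r₂ m r : List α}
    (h : ∀ x ∈ l₁ ++ l₂, (key x).length = if tag x then n else n + 1) (hn : n ≠ 0)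
    (p₁ : r₁.Perm (survivors (fun a b => LeV (key a) (key b)) tag ∅ l₁))
    (p₂ : r₂.Perm (survivors (fun a b => LeV (key a) (key b)) tag ∅ l₂))
    (pm : m.Perm (l₁.filter (fun x => tag x) ++ r₂))
    (sm : m.Pairwise fun x y => LexLE (key x) (key y))
    (p : r.Perm (survivors (fun a b => LeV (key a).tail (key b).tail) tag ∅ m)) :
    (r ++ r₁).Perm (survivors (fun a b => LeV (key a) (key b)) tag ∅ (l₁ ++ l₂)) := by
  classical
  have hm : ∀ x ∈ m, (key x).length = if tag x then n else n + 1 := by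
    intro x hx
    rcases List.mem_append.1 (pm.mem_iff.1 hx) with hx | hx
    · exact h x (List.mem_append_left _ (List.mem_of_mem_filter hx))
    · exact h x (List.mem_append_right _ (mem_of_mem_survivors _ _ (p₂.mem_iff.1 hx)).1)
  rw [survivors_eq_filter (R := fun a b => LeV (key a) (key b)) tag (by simp)] at p
  · rw [survivors_append, survivors_union]
    refine List.perm_append_comm.trans (p₁.append (p.trans ((pm.filter _).trans ?_)))
    rw [List.filter_append, List.filter_eq_nil_iff.2, List.nil_append]
    · refine (p₂.filter _).trans (.of_eq (List.filter_congr fun x hx => ?_))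
      have hx' := (mem_of_mem_survivors _ _ hx).2
      simp only [hx', true_and, decide_eq_decide]
      refine not_congr (exists_congr fun a => and_congr_left fun ha => ?_)
      simp only [Set.mem_empty_iff_false, false_or, pm.mem_iff, List.mem_append, List.mem_filter,
        ha.1, and_true, Set.mem_ofPred_eq]
      refine ⟨fun ha' => ha'.resolve_right fun h => ?_, .inl⟩
      have := (mem_of_mem_survivors _ _ (p₂.mem_iff.1 h)).2
      simp [ha.1] at this
    · intro x hx
      simp [(List.mem_filter.1 hx).2]
  · refine sm.imp_of_mem fun {x y} hx hy hxy => ⟨fun tx ty => ?_, fun ty tx hyx => ?_⟩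
    · have lx := hm x hx
      have ly := hm y hy
      match hkx : key x, hky : key y with
      | [], _ => simp [hkx, tx, hn.symm] at lx
      | _ :: _, [] => simp [hky, ty] at ly
      | a :: k, b :: k' =>
        rw [hkx, hky] at hxy
        simp only [LeV, List.tail_cons]
        exact ⟨fun h => ⟨hxy.elim le_of_lt fun h => h.1.le, h⟩, And.right⟩
    · have lx := hm x hx
      have ly := hm y hy
      rw [hxy.antisymm hyx.lexLE] at lx
      simp [tx, ty] at lx ly
      omega

/-- Divide and conquer: both halves are filtered on their own, and then the victims of the second
half are checked against the killers of the first half with one coordinate less. The additional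
coordinate costs a logarithmic factor, and the base of the recursion over the number of coordinates
is `spec_sweepSort`. -/
theorem spec_filter (J : ℕ) (j : ℕ) : ∀ (key : α → List ℝ) (pay : α → Val) (t : ℕ) (l : List α),
    (∀ x ∈ l, (key x).length = if tag x then j + 2 else j + 3) → l.length ≤ 2 ^ t →
    ∃ r : List α, r.Perm (survivors (fun a b => LeV (key a) (key b)) tag ∅ l) ∧
      Spec (program J) Fn.filter (.pair (unaryVal j) (encL (encElem key tag pay) l))
        (encL (encElem key tag pay) r)
        (filterConst j * (max l.length 1 * (t + 1) ^ (j + 1))) := by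
  induction j with
  | zero =>
    intro key pay t l hkey hl
    have hR : ∀ a ∈ l, tag a = true → ∀ b ∈ l, tag b = false → (LeV (key a) (key b) ↔
        (key a).headD 0 ≤ (key b).headD 0 ∧ (key a).tail.headD 0 ≤ (key b).tail.headD 0) := by
      intro a ha ta b hb tb
      have ha := hkey a ha
      have hb := hkey b hb
      match hka : key a, hkb : key b with
      | [x, y], [z, w, _] => simp [LeV]
      | [], _ => simp [hka, ta] at ha
      | [_], _ => simp [hka, ta] at ha
      | _ :: _ :: _ :: _, _ => simp [hka, ta] at ha
      | _, [] => simp [hkb, tb] at hb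
      | _, [_] => simp [hkb, tb] at hb
      | _, [_, _] => simp [hkb, tb] at hb
      | _, _ :: _ :: _ :: _ :: _ => simp [hkb, tb] at hb
    have henc : ∀ x ∈ l, encElem key tag pay x = encPt (fun a => (key a).headD 0)
        (fun a => (key a).tail.headD 0) (fun a => encR (key a).tail.tail) tag pay x := by
      intro a ha
      have ha := hkey a ha
      match hka : key a with
      | [] => split_ifs at ha <;> simp [hka] at ha
      | [_] => split_ifs at ha <;> simp [hka] at ha
      | x :: y :: k => simp [encElem, encItem, encPt, hka]
    obtain ⟨r, p, -, c⟩ := spec_sweepSort (fun a => (key a).headD 0)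
      (fun a => (key a).tail.headD 0) (fun a => encR (key a).tail.tail) pay tag J
      (fun a b => Iff.rfl) t l hl
    have hr : ∀ x ∈ r, x ∈ l := by
      intro x hx
      rcases List.mem_append.1 (p.mem_iff.1 hx) with hx | hx
      · exact List.mem_of_mem_filter hx
      · exact (mem_of_mem_survivors _ _ hx).1
    have hrl : r.length ≤ l.length := by
      rw [p.length_eq, List.length_append, add_comm]
      exact length_survivors_le _ tag l ∅
    rw [← encL_congr henc, ← encL_congr fun x hx => henc x (hr x hx)] at c
    refine ⟨r.filter fun x => !tag x, ?_, ?_⟩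
    · refine (p.filter _).trans (.of_eq ?_)
      rw [List.filter_append, List.filter_eq_nil_iff.2, List.filter_eq_self.2, List.nil_append]
      · refine survivors_congr _ _ fun a ha b hb ta tb => (hR a ?_ ta b hb tb).symm
        simpa using ha
      · intro x hx
        simp [(mem_of_mem_survivors _ _ hx).2]
      · intro x hx
        simp [(List.mem_filter.1 hx).2]
    · apply Spec.of_wp (body := Body.filter) rfl
      simp [Body.filter, wp, unaryVal]
      refine .mk c fun k hk => ?_
      refine .mk (spec_selB key tag pay J r) fun k' hk' => ⟨rfl, ?_⟩
      simp only [filterConst]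
      have h₁ : max l.length 1 ≤ max l.length 1 * (t + 1) := Nat.le_mul_of_pos_right _ (by omega)
      omega
  | succ j ihj =>
    intro key pay t
    have small : ∀ (t : ℕ) (l : List α), l.length < 2 →
        ∃ r : List α, r.Perm (survivors (fun a b => LeV (key a) (key b)) tag ∅ l) ∧
        Spec (program J) Fn.filter (.pair (unaryVal (j + 1)) (encL (encElem key tag pay) l))
          (encL (encElem key tag pay) r)
          (filterConst (j + 1) * (max l.length 1 * (t + 1) ^ (j + 1 + 1))) := by
      intro t l hl
      have hc : 500 ≤ filterConst (j + 1) * (max l.length 1 * (t + 1) ^ (j + 1 + 1)) := by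
        have h₁ : 500 ≤ filterConst (j + 1) := by simp only [filterConst]; omega
        have h₂ : 1 ≤ max l.length 1 * (t + 1) ^ (j + 1 + 1) :=
          Nat.mul_pos (by omega) (by positivity)
        nlinarith
      refine ⟨l.filter fun x => !tag x, ?_, ?_⟩
      · match l, hl with
        | [], _ => simp [survivors]
        | [x], _ => by_cases h : tag x = true <;> simp [survivors, h]
      · apply Spec.of_wp (body := Body.filter) rfl
        have hs := spec_selB key tag pay J l
        match l, hl with
        | [], _ => simp [Body.filter, wp, unaryVal]; simp at hc; omega
        | [x], _ =>
          simp [Body.filter, wp, unaryVal]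
          refine .mk hs fun k hk => ⟨rfl, ?_⟩
          simp at hk hc
          omega
    induction t with
    | zero => exact fun l _ hl => small 0 l (by simp at hl; omega)
    | succ t ih =>
      intro l hkey hl
      rcases Nat.lt_or_ge l.length 2 with h2 | h2
      · exact small _ l h2
      · set m := l.length / 2 with hm
        have e₁ : (l.take m).length = m := by simp; omega
        have e₂ : (l.drop m).length = l.length - m := by simp
        have hl' := hl
        rw [pow_succ] at hl
        obtain ⟨r₁, p₁, c₁⟩ := ih (l.take m) (fun x hx => hkey x (List.mem_of_mem_take hx))
          (by omega)
        obtain ⟨r₂, p₂, c₂⟩ := ih (l.drop m) (fun x hx => hkey x (List.mem_of_mem_drop hx))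
          (by omega)
        have hA := spec_selA key tag pay J (l.take m) r₂
        set A := (l.take m).filter (fun x => tag x) ++ r₂ with hAdef
        have hAmem : ∀ x ∈ A, x ∈ l := by
          intro x hx
          rcases List.mem_append.1 hx with hx | hx
          · exact List.mem_of_mem_take (List.mem_of_mem_filter hx)
          · exact List.mem_of_mem_drop (mem_of_mem_survivors _ _ (p₂.mem_iff.1 hx)).1
        have hAlen : A.length ≤ l.length := by
          have q₁ := length_survivors_le (fun a b => LeV (key a) (key b)) tag (l.take m) ∅
          have q₂ := length_survivors_le (fun a b => LeV (key a) (key b)) tag (l.drop m) ∅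
          rw [← p₂.length_eq] at q₂
          rw [hAdef, List.length_append]
          omega
        obtain ⟨M, pM, sM, cM⟩ := spec_sort J (j + 4) key
          (fun x => .pair (encB (tag x)) (pay x)) (t + 1) A (fun x hx => by
            rw [hkey x (hAmem x hx)]; split_ifs <;> omega) (hAlen.trans hl')
        have hMmem : ∀ x ∈ M, x ∈ l := fun x hx => hAmem x (pM.mem_iff.1 hx)
        have hW := spec_wrap key tag pay J M (by
          intro x hx h0
          have := hkey x (hMmem x hx)
          rw [h0] at this
          split_ifs at this)
        obtain ⟨r, p, c⟩ := ihj (fun x => (key x).tail) (encElem key tag pay) (t + 1) M (by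
          intro x hx
          rw [List.length_tail, hkey x (hMmem x hx)]
          split_ifs <;> omega) (by rw [pM.length_eq]; exact hAlen.trans hl')
        have hU := spec_unwrap (fun x => (key x).tail) tag (encElem key tag pay) J r r₁
        have hd := spec_halve J (encElem key tag pay) (encElem key tag pay) l l (by omega)
        refine ⟨r ++ r₁, ?_, ?_⟩
        · have := perm_merge key tag (n := j + 3) (l₁ := l.take m) (l₂ := l.drop m)
            (fun x hx => by
              rw [List.take_append_drop] at hx
              rw [hkey x hx])
            (by omega) p₁ p₂ pM sM p
          rwa [List.take_append_drop] at this
        · apply Spec.of_wp (body := Body.filter) rfl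
          rw [e₁, max_eq_left (by omega)] at c₁
          rw [e₂, max_eq_left (by omega)] at c₂
          have hMlen : M.length ≤ l.length := pM.length_eq ▸ hAlen
          have hrlen : r.length ≤ l.length := by
            rw [p.length_eq]
            exact (Nat.le_add_right _ _).trans ((length_survivors_le _ tag M ∅).trans hMlen)
          obtain ⟨m₂, hm₂⟩ : ∃ m₂, m₂ = l.length - m := ⟨_, rfl⟩
          have hml : l.length = m + m₂ := by omega
          rw [← hm₂] at c₂
          rw [e₁] at hA
          rw [← hm] at hd
          rw [max_eq_left (by omega)]
          have h1 : 1 ≤ m := by omega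
          have bM : max M.length 1 ≤ l.length := by omega
          have bA : max A.length 1 ≤ l.length := by omega
          -- Two calls with half the length and one with one coordinate less fit into the bound.
          have b₁ : (t + 1) ^ (j + 2) + (t + 2) ^ (j + 1) ≤ (t + 2) ^ (j + 2) := by
            calc _ = (t + 1) ^ (j + 1) * (t + 1) + (t + 2) ^ (j + 1) := by ring
              _ ≤ (t + 2) ^ (j + 1) * (t + 1) + (t + 2) ^ (j + 1) := by gcongr; omega
              _ = _ := by ring
          have b₂ : t + 2 ≤ (t + 2) ^ (j + 1) := Nat.le_self_pow (by omega) _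
          have b₃ : l.length * (t + 2) ≤ l.length * (t + 2) ^ (j + 1) :=
            Nat.mul_le_mul_left _ b₂
          have cM' := cM.mono (K' := 300 * (j + 5) * (l.length * (t + 2) ^ (j + 1)))
            (Nat.mul_le_mul_left _ ((Nat.mul_le_mul_right _ bA).trans b₃))
          have c' := c.mono (K' := filterConst j * (l.length * (t + 2) ^ (j + 1)))
            (Nat.mul_le_mul_left _ (Nat.mul_le_mul_right _ bM))
          have b₄ : l.length ≤ l.length * (t + 2) ^ (j + 1) :=
            Nat.le_mul_of_pos_right _ (by positivity)
          have b₅ : filterConst (j + 1) * (m * (t + 1) ^ (j + 2)) +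
              filterConst (j + 1) * (m₂ * (t + 1) ^ (j + 2)) +
              filterConst j * (l.length * (t + 2) ^ (j + 1)) +
              300 * (j + 5) * (l.length * (t + 2) ^ (j + 1)) +
              500 * (l.length * (t + 2) ^ (j + 1)) ≤
              filterConst (j + 1) * (l.length * (t + 2) ^ (j + 2)) := by
            calc _ = filterConst (j + 1) *
                  (l.length * ((t + 1) ^ (j + 2) + (t + 2) ^ (j + 1))) := by
                  rw [hml]; simp only [filterConst]; ring
              _ ≤ _ := by gcongr
          have hs : ∃ x y l', l = x :: y :: l' := by
            match l, h2 with
            | x :: y :: l, _ => exact ⟨x, y, l, rfl⟩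
          obtain ⟨x, y, l', hl'⟩ := hs
          have hlv : encL (encElem key tag pay) l = .pair (encElem key tag pay x)
            (.pair (encElem key tag pay y) (encL (encElem key tag pay) l')) := by rw [hl']; rfl
          clear_value A m
          rw [hlv] at hd ⊢
          simp [Body.filter, wp, unaryVal]
          refine .mk hd fun k hk => ?_
          simp
          refine .mk c₂ fun k₂ hk₂ => ?_
          refine .mk hA fun k₃ hk₃ => ?_
          refine .mk cM' fun k₄ hk₄ => ?_
          refine .mk hW fun k₅ hk₅ => ?_
          refine .mk c' fun k₆ hk₆ => ?_
          refine .mk c₁ fun k₇ hk₇ => ?_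
          refine .mk hU fun k₈ hk₈ => ⟨rfl, ?_⟩
          rw [show j + 1 + 1 = j + 2 from rfl] at hk₂ hk₇ ⊢
          rw [show t + 1 + 1 = t + 2 from rfl]
          omega

end

/-! ### Pareto-optimal vectors of a list -/

theorem lexLE_snoc_left {x : ℝ} : ∀ {l l' : List ℝ}, l.length = l'.length →
    LexLE (l ++ [x]) l' → LexLE l l' ∧ l ≠ l'
  | [], [], _, h => h.elim
  | y :: l, z :: l', hl, .inl h => ⟨.inl h, fun e => h.ne (List.cons.inj e).1⟩
  | y :: l, z :: l', hl, .inr ⟨h, h'⟩ => by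
    obtain ⟨h₁, h₂⟩ := lexLE_snoc_left (by simpa using hl) h'
    exact ⟨.inr ⟨h, h₁⟩, fun e => h₂ (List.cons.inj e).2⟩

theorem lexLE_snoc_right {x : ℝ} : ∀ {l l' : List ℝ}, l.length = l'.length →
    LexLE l (l' ++ [x]) → LexLE l l'
  | [], [], _, _ => trivial
  | y :: l, z :: l', hl, .inl h => .inl h
  | y :: l, z :: l', hl, .inr ⟨h, h'⟩ => .inr ⟨h, lexLE_snoc_right (by simpa using hl) h'⟩

theorem leV_snoc_right {x : ℝ} : ∀ {l l' : List ℝ}, l.length = l'.length →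
    (LeV l (l' ++ [x]) ↔ LeV l l')
  | [], [], _ => Iff.rfl
  | y :: l, z :: l', hl => and_congr_right fun _ => leV_snoc_right (by simpa using hl)

/-- Domination of vectors that are given as lists. -/
def DomL (l l' : List ℝ) : Prop := LeV l l' ∧ l ≠ l'

theorem spec_snoc (J : ℕ) (l : List ℝ) :
    Spec (program J) Fn.snoc (encR l) (encR (l ++ [0])) (30 * (l.length + 1)) := by
  induction l with
  | nil =>
    apply Spec.of_wp (body := Body.snoc) rfl
    simp [Body.snoc, wp]
  | cons x l ih =>
    apply Spec.of_wp (body := Body.snoc) rfl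
    simp [Body.snoc, wp]
    refine .mk ih fun k hk => ⟨rfl, ?_⟩
    omega

section
variable {α : Type*} (vec : α → List ℝ) (pay : α → Val)

/-- The key for the lexicographic sorting. The additional coordinate puts victims before killers
with the same vector. -/
def sortKey (x : α × Bool) : List ℝ := if x.2 then vec x.1 ++ [0] else vec x.1

/-- The key after the first coordinate has been dealt with. The additional coordinate puts killers
before victims with the same vector in later sorting steps. -/
def elemKey (x : α × Bool) : List ℝ := if x.2 then (vec x.1).tail else (vec x.1).tail ++ [0]

/-- What follows the sorting key. -/
def afterKey : α × Bool → Val :=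
  encElem (elemKey vec) Prod.snd fun x => encItem vec pay x.1

/-- Each entry of `l` once as a victim and once as a killer. -/
def doubled (l : List α) : List (α × Bool) := l.flatMap fun x => [(x, false), (x, true)]

theorem length_doubled (l : List α) : (doubled l).length = 2 * l.length := by
  induction l with
  | nil => rfl
  | cons x l ih =>
    simp only [doubled, List.flatMap_cons, List.length_append] at ih ⊢
    simp [ih]
    ring

theorem mem_doubled {l : List α} {x : α × Bool} : x ∈ doubled l ↔ x.1 ∈ l := by
  obtain ⟨x, b⟩ := x
  cases b <;> simp [doubled]

theorem map_filter_doubled (p : α → Prop) [DecidablePred p] (l : List α) :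
    ((doubled l).filter fun x => x.2 = false ∧ p x.1).map Prod.fst = l.filter fun x => p x := by
  induction l with
  | nil => rfl
  | cons x l ih =>
    simp only [doubled, List.flatMap_cons, List.filter_append, List.map_append] at ih ⊢
    rw [ih]
    by_cases h : p x <;> simp [h]

theorem spec_double (J D : ℕ) (l : List α) (hl : ∀ x ∈ l, (vec x).length = D + 1) :
    Spec (program J) Fn.double (encL (encItem vec pay) l)
      (encL (encItem (sortKey vec) (afterKey vec pay)) (doubled l))
      (200 * (D + 1) * (l.length + 1)) := by
  induction l with
  | nil =>
    apply Spec.of_wp (body := Body.double) rfl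
    simp [Body.double, wp, doubled]
    nlinarith
  | cons x l ih =>
    apply Spec.of_wp (body := Body.double) rfl
    have hx := hl x (by simp)
    obtain ⟨y, k, hk⟩ : ∃ y k, vec x = y :: k := by
      match h : vec x with
      | [] => simp [h] at hx
      | y :: k => exact ⟨y, k, rfl⟩
    have hkl : k.length = D := by rw [hk] at hx; simpa using hx
    have h₁ := spec_snoc J k
    have h₂ := spec_snoc J (y :: k)
    simp [Body.double, wp, encItem, hk]
    refine .mk h₁ fun k₁ hk₁ => ?_
    refine .mk h₂ fun k₂ hk₂ => ?_
    refine .mk (ih fun x hx => hl x (by simp [hx])) fun k₃ hk₃ => ⟨?_, ?_⟩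
    · simp [doubled, encItem, afterKey, encElem, sortKey, elemKey, hk]
    · simp only [List.length_cons, hkl] at hk₁ hk₂
      nlinarith

theorem spec_mapSnd (J : ℕ) {β : Type*} (key : β → List ℝ) (rest : β → Val) (l : List β) :
    Spec (program J) Fn.mapSnd (encL (encItem key rest) l) (encL rest l)
      (30 * (l.length + 1)) := by
  induction l with
  | nil =>
    apply Spec.of_wp (body := Body.mapSnd) rfl
    simp [Body.mapSnd, wp]
  | cons x l ih =>
    apply Spec.of_wp (body := Body.mapSnd) rfl
    simp [Body.mapSnd, wp, encItem]
    refine .mk ih fun k hk => ⟨rfl, ?_⟩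
    omega

theorem wp_unary (P : Program) (ρ : List Val) (j : ℕ) : ∀ Q : Val → ℕ → Prop,
    wp P (Body.unary j) ρ Q ↔ Q (unaryVal j) (2 * j + 1) := by
  induction j with
  | zero => exact fun Q => Iff.rfl
  | succ j ih =>
    intro Q
    simp only [Body.unary, wp, ih, unaryVal]
    rw [show 1 + (2 * j + 1) + 1 = 2 * (j + 1) + 1 by ring]

theorem wp_zeros (P : Program) (ρ : List Val) (D : ℕ) : ∀ Q : Val → ℕ → Prop,
    wp P (Body.zeros D) ρ Q ↔ Q (encR (List.replicate D 0)) (2 * D + 1) := by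
  induction D with
  | zero => exact fun Q => Iff.rfl
  | succ j ih =>
    intro Q
    simp only [Body.zeros, wp, ih, List.replicate_succ, encR_cons]
    rw [show 1 + (2 * j + 1) + 1 = 2 * (j + 1) + 1 by ring]

/-- In the sorted list of victims and killers, domination is a matter of the order and of all
coordinates but the first. -/
theorem pairwise_of_sorted {D : ℕ} {m : List (α × Bool)}
    (hm : ∀ x ∈ m, (vec x.1).length = D + 1)
    (sm : m.Pairwise fun x y => LexLE (sortKey vec x) (sortKey vec y)) :
    m.Pairwise (fun x y =>
      (x.2 = true → y.2 = false → (LeV (elemKey vec x) (elemKey vec y) ↔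
        DomL (vec x.1) (vec y.1))) ∧
      (y.2 = true → x.2 = false → ¬ DomL (vec y.1) (vec x.1))) := by
  refine sm.imp_of_mem ?_
  rintro ⟨x, b⟩ ⟨y, c⟩ hx hy hxy
  have hx := hm _ hx
  have hy := hm _ hy
  refine ⟨?_, ?_⟩
  · rintro rfl rfl
    simp only [sortKey, if_true, Bool.false_eq_true, if_false] at hxy
    obtain ⟨h₁, h₂⟩ := lexLE_snoc_left (hx.trans hy.symm) hxy
    simp only [elemKey, if_true, Bool.false_eq_true, if_false, DomL, h₂, ne_eq,
      not_false_eq_true, and_true]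
    rw [leV_snoc_right (by rw [List.length_tail, List.length_tail, hx, hy])]
    match hvx : vec x, hvy : vec y with
    | [], _ => simp [hvx] at hx
    | _ :: _, [] => simp [hvy] at hy
    | a :: k, b :: k' =>
      rw [hvx, hvy] at h₁
      simp only [LeV, List.tail_cons]
      exact ⟨fun h => ⟨h₁.elim le_of_lt fun h => h.1.le, h⟩, And.right⟩
  · rintro rfl rfl ⟨h, hne⟩
    simp only [sortKey, if_true, Bool.false_eq_true, if_false] at hxy
    exact hne (h.lexLE.antisymm (lexLE_snoc_right (hx.trans hy.symm) hxy))

/-- The constant in the running time of `Body.pareto`. -/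
def paretoConst (J : ℕ) : ℕ := 2 * filterConst J + 1010 * (J + 10)

open Classical in
/-- Sorting makes the first coordinate superfluous, so that `J + 2` coordinates remain for
`spec_filter`, which takes `J + 1` logarithmic factors. -/
theorem spec_pareto (J t : ℕ) (l : List α) (hl : ∀ x ∈ l, (vec x).length = J + 3)
    (ht : 2 * l.length ≤ 2 ^ t) :
    ∃ r : List α, r.Perm (l.filter fun x => ¬ ∃ a ∈ l, DomL (vec a) (vec x)) ∧
      Spec (program J) Fn.pareto (encL (encItem vec pay) l) (encL (encItem vec pay) r)
        (paretoConst J * (max l.length 1 * (t + 1) ^ (J + 1))) := by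
  have c₁ := spec_double vec pay J (J + 2) l hl
  have hd : ∀ x ∈ doubled l, (vec x.1).length = J + 3 := fun x hx => hl _ (mem_doubled.1 hx)
  obtain ⟨m, pm, sm, c₂⟩ := spec_sort J (J + 4) (sortKey vec) (afterKey vec pay) t (doubled l)
    (by
      intro x hx
      have := hd x hx
      rw [sortKey]
      split_ifs <;> simp [this])
    (by rwa [length_doubled])
  have hm : ∀ x ∈ m, (vec x.1).length = J + 3 := fun x hx => hd x (pm.mem_iff.1 hx)
  have c₃ := spec_mapSnd J (sortKey vec) (afterKey vec pay) m
  have hml : m.length = 2 * l.length := by rw [pm.length_eq, length_doubled]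
  obtain ⟨r, p, c₄⟩ := spec_filter Prod.snd J J (elemKey vec) (fun x => encItem vec pay x.1) t m
    (by
      intro x hx
      have := hm x hx
      rw [elemKey]
      split_ifs <;> simp [this])
    (by rwa [hml])
  have c₅ := spec_unwrap (elemKey vec) Prod.snd (fun x => encItem vec pay x.1) J r []
  rw [survivors_eq_filter (R := fun a b => DomL (vec a.1) (vec b.1)) Prod.snd (by simp)
    (pairwise_of_sorted vec hm sm)] at p
  have hr : r.length ≤ 2 * l.length := by
    rw [p.length_eq, ← hml]
    exact List.length_filter_le _ _
  have he : encL (encItem vec pay) (r.map Prod.fst) =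
      encL (fun x => encItem vec pay x.1) (r ++ []) := by
    simp [encL, Function.comp_def]
  refine ⟨r.map Prod.fst, ?_, ?_⟩
  · have hk : ∀ x : α × Bool, (∃ a, (a ∈ (∅ : Set (α × Bool)) ∨ a ∈ m) ∧ a.2 = true ∧
        DomL (vec a.1) (vec x.1)) ↔ ∃ a ∈ l, DomL (vec a) (vec x.1) := by
      intro x
      simp only [Set.mem_empty_iff_false, false_or, pm.mem_iff, mem_doubled]
      exact ⟨fun ⟨a, h, _, h'⟩ => ⟨a.1, h, h'⟩, fun ⟨a, h, h'⟩ => ⟨(a, true), h, rfl, h'⟩⟩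
    simp only [hk] at p
    refine (p.map _).trans (((pm.filter _).map _).trans (.of_eq ?_))
    exact map_filter_doubled (fun x => ¬ ∃ a ∈ l, DomL (vec a) (vec x)) l
  · apply Spec.of_wp (body := Body.pareto J) rfl
    rw [he]
    have hmax : max (2 * l.length) 1 ≤ 2 * max l.length 1 := by omega
    rw [length_doubled] at c₂
    rw [hml] at c₃ c₄
    set M := max l.length 1 with hM
    have b₁ : t + 1 ≤ (t + 1) ^ (J + 1) := Nat.le_self_pow (by omega) _
    have b₂ : 1 ≤ (t + 1) ^ (J + 1) := Nat.one_le_pow _ _ (by omega)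
    set T := (t + 1) ^ (J + 1) with hT
    have b₃ : M ≤ M * T := Nat.le_mul_of_pos_right _ b₂
    have b₀ : 1 ≤ M * T := Nat.mul_pos (by omega) b₂
    have c₂' := c₂.mono (K' := 600 * (J + 5) * (M * T)) (by
      calc _ ≤ 300 * (J + 4 + 1) * (2 * M * T) := by gcongr
        _ = _ := by ring)
    have c₄' := c₄.mono (K' := 2 * filterConst J * (M * T)) (by
      calc _ ≤ filterConst J * (2 * M * T) := by gcongr
        _ = _ := by ring)
    have c₁' := c₁.mono (K' := 400 * (J + 3) * (M * T)) (by
      calc _ ≤ 200 * (J + 2 + 1) * (2 * (M * T)) := by gcongr; omega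
        _ = _ := by ring)
    have b₄ : paretoConst J * (M * T) = 2 * filterConst J * (M * T) + 600 * (J + 5) * (M * T) +
        400 * (J + 3) * (M * T) + 5900 * (M * T) + 10 * (J * (M * T)) := by
      simp only [paretoConst]; ring
    have b₅ : J ≤ J * (M * T) := Nat.le_mul_of_pos_right _ b₀
    have b₆ : 400 * (J + 3) * (M * T) = 400 * (J * (M * T)) + 1200 * (M * T) := by ring
    have b₇ : l.length ≤ M := by omega
    clear_value M T
    simp [Body.pareto, wp, wp_unary]
    refine .mk c₁' fun k₁ hk₁ => ?_
    refine .mk c₂' fun k₂ hk₂ => ?_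
    refine .mk c₃ fun k₃ hk₃ => ?_
    refine .mk c₄' fun k₄ hk₄ => ?_
    refine .mk c₅ fun k₅ hk₅ => ⟨by simp, ?_⟩
    rw [b₄]
    omega

end

/-! ### Solutions and their combinations -/

/-- Expressions for sets of vertices, which allow unions in constant time. -/
inductive STree (n : ℕ) : Type
  | empty : STree n
  | single (v : Fin n) : STree n
  | union (s t : STree n) : STree n

namespace STree

variable {n : ℕ}

/-- The elements of the set. -/
def toList : STree n → List (Fin n)
  | empty => []
  | single v => [v]
  | union s t => s.toList ++ t.toList

/-- The number of nodes of the expression. -/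
def size : STree n → ℕ
  | empty => 1
  | single _ => 1
  | union s t => s.size + t.size + 1

/-- The expression as a value. -/
def enc : STree n → Val
  | empty => .nil
  | single v => .pair (.pair (.label v) .nil) .nil
  | union s t => .pair .nil (.pair s.enc t.enc)

end STree

/-- A solution together with its cost. -/
abbrev Sol (n d : ℕ) : Type := (Fin d → ℝ) × STree n

/-- A cost vector, filled up with zeros to length `J + 3`. The additional coordinates do not affect
domination, and with at least three coordinates two of them remain after the first one has been
dealt with by sorting. -/
def padVec {d : ℕ} (J : ℕ) (x : Fin d → ℝ) : List ℝ :=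
  List.ofFn x ++ List.replicate (J + 3 - d) 0

/-- A solution as a value. -/
def encSol {n d : ℕ} (J : ℕ) : Sol n d → Val :=
  encItem (fun s => padVec J s.1) fun s => s.2.enc

/-- The combination of two solutions. -/
def Sol.add {n d : ℕ} (a b : Sol n d) : Sol n d := (a.1 + b.1, .union a.2 b.2)

/-- All combinations of a solution of `l` with one of `l'`. -/
def crossL {n d : ℕ} (l l' : List (Sol n d)) : List (Sol n d) := l.flatMap fun a => l'.map a.add

open Classical in
/-- The solutions of `l` that no solution of `l` dominates. -/
noncomputable def paretoL {n d : ℕ} (l : List (Sol n d)) : List (Sol n d) :=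
  l.filter fun x => ¬ ∃ a ∈ l, Dominates a.1 x.1

theorem addL_nil (l : List ℝ) : addL l [] = l := by cases l <;> rfl

theorem addL_append {k : List ℝ} : ∀ {l l' : List ℝ}, l.length = l'.length → ∀ k' : List ℝ,
    addL (l ++ k) (l' ++ k') = List.zipWith (· + ·) l l' ++ addL k k'
  | [], [], _, _ => rfl
  | x :: l, y :: l', h, k' => by
    simp [addL, addL_append (l := l) (l' := l') (by simpa using h) k']

theorem addL_replicate (m : ℕ) :
    addL (List.replicate m 0) (List.replicate m 0) = List.replicate m 0 := by
  induction m with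
  | zero => rfl
  | succ m ih => simp [List.replicate_succ, addL, ih]

section
variable {n d : ℕ}

theorem zipWith_ofFn (x y : Fin d → ℝ) :
    List.zipWith (· + ·) (List.ofFn x) (List.ofFn y) = List.ofFn (x + y) := by
  apply List.ext_getElem <;> simp

theorem addL_padVec (J : ℕ) (x y : Fin d → ℝ) :
    addL (padVec J x) (padVec J y) = padVec J (x + y) := by
  rw [padVec, padVec, addL_append (by simp), addL_replicate, zipWith_ofFn, padVec]

theorem addL_padVec_ofFn (J : ℕ) (x y : Fin d → ℝ) :
    addL (padVec J x) (List.ofFn y) = padVec J (x + y) := by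
  have := addL_append (k := List.replicate (J + 3 - d) 0) (l := List.ofFn x) (l' := List.ofFn y)
    (by simp) []
  rw [List.append_nil, addL_nil, zipWith_ofFn] at this
  exact this

theorem length_padVec {J : ℕ} (hd : d ≤ J + 3) (x : Fin d → ℝ) :
    (padVec J x).length = J + 3 := by
  simp [padVec]; omega

theorem leV_append : ∀ {l l' : List ℝ}, l.length = l'.length → ∀ k : List ℝ,
    (LeV (l ++ k) (l' ++ k) ↔ LeV l l')
  | [], [], _, k => by
    refine iff_of_true ?_ trivial
    induction k with
    | nil => trivial
    | cons x k ih => exact ⟨le_rfl, ih⟩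
  | x :: l, y :: l', h, k => and_congr_right fun _ => leV_append (by simpa using h) k

theorem leV_ofFn : ∀ {d : ℕ} {x y : Fin d → ℝ}, LeV (List.ofFn x) (List.ofFn y) ↔ ∀ i, x i ≤ y i
  | 0, x, y => by simp [LeV]
  | d + 1, x, y => by
    rw [List.ofFn_succ, List.ofFn_succ, Fin.forall_fin_succ]
    exact and_congr_right fun _ => leV_ofFn

theorem domL_padVec (J : ℕ) (x y : Fin d → ℝ) :
    DomL (padVec J x) (padVec J y) ↔ Dominates x y := by
  rw [DomL, padVec, padVec, leV_append (by simp), leV_ofFn, Dominates]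
  refine and_congr_right fun h => ?_
  rw [ne_eq, List.append_left_inj, List.ofFn_inj, funext_iff, not_forall]
  exact exists_congr fun i => ⟨fun h' => lt_of_le_of_ne (h i) h', fun h' => h'.ne⟩

variable (J : ℕ) (hd : d ≤ J + 3)
include hd

theorem spec_pareto_sol (t : ℕ) (l : List (Sol n d)) (ht : 2 * l.length ≤ 2 ^ t) :
    ∃ r : List (Sol n d), r.Perm (paretoL l) ∧
      Spec (program J) Fn.pareto (encL (encSol J) l) (encL (encSol J) r)
        (paretoConst J * (max l.length 1 * (t + 1) ^ (J + 1))) := by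
  obtain ⟨r, p, c⟩ := spec_pareto (fun s : Sol n d => padVec J s.1) (fun s => s.2.enc) J t l
    (fun x _ => length_padVec hd x.1) ht
  refine ⟨r, ?_, c⟩
  refine p.trans (.of_eq (List.filter_congr fun x _ => ?_))
  rw [decide_eq_decide]
  exact not_congr (exists_congr fun a => and_congr_right fun _ => domL_padVec J a.1 x.1)

theorem spec_cross₁ (a : Sol n d) (l l' : List (Sol n d)) :
    Spec (program J) Fn.cross₁ (.pair (encSol J a) (.pair (encL (encSol J) l)
      (encL (encSol J) l'))) (encL (encSol J) (l.map a.add ++ l'))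
      (100 * (J + 10) * (l.length + 1)) := by
  induction l with
  | nil =>
    apply Spec.of_wp (body := Body.cross₁) rfl
    simp [Body.cross₁, wp]
    omega
  | cons x l ih =>
    apply Spec.of_wp (body := Body.cross₁) rfl
    have h₁ := spec_addVec J (padVec J a.1) (padVec J x.1)
    rw [length_padVec hd, addL_padVec] at h₁
    simp only [encSol, encItem] at ih
    simp [Body.cross₁, wp, encSol, encItem]
    refine .mk h₁ fun k₁ hk₁ => ?_
    refine .mk ih fun k₂ hk₂ => ⟨⟨⟨rfl, rfl⟩, rfl⟩, ?_⟩
    nlinarith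

theorem spec_cross (l l' : List (Sol n d)) :
    Spec (program J) Fn.cross (.pair (encL (encSol J) l) (encL (encSol J) l'))
      (encL (encSol J) (crossL l l')) (150 * (J + 10) * (l.length * (l'.length + 1) + 1)) := by
  induction l with
  | nil =>
    apply Spec.of_wp (body := Body.cross) rfl
    simp [Body.cross, wp, crossL]
    omega
  | cons x l ih =>
    apply Spec.of_wp (body := Body.cross) rfl
    have h := spec_cross₁ J hd x l' (crossL l l')
    simp [Body.cross, wp]
    refine .mk ih fun k₁ hk₁ => ?_
    refine .mk h fun k₂ hk₂ => ⟨rfl, ?_⟩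
    nlinarith [Nat.zero_le (J * l'.length), Nat.zero_le J]

omit hd in
theorem length_crossL (l l' : List (Sol n d)) : (crossL l l').length = l.length * l'.length := by
  induction l with
  | nil => simp [crossL]
  | cons x l ih =>
    simp only [crossL, List.flatMap_cons, List.length_append] at ih ⊢
    simp [ih]
    ring

end

/-! ### Tables -/

/-- The table of a node: a binary tree that branches over the vertices of the bag, in the order of
their labels. The first child is for the sets without the vertex, the second one for those with
it, and the leaves hold lists of solutions. -/
inductive Tbl (n d : ℕ) : Type
  | leaf (l : List (Sol n d)) : Tbl n d
  | node (u : Fin n) (a b : Tbl n d) : Tbl n d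

section
variable {n d : ℕ}

/-- A table as a value. -/
def Tbl.enc (J : ℕ) : Tbl n d → Val
  | leaf l => .pair .nil (encL (encSol J) l)
  | node u a b => .pair (.pair (.label u) .nil) (.pair (a.enc J) (b.enc J))

/-- The table branches over the vertices of `l`, and its entry for each set `S` of these vertices
satisfies `Φ S`. -/
def Tbl.Holds : List (Fin n) → (Finset (Fin n) → List (Sol n d) → Prop) → Tbl n d → Prop
  | [], Φ, leaf A => Φ ∅ A
  | u :: l, Φ, node u' a b => u' = u ∧ a.Holds l Φ ∧ b.Holds l fun S A => Φ (insert u S) A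
  | _, _, _ => False

theorem Tbl.Holds.congr : ∀ {l : List (Fin n)} {Φ Ψ : Finset (Fin n) → List (Sol n d) → Prop}
    {t : Tbl n d}, t.Holds l Φ → (∀ S ⊆ l.toFinset, ∀ A, Φ S A → Ψ S A) → t.Holds l Ψ
  | [], _, _, leaf _, h, h' => h' ∅ (by simp) _ h
  | u :: l, Φ, Ψ, node u' a b, ⟨h₁, h₂, h₃⟩, h' => by
    refine ⟨h₁, h₂.congr fun S hS A hA => h' S ?_ A hA, h₃.congr fun S hS A hA => h' _ ?_ A hA⟩
    · rw [List.toFinset_cons]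
      exact hS.trans (Finset.subset_insert _ _)
    · rw [List.toFinset_cons]
      exact Finset.insert_subset_insert _ hS

theorem eq_of_toFinset_eq {l l' : List (Fin n)} (hl : l.Pairwise (· < ·))
    (hl' : l'.Pairwise (· < ·)) (h : l.toFinset = l'.toFinset) : l = l' := by
  refine List.Perm.eq_of_pairwise (le := (· < ·)) (fun a b _ _ h h' => absurd h h'.asymm) hl hl' ?_
  rw [List.perm_ext_iff_of_nodup (hl.imp ne_of_lt) (hl'.imp ne_of_lt)]
  intro x
  rw [← List.mem_toFinset, h, List.mem_toFinset]

/-- The running time of a procedure that spends time `c` on each node of a table. -/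
def tblCost (c : ℕ) : ℕ → ℕ
  | 0 => c
  | k + 1 => 2 * tblCost c k + c

theorem tblCost_le (c k : ℕ) : tblCost c k ≤ c * 2 ^ (k + 1) := by
  have : tblCost c k + c = c * 2 ^ (k + 1) := by
    induction k with
    | zero => simp [tblCost]; ring
    | succ k ih => rw [tblCost, pow_succ, ← mul_assoc, ← ih]; ring
  omega

/-- The time for the computation of one entry of a table, when the lists that it is computed from
have at most `p` entries and `4 * p ^ 2 ≤ 2 ^ t`. -/
def leafCost (J p t : ℕ) : ℕ :=
  (2 * paretoConst J + 1000 * (J + 10)) * (p ^ 2 * (t + 1) ^ (J + 1))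

variable (J : ℕ) (hd : d ≤ J + 3) (p t : ℕ) (hp : 1 ≤ p) (ht : 4 * p ^ 2 ≤ 2 ^ t)

include hp in
theorem le_leafCost (m : ℕ) (hm : m ≤ 2 * p ^ 2) :
    paretoConst J * (max m 1 * (t + 1) ^ (J + 1)) + 1000 * (J + 10) * p ^ 2 ≤ leafCost J p t := by
  have h₁ : 1 ≤ (t + 1) ^ (J + 1) := Nat.one_le_pow _ _ (by omega)
  have h₂ : 1 ≤ p ^ 2 := Nat.one_le_pow _ _ hp
  calc _ ≤ paretoConst J * (2 * p ^ 2 * (t + 1) ^ (J + 1)) +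
        1000 * (J + 10) * (p ^ 2 * (t + 1) ^ (J + 1)) := by
        gcongr
        · omega
        · exact Nat.le_mul_of_pos_right _ h₁
    _ = _ := by rw [leafCost]; ring

include hd hp ht in
/-- A join node: the entries for the same set are combined in all possible ways. -/
theorem spec_join (l : List (Fin n)) : ∀ (Φ₁ Φ₂ Ψ : Finset (Fin n) → List (Sol n d) → Prop)
    (t₁ t₂ : Tbl n d), t₁.Holds l Φ₁ → t₂.Holds l Φ₂ →
    (∀ S ⊆ l.toFinset, ∀ A B, Φ₁ S A → Φ₂ S B → A.length ≤ p ∧ B.length ≤ p ∧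
      ∀ r : List (Sol n d), r.Perm (paretoL (crossL A B)) → Ψ S r) →
    ∃ t' : Tbl n d, t'.Holds l Ψ ∧
      Spec (program J) Fn.join (.pair (t₁.enc J) (t₂.enc J)) (t'.enc J)
        (tblCost (leafCost J p t + 100) l.length) := by
  induction l with
  | nil =>
    intro Φ₁ Φ₂ Ψ t₁ t₂ h₁ h₂ hΨ
    match t₁, t₂, h₁, h₂ with
    | .leaf A, .leaf B, h₁, h₂ =>
      obtain ⟨hA, hB, hr⟩ := hΨ ∅ (by simp) A B h₁ h₂
      have hAB : A.length * B.length ≤ p ^ 2 := by rw [sq]; gcongr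
      have c₁ := spec_cross J hd A B
      obtain ⟨r, hp', c₂⟩ := spec_pareto_sol J hd t (crossL A B) (by rw [length_crossL]; omega)
      refine ⟨.leaf r, hr r hp', ?_⟩
      rw [length_crossL] at c₂
      have hl := le_leafCost J p t hp (A.length * B.length) (by omega)
      have hc : 150 * (J + 10) * (A.length * (B.length + 1) + 1) ≤ 1000 * (J + 10) * p ^ 2 := by
        have : A.length * (B.length + 1) + 1 ≤ 3 * p ^ 2 := by nlinarith
        calc _ ≤ 150 * (J + 10) * (3 * p ^ 2) := by gcongr
          _ ≤ _ := by nlinarith [Nat.zero_le (J * p ^ 2)]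
      apply Spec.of_wp (body := Body.join) rfl
      simp [Body.join, wp, Tbl.enc, tblCost]
      refine .mk c₁ fun k₁ hk₁ => ?_
      refine .mk c₂ fun k₂ hk₂ => ⟨rfl, ?_⟩
      omega
  | cons u l ih =>
    intro Φ₁ Φ₂ Ψ t₁ t₂ h₁ h₂ hΨ
    match t₁, t₂, h₁, h₂ with
    | .node u₁ a₁ b₁, .node u₂ a₂ b₂, ⟨e₁, ha₁, hb₁⟩, ⟨e₂, ha₂, hb₂⟩ =>
      subst e₁
      obtain ⟨t₁, h₁, c₁⟩ := ih _ _ Ψ a₁ a₂ ha₁ ha₂ fun S hS A B hA hB =>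
        hΨ S (by rw [List.toFinset_cons]; exact hS.trans (Finset.subset_insert _ _)) A B hA hB
      obtain ⟨t₂, h₂, c₂⟩ := ih _ _ (fun S => Ψ (insert u₁ S)) b₁ b₂ hb₁ hb₂
        fun S hS A B hA hB =>
        hΨ _ (by rw [List.toFinset_cons]; exact Finset.insert_subset_insert _ hS) A B hA hB
      refine ⟨.node u₁ t₁ t₂, ⟨rfl, h₁, h₂⟩, ?_⟩
      apply Spec.of_wp (body := Body.join) rfl
      simp [Body.join, wp, Tbl.enc, tblCost]
      refine .mk c₁ fun k₁ hk₁ => ?_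
      refine .mk c₂ fun k₂ hk₂ => ⟨⟨rfl, rfl⟩, ?_⟩
      omega

/-- An introduce node: the table branches over `v` as well, but its entries do not depend on it. -/
theorem spec_ins (v : Fin n) (l : List (Fin n)) :
    ∀ (Φ : Finset (Fin n) → List (Sol n d) → Prop) (t : Tbl n d),
    l.Pairwise (· < ·) → v ∉ l → t.Holds l Φ →
    ∃ (l' : List (Fin n)) (t' : Tbl n d), l'.Pairwise (· < ·) ∧
      l'.toFinset = insert v l.toFinset ∧ t'.Holds l' (fun S A => Φ (S.erase v) A) ∧
      Spec (program J) Fn.ins (.pair (.label v) (t.enc J)) (t'.enc J) (tblCost 50 l.length) := by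
  have here : ∀ (Φ : Finset (Fin n) → List (Sol n d) → Prop) (l : List (Fin n)) (t : Tbl n d),
      v ∉ l → t.Holds l Φ →
      (Tbl.node v t t).Holds (v :: l) (fun S A => Φ (S.erase v) A) := by
    intro Φ l t hv h
    have hS : ∀ S ⊆ l.toFinset, v ∉ S := fun S hS hvS => hv (by simpa using hS hvS)
    exact ⟨rfl, h.congr fun S hS' A hA => by rwa [Finset.erase_eq_of_notMem (hS S hS')],
      h.congr fun S hS' A hA => by
        change Φ ((insert v S).erase v) A
        rwa [Finset.erase_insert (hS S hS')]⟩
  induction l with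
  | nil =>
    intro Φ t _ _ h
    match t, h with
    | .leaf A, h =>
      refine ⟨[v], .node v (.leaf A) (.leaf A), by simp, rfl, here Φ [] _ (by simp) h, ?_⟩
      apply Spec.of_wp (body := Body.ins) rfl
      simp [Body.ins, wp, Tbl.enc, tblCost]
  | cons u l ih =>
    intro Φ t hl hv h
    have hl' := List.pairwise_cons.1 hl
    by_cases hvu : v ≤ u
    · refine ⟨v :: u :: l, .node v t t, ?_, by simp, here Φ _ _ hv h, ?_⟩
      · refine List.pairwise_cons.2 ⟨fun z hz => ?_, hl⟩
        have hvu : v < u := lt_of_le_of_ne hvu fun e => hv (by simp [e])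
        rcases List.mem_cons.1 hz with rfl | hz
        · exact hvu
        · exact hvu.trans (hl'.1 z hz)
      · match t, h with
        | .node u' a b, ⟨e, _, _⟩ =>
          subst e
          apply Spec.of_wp (body := Body.ins) rfl
          simp [Body.ins, wp, Tbl.enc, tblCost, hvu]
    · match t, h with
      | .node u' a b, ⟨e, ha, hb⟩ =>
        subst e
        have hv' : v ∉ l := fun h => hv (by simp [h])
        obtain ⟨l₁, t₁, s₁, e₁, h₁, c₁⟩ := ih Φ a hl'.2 hv' ha
        obtain ⟨l₂, t₂, s₂, e₂, h₂, c₂⟩ := ih _ b hl'.2 hv' hb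
        obtain rfl : l₁ = l₂ := eq_of_toFinset_eq s₁ s₂ (e₁.trans e₂.symm)
        refine ⟨u' :: l₁, .node u' t₁ t₂, ?_, ?_, ⟨rfl, h₁, h₂.congr fun S hS A hA => ?_⟩, ?_⟩
        · refine List.pairwise_cons.2 ⟨fun z hz => ?_, s₁⟩
          rw [← List.mem_toFinset, e₁, Finset.mem_insert, List.mem_toFinset] at hz
          rcases hz with rfl | hz
          · exact not_le.1 hvu
          · exact hl'.1 z hz
        · rw [List.toFinset_cons, List.toFinset_cons, e₁, Finset.insert_comm]
        · change Φ ((insert u' S).erase v) A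
          rwa [Finset.erase_insert_of_ne (fun e => hvu (le_of_eq e.symm))]
        · apply Spec.of_wp (body := Body.ins) rfl
          simp [Body.ins, wp, Tbl.enc, tblCost, hvu]
          refine .mk c₁ fun k₁ hk₁ => ?_
          refine .mk c₂ fun k₂ hk₂ => ⟨⟨rfl, rfl⟩, ?_⟩
          omega

/-- The value `e` is an entry of the adjacency matrix for an edge of weight `x`, where `x = 0` if
there is no edge. -/
def IsEntry (e : Val) (x : Fin d → ℝ) : Prop := e = .nil ∧ x = 0 ∨ e = encR (List.ofFn x)

include hd in
theorem spec_addVec_entry {e : Val} {y : Fin d → ℝ} (he : IsEntry e y) (x : Fin d → ℝ) :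
    Spec (program J) Fn.addVec (.pair (encR (padVec J x)) e) (encR (padVec J (x + y)))
      (30 * (J + 4)) := by
  rcases he with ⟨rfl, rfl⟩ | rfl
  · have := spec_addVec J (padVec J x) []
    rw [addL_nil, length_padVec hd] at this
    rwa [add_zero]
  · have := spec_addVec J (padVec J x) (List.ofFn y)
    rwa [addL_padVec_ofFn, length_padVec hd] at this

variable (f : ℕ → Val) (w : Fin n → Fin d → ℝ) (v : Fin n)

include hd hp ht in
/-- The part of a forget node below the branching over `v`. On the way to a leaf, `x` collects the
weights of the edges from `v` to the chosen vertices of the bag, which are cut if `v` is not chosen,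
and `y` those to the other vertices, which are cut if `v` is chosen. -/
theorem spec_comb (l : List (Fin n)) : ∀ (Φ₁ Φ₂ Ψ : Finset (Fin n) → List (Sol n d) → Prop)
    (t₁ t₂ : Tbl n d) (x y : Fin d → ℝ), (∀ u ∈ l, IsEntry (f u) (w u)) → l.Nodup →
    t₁.Holds l Φ₁ → t₂.Holds l Φ₂ →
    (∀ S ⊆ l.toFinset, ∀ A B, Φ₁ S A → Φ₂ S B → A.length ≤ p ∧ B.length ≤ p ∧
      ∀ r : List (Sol n d), r.Perm (paretoL
        (A.map (Sol.add (x + ∑ u ∈ S, w u, .empty)) ++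
          B.map (Sol.add (y + ∑ u ∈ l.toFinset \ S, w u, .single v)))) → Ψ S r) →
    ∃ t' : Tbl n d, t'.Holds l Ψ ∧
      Spec (program J) Fn.comb (.pair (.array f) (.pair (.label v) (.pair (encR (padVec J x))
        (.pair (encR (padVec J y)) (.pair (t₁.enc J) (t₂.enc J)))))) (t'.enc J)
        (tblCost (leafCost J p t + 200 * (J + 10)) l.length) := by
  induction l with
  | nil =>
    intro Φ₁ Φ₂ Ψ t₁ t₂ x y _ _ h₁ h₂ hΨ
    match t₁, t₂, h₁, h₂ with
    | .leaf A, .leaf B, h₁, h₂ =>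
      obtain ⟨hA, hB, hr⟩ := hΨ ∅ (by simp) A B h₁ h₂
      simp only [Finset.sum_empty, List.toFinset_nil, Finset.empty_sdiff, add_zero] at hr
      have c₁ := spec_cross₁ J hd (y, .single v) B []
      have c₂ := spec_cross₁ J hd (x, .empty) A (B.map (Sol.add (y, .single v)))
      rw [List.append_nil] at c₁
      have hpp : p ≤ p ^ 2 := Nat.le_self_pow (by omega) _
      have hlen : (A.map (Sol.add (x, .empty)) ++ B.map (Sol.add (y, .single v))).length ≤
          2 * p ^ 2 := by simp; omega
      obtain ⟨r, hp', c₃⟩ := spec_pareto_sol J hd t _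
        ((Nat.mul_le_mul_left 2 hlen).trans (by omega))
      refine ⟨.leaf r, hr r hp', ?_⟩
      have hl := le_leafCost J p t hp _ hlen
      have hc₁ : 100 * (J + 10) * (A.length + 1) ≤ 200 * (J + 10) * p ^ 2 := by
        calc _ ≤ 100 * (J + 10) * (2 * p ^ 2) := by gcongr; omega
          _ = _ := by ring
      have hc₂ : 100 * (J + 10) * (B.length + 1) ≤ 200 * (J + 10) * p ^ 2 := by
        calc _ ≤ 100 * (J + 10) * (2 * p ^ 2) := by gcongr; omega
          _ = _ := by ring
      have hc₃ : 1000 * (J + 10) * p ^ 2 = 200 * (J + 10) * p ^ 2 + 200 * (J + 10) * p ^ 2 +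
          600 * (J + 10) * p ^ 2 := by ring
      apply Spec.of_wp (body := Body.comb) rfl
      simp [Body.comb, wp, Tbl.enc, tblCost]
      refine .mk c₁ fun k₁ hk₁ => ?_
      refine .mk c₂ fun k₂ hk₂ => ?_
      refine .mk c₃ fun k₃ hk₃ => ⟨rfl, ?_⟩
      omega
  | cons u l ih =>
    intro Φ₁ Φ₂ Ψ t₁ t₂ x y hf hl h₁ h₂ hΨ
    match t₁, t₂, h₁, h₂ with
    | .node u₁ a₁ b₁, .node u₂ a₂ b₂, ⟨e₁, ha₁, hb₁⟩, ⟨e₂, ha₂, hb₂⟩ =>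
      subst e₁
      obtain ⟨hul, hl⟩ := List.nodup_cons.1 hl
      have hul' : u₁ ∉ l.toFinset := by simpa using hul
      have c₃ := spec_addVec_entry J hd (hf u₁ (by simp)) x
      have c₄ := spec_addVec_entry J hd (hf u₁ (by simp)) y
      have hf : ∀ u ∈ l, IsEntry (f u) (w u) := fun u hu => hf u (by simp [hu])
      obtain ⟨t₁, h₁, c₁⟩ := ih _ _ Ψ a₁ a₂ x (y + w u₁) hf hl ha₁ ha₂ fun S hS A B hA hB => by
        have := hΨ S (by rw [List.toFinset_cons]; exact hS.trans (Finset.subset_insert _ _))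
          A B hA hB
        rw [List.toFinset_cons, Finset.insert_sdiff_of_notMem _ (fun h => hul' (hS h)),
          Finset.sum_insert (fun h => hul' (Finset.sdiff_subset h)), ← add_assoc] at this
        exact this
      obtain ⟨t₂, h₂, c₂⟩ := ih _ _ (fun S => Ψ (insert u₁ S)) b₁ b₂ (x + w u₁) y hf hl hb₁ hb₂
        fun S hS A B hA hB => by
        have := hΨ _ (by rw [List.toFinset_cons]; exact Finset.insert_subset_insert _ hS)
          A B hA hB
        rw [List.toFinset_cons, Finset.insert_sdiff_insert, Finset.sdiff_insert_of_notMem hul',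
          Finset.sum_insert (fun h => hul' (hS h)), ← add_assoc] at this
        exact this
      refine ⟨.node u₁ t₁ t₂, ⟨rfl, h₁, h₂⟩, ?_⟩
      apply Spec.of_wp (body := Body.comb) rfl
      simp [Body.comb, wp, Tbl.enc, tblCost]
      refine .mk c₄ fun k₄ hk₄ => ?_
      refine .mk c₁ fun k₁ hk₁ => ?_
      refine .mk c₃ fun k₃ hk₃ => ?_
      refine .mk c₂ fun k₂ hk₂ => ⟨⟨rfl, rfl⟩, ?_⟩
      omega

include hd hp ht in
/-- A forget node: the recursion descends to the branching over `v`, with `x` and `y` as in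
`spec_comb`. -/
theorem spec_forget (l : List (Fin n)) : ∀ (Φ Ψ : Finset (Fin n) → List (Sol n d) → Prop)
    (t₁ : Tbl n d) (x y : Fin d → ℝ), (∀ u ∈ l, IsEntry (f u) (w u)) → l.Pairwise (· < ·) →
    v ∈ l → t₁.Holds l Φ →
    (∀ S ⊆ l.toFinset.erase v, ∀ A B, Φ S A → Φ (insert v S) B → A.length ≤ p ∧ B.length ≤ p ∧
      ∀ r : List (Sol n d), r.Perm (paretoL
        (A.map (Sol.add (x + ∑ u ∈ S, w u, .empty)) ++
          B.map (Sol.add (y + ∑ u ∈ l.toFinset.erase v \ S, w u, .single v)))) → Ψ S r) →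
    ∃ t' : Tbl n d, t'.Holds (l.erase v) Ψ ∧
      Spec (program J) Fn.forget (.pair (.array f) (.pair (.label v) (.pair (encR (padVec J x))
        (.pair (encR (padVec J y)) (t₁.enc J))))) (t'.enc J)
        (tblCost (leafCost J p t + 200 * (J + 10)) l.length) := by
  induction l with
  | nil => simp
  | cons u l ih =>
    intro Φ Ψ t₁ x y hf hl hv h hΨ
    match t₁, h with
    | .node u' a b, ⟨e, ha, hb⟩ =>
      subst e
      have hl' := List.pairwise_cons.1 hl
      have hul : u' ∉ l := fun h => (hl'.1 u' h).false
      have hul' : u' ∉ l.toFinset := by simpa using hul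
      by_cases hvu : v = u'
      · subst hvu
        rw [List.erase_cons_head]
        rw [List.toFinset_cons, Finset.erase_insert hul'] at hΨ
        obtain ⟨t', h', c⟩ := spec_comb J hd p t hp ht f w v l Φ (fun S => Φ (insert v S)) Ψ a b
          x y (fun u hu => hf u (by simp [hu])) (hl'.2.imp ne_of_lt) ha hb hΨ
        refine ⟨t', h', ?_⟩
        apply Spec.of_wp (body := Body.forget) rfl
        simp [Body.forget, wp, Tbl.enc, tblCost]
        refine .mk c fun k hk => ⟨rfl, ?_⟩
        omega
      · have hv' : v ∈ l := (List.mem_cons.1 hv).resolve_left hvu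
        have hlt : ¬ v ≤ u' := not_le.2 (hl'.1 v hv')
        have c₃ := spec_addVec_entry J hd (hf u' (by simp)) x
        have c₄ := spec_addVec_entry J hd (hf u' (by simp)) y
        have hf : ∀ u ∈ l, IsEntry (f u) (w u) := fun u hu => hf u (by simp [hu])
        have hul₂ : u' ∉ l.toFinset.erase v := fun h => hul' (Finset.mem_of_mem_erase h)
        rw [List.toFinset_cons, Finset.erase_insert_of_ne (Ne.symm hvu)] at hΨ
        rw [List.erase_cons_tail (by simpa using Ne.symm hvu)]
        obtain ⟨t₁, h₁, c₁⟩ := ih Φ Ψ a x (y + w u') hf hl'.2 hv' ha fun S hS A B hA hB => by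
          have := hΨ S (hS.trans (Finset.subset_insert _ _)) A B hA hB
          rw [Finset.insert_sdiff_of_notMem _ (fun h => hul₂ (hS h)),
            Finset.sum_insert (fun h => hul₂ (Finset.sdiff_subset h)), ← add_assoc] at this
          exact this
        obtain ⟨t₂, h₂, c₂⟩ := ih (fun S => Φ (insert u' S)) (fun S => Ψ (insert u' S)) b
          (x + w u') y hf hl'.2 hv' hb fun S hS A B hA hB => by
          rw [Finset.insert_comm] at hB
          have := hΨ _ (Finset.insert_subset_insert _ hS) A B hA hB
          rw [Finset.insert_sdiff_insert, Finset.sdiff_insert_of_notMem hul₂,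
            Finset.sum_insert (fun h => hul₂ (hS h)), ← add_assoc] at this
          exact this
        refine ⟨.node u' t₁ t₂, ⟨rfl, h₁, h₂⟩, ?_⟩
        apply Spec.of_wp (body := Body.forget) rfl
        simp [Body.forget, wp, Tbl.enc, tblCost, hlt]
        refine .mk c₄ fun k₄ hk₄ => ?_
        refine .mk c₁ fun k₁ hk₁ => ?_
        refine .mk c₃ fun k₃ hk₃ => ?_
        refine .mk c₂ fun k₂ hk₂ => ⟨⟨rfl, rfl⟩, ?_⟩
        omega

end

/-! ### Tree decompositions -/

namespace NiceTree

variable {n : ℕ}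

theorem at?_append (T : NiceTree n) (a b : List Bool) :
    T.at? (a ++ b) = (T.at? a).bind fun U => U.at? b := by
  induction a generalizing T with
  | nil => cases T <;> simp [at?]
  | cons c a ih => cases T <;> cases c <;> simp [at?, ih]

theorem at?_nil (T : NiceTree n) : T.at? [] = some T := by cases T <;> simp [at?]

theorem mem_nodes_iff {T U : NiceTree n} : U ∈ T.nodes ↔ ∃ a, T.at? a = some U := by
  constructor
  · intro h
    induction T with
    | leaf => exact ⟨[], by simp_all [nodes, at?]⟩
    | introduce v T ih =>
      rcases List.mem_cons.1 h with rfl | h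
      · exact ⟨[], at?_nil _⟩
      · obtain ⟨a, ha⟩ := ih h
        exact ⟨false :: a, ha⟩
    | forget v T ih =>
      rcases List.mem_cons.1 h with rfl | h
      · exact ⟨[], at?_nil _⟩
      · obtain ⟨a, ha⟩ := ih h
        exact ⟨false :: a, ha⟩
    | join T₁ T₂ ih₁ ih₂ =>
      rcases List.mem_cons.1 h with rfl | h
      · exact ⟨[], at?_nil _⟩
      · rcases List.mem_append.1 h with h | h
        · obtain ⟨a, ha⟩ := ih₁ h
          exact ⟨false :: a, ha⟩
        · obtain ⟨a, ha⟩ := ih₂ h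
          exact ⟨true :: a, ha⟩
  · rintro ⟨a, h⟩
    induction a generalizing T with
    | nil =>
      rw [at?_nil, Option.some.injEq] at h
      subst h
      cases T <;> simp [nodes]
    | cons c a ih =>
      cases T <;> cases c <;> simp only [at?, reduceCtorEq] at h <;> simp [nodes, ih h]

theorem bag_subset_verts (T : NiceTree n) : T.bag ⊆ T.verts := by
  induction T with
  | leaf => exact subset_rfl
  | introduce v T ih => exact Finset.insert_subset_insert _ ih
  | forget v T ih => exact (Finset.erase_subset _ _).trans ih
  | join T₁ T₂ ih₁ _ => exact ih₁.trans Finset.subset_union_left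

theorem mem_verts_iff {T : NiceTree n} {v : Fin n} :
    v ∈ T.verts ↔ ∃ U ∈ T.nodes, v ∈ U.bag := by
  constructor
  · intro h
    induction T with
    | leaf => simp [verts] at h
    | introduce u T ih =>
      rcases Finset.mem_insert.1 h with rfl | h
      · exact ⟨_, List.mem_cons_self, Finset.mem_insert_self _ _⟩
      · obtain ⟨U, hU, hv⟩ := ih h
        exact ⟨U, List.mem_cons_of_mem _ hU, hv⟩
    | forget u T ih =>
      obtain ⟨U, hU, hv⟩ := ih h
      exact ⟨U, List.mem_cons_of_mem _ hU, hv⟩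
    | join T₁ T₂ ih₁ ih₂ =>
      rcases Finset.mem_union.1 h with h | h
      · obtain ⟨U, hU, hv⟩ := ih₁ h
        exact ⟨U, by simp [nodes, hU], hv⟩
      · obtain ⟨U, hU, hv⟩ := ih₂ h
        exact ⟨U, by simp [nodes, hU], hv⟩
  · rintro ⟨U, hU, hv⟩
    induction T with
    | leaf =>
      obtain rfl : U = leaf := by simpa [nodes] using hU
      simp [bag] at hv
    | introduce u T ih =>
      rcases List.mem_cons.1 hU with rfl | h
      · exact bag_subset_verts _ hv
      · exact Finset.mem_insert_of_mem (ih h)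
    | forget u T ih =>
      rcases List.mem_cons.1 hU with rfl | h
      · exact bag_subset_verts _ hv
      · exact ih h
    | join T₁ T₂ ih₁ ih₂ =>
      rcases List.mem_cons.1 hU with rfl | h
      · exact bag_subset_verts _ hv
      · rcases List.mem_append.1 h with h | h
        · exact Finset.mem_union_left _ (ih₁ h)
        · exact Finset.mem_union_right _ (ih₂ h)

/-- If `v` is introduced at or below a node and missing in the bag of the node, then it occurs only
below that node, since its occurrences are connected. -/
theorem IsNiceTreeDecomposition.prefix_of_mem {T : NiceTree n} {G : SimpleGraph (Fin n)}
    (hT : T.IsNiceTreeDecomposition G) {a : List Bool} {U : NiceTree n} (ha : T.at? a = some U)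
    {v : Fin n} (hv : v ∈ U.verts) (hv' : v ∉ U.bag) {b : List Bool}
    (hb : b ∈ T.occurrences v) : a <+: b := by
  obtain ⟨W, hW, hvW⟩ := mem_verts_iff.1 hv
  obtain ⟨c, hc⟩ := mem_nodes_iff.1 hW
  have hac : a ++ c ∈ T.occurrences v := ⟨W, by rw [at?_append, ha]; exact hc, hvW⟩
  have haocc : a ∉ T.occurrences v := by
    rintro ⟨W', hW', h⟩
    rw [ha, Option.some.injEq] at hW'
    exact hv' (hW' ▸ h)
  have step : ∀ x y : T.occurrences v, (addressGraph.induce (T.occurrences v)).Adj x y →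
      a <+: x.1 → a <+: y.1 := by
    intro x y hxy hx
    simp only [SimpleGraph.comap_adj, Function.Embedding.subtype_apply, addressGraph,
      SimpleGraph.fromRel_adj] at hxy
    obtain ⟨-, ⟨e, he⟩ | ⟨e, he⟩⟩ := hxy
    · rw [he]
      exact hx.trans (List.prefix_append _ _)
    · rw [he] at hx
      rcases List.prefix_concat_iff.1 hx with h | h
      · exact absurd (by rw [h, ← he]; exact x.2) haocc
      · exact h
  have walk : ∀ x y : T.occurrences v, (addressGraph.induce (T.occurrences v)).Walk x y →
      a <+: x.1 → a <+: y.1 := by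
    intro x y w
    induction w with
    | nil => exact id
    | cons h _ ih => exact fun hx => ih (step _ _ h hx)
  obtain ⟨w⟩ := (hT.connected v).preconnected ⟨a ++ c, hac⟩ ⟨b, hb⟩
  exact walk _ _ w (List.prefix_append _ _)

/-- The vertices that have been forgotten at the root node or below it. -/
def forgotten (U : NiceTree n) : Finset (Fin n) := U.verts \ U.bag

/-- The properties of the nodes of a nice tree decomposition that dynamic programming relies on: a
vertex is introduced only once on each path, the subtrees below a join node share only vertices of
its bag, and all neighbours of a vertex that is forgotten below a node are introduced there. -/
def Separated (G : SimpleGraph (Fin n)) (U : NiceTree n) : Prop :=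
  (∀ v ∈ U.verts, v ∉ U.bag → ∀ u, G.Adj v u → u ∈ U.verts) ∧
  match U with
  | leaf => True
  | introduce v T => v ∉ T.verts ∧ T.Separated G
  | forget v T => v ∈ T.bag ∧ T.Separated G
  | join T₁ T₂ => T₁.bag = T₂.bag ∧ T₁.verts ∩ T₂.verts ⊆ T₁.bag ∧ T₁.Separated G ∧
      T₂.Separated G

theorem Separated.mem_verts_of_adj {G : SimpleGraph (Fin n)} {U : NiceTree n} (h : U.Separated G)
    {u v : Fin n} (hv : v ∈ U.forgotten) (hvu : G.Adj v u) : u ∈ U.verts := by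
  obtain ⟨hv, hv'⟩ := Finset.mem_sdiff.1 hv
  cases U <;> exact h.1 v hv hv' u hvu

theorem IsNiceTreeDecomposition.separated_of_at? {T : NiceTree n} {G : SimpleGraph (Fin n)}
    (hT : T.IsNiceTreeDecomposition G) (U : NiceTree n) : ∀ (a : List Bool), T.at? a = some U →
    U.WellFormed → U.Separated G := by
  have closed : ∀ (U : NiceTree n) (a : List Bool), T.at? a = some U →
      ∀ v ∈ U.verts, v ∉ U.bag → ∀ u, G.Adj v u → u ∈ U.verts := by
    intro U a ha v hv hv' u huv
    obtain ⟨W, hW, h₁, h₂⟩ := hT.edge_covered v u huv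
    obtain ⟨b, hb⟩ := mem_nodes_iff.1 hW
    obtain ⟨c, rfl⟩ := hT.prefix_of_mem ha hv hv' ⟨W, hb, h₁⟩
    rw [at?_append, ha] at hb
    exact mem_verts_iff.2 ⟨W, mem_nodes_iff.2 ⟨c, hb⟩, h₂⟩
  induction U with
  | leaf => exact fun a ha _ => ⟨closed _ a ha, trivial⟩
  | introduce v U ih =>
    intro a ha hwf
    have ha' : T.at? (a ++ [false]) = some U := by rw [at?_append, ha]; simp [at?, at?_nil]
    refine ⟨closed _ a ha, fun hv => ?_, ih _ ha' hwf.2⟩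
    have := hT.prefix_of_mem ha' hv hwf.1 (b := a) ⟨_, ha, Finset.mem_insert_self _ _⟩
    simpa using this.length_le
  | forget v U ih =>
    intro a ha hwf
    have ha' : T.at? (a ++ [false]) = some U := by rw [at?_append, ha]; simp [at?, at?_nil]
    exact ⟨closed _ a ha, hwf.1, ih _ ha' hwf.2⟩
  | join U₁ U₂ ih₁ ih₂ =>
    intro a ha hwf
    have h₁ : T.at? (a ++ [false]) = some U₁ := by rw [at?_append, ha]; simp [at?, at?_nil]
    have h₂ : T.at? (a ++ [true]) = some U₂ := by rw [at?_append, ha]; simp [at?, at?_nil]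
    refine ⟨closed _ a ha, hwf.1, fun v hv => ?_, ih₁ _ h₁ hwf.2.1, ih₂ _ h₂ hwf.2.2⟩
    obtain ⟨hv₁, hv₂⟩ := Finset.mem_inter.1 hv
    by_contra hb
    obtain ⟨W, hW, hvW⟩ := mem_verts_iff.1 hv₂
    obtain ⟨c, hc⟩ := mem_nodes_iff.1 hW
    have := hT.prefix_of_mem h₁ hv₁ hb (b := a ++ [true] ++ c)
      ⟨W, by rw [at?_append, h₂]; exact hc, hvW⟩
    rw [List.append_assoc, List.prefix_append_right_inj] at this
    simp at this

theorem IsNiceTreeDecomposition.separated {T : NiceTree n} {G : SimpleGraph (Fin n)}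
    (hT : T.IsNiceTreeDecomposition G) : T.Separated G :=
  hT.separated_of_at? T [] (at?_nil T) hT.wellFormed

theorem WellFormed.of_mem_nodes {T U : NiceTree n} (hT : T.WellFormed) (hU : U ∈ T.nodes) :
    U.WellFormed := by
  induction T with
  | leaf =>
    obtain rfl : U = leaf := by simpa [nodes] using hU
    exact hT
  | introduce v T ih =>
    rcases List.mem_cons.1 hU with rfl | h
    exacts [hT, ih hT.2 h]
  | forget v T ih =>
    rcases List.mem_cons.1 hU with rfl | h
    exacts [hT, ih hT.2 h]
  | join T₁ T₂ ih₁ ih₂ =>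
    rcases List.mem_cons.1 hU with rfl | h
    · exact hT
    · rcases List.mem_append.1 h with h | h
      exacts [ih₁ hT.2.1 h, ih₂ hT.2.2 h]

end NiceTree

/-! ### Cut costs -/

section
variable {n : ℕ} {M : Type*} [AddCommGroup M]

/-- The part of the cost of the cut `p` that is due to the edges with an end in `Z`. Here `c` holds
the weights of the edges between inner vertices, `a` those of the edges to the sink, and `b` those
of the edges to the source. -/
def partCost (c : Fin n → Fin n → M) (a b : Fin n → M) (Z p : Finset (Fin n)) : M :=
  (∑ u, ∑ v, if (u ∈ p ∧ v ∉ p) ∧ (u ∈ Z ∨ v ∈ Z) then c u v else 0) +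
    ∑ z ∈ Z, if z ∈ p then a z else b z

variable (c : Fin n → Fin n → M) (a b : Fin n → M)

theorem partCost_empty (p : Finset (Fin n)) : partCost c a b ∅ p = 0 := by
  simp [partCost]

/-- The part of the cost due to `Z` depends on the cut only within the neighbourhood of `Z`. -/
theorem partCost_congr {Z V p p' : Finset (Fin n)} (hc : ∀ u v, c u v = c v u) (hZ : Z ⊆ V)
    (hV : ∀ u ∈ Z, ∀ v, c u v ≠ 0 → v ∈ V) (hp : ∀ v ∈ V, v ∈ p ↔ v ∈ p') :
    partCost c a b Z p = partCost c a b Z p' := by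
  unfold partCost
  congr 1
  · refine Finset.sum_congr rfl fun u _ => Finset.sum_congr rfl fun v _ => ?_
    by_cases h0 : c u v = 0
    · simp [h0]
    · refine if_congr (and_congr_left fun h => ?_) rfl rfl
      have hu : u ∈ V := h.elim (fun h => hZ h) fun h => hV v h u (by rwa [hc v u])
      have hv : v ∈ V := h.elim (fun h => hV u h v h0) fun h => hZ h
      rw [hp u hu, hp v hv]
  · exact Finset.sum_congr rfl fun z hz => if_congr (hp z (hZ hz)) rfl rfl

/-- All costs that do not involve `Z` depend only on the cut outside `Z`. -/
theorem partCost_univ_sub {Z p p' : Finset (Fin n)} (hp : ∀ v ∉ Z, v ∈ p ↔ v ∈ p') :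
    partCost c a b Finset.univ p - partCost c a b Z p =
      partCost c a b Finset.univ p' - partCost c a b Z p' := by
  have key : ∀ p : Finset (Fin n), partCost c a b Finset.univ p - partCost c a b Z p =
      (∑ u, ∑ v, if (u ∈ p ∧ v ∉ p) ∧ u ∉ Z ∧ v ∉ Z then c u v else 0) +
        ∑ z ∈ Zᶜ, if z ∈ p then a z else b z := by
    intro p
    rw [sub_eq_iff_eq_add', partCost, partCost, add_add_add_comm, Finset.sum_add_sum_compl]
    congr 1
    rw [← Finset.sum_add_distrib]
    refine Finset.sum_congr rfl fun u _ => ?_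
    rw [← Finset.sum_add_distrib]
    refine Finset.sum_congr rfl fun v _ => ?_
    by_cases h : u ∈ p ∧ v ∉ p <;> by_cases h₁ : u ∈ Z <;> by_cases h₂ : v ∈ Z <;>
      simp [h, h₁, h₂]
  rw [key, key]
  congr 1
  · refine Finset.sum_congr rfl fun u _ => Finset.sum_congr rfl fun v _ => ?_
    refine if_congr (and_congr_left fun h => ?_) rfl rfl
    rw [hp u h.1, hp v h.2]
  · refine Finset.sum_congr rfl fun z hz => if_congr (hp z ?_) rfl rfl
    simpa using hz

theorem partCost_union {Z Z' : Finset (Fin n)} (hc : ∀ u v, c u v = c v u)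
    (hd : Disjoint Z Z') (h0 : ∀ u ∈ Z, ∀ v ∈ Z', c u v = 0) (p : Finset (Fin n)) :
    partCost c a b (Z ∪ Z') p = partCost c a b Z p + partCost c a b Z' p := by
  unfold partCost
  rw [Finset.sum_union hd, add_add_add_comm, ← Finset.sum_add_distrib]
  congr 1
  refine Finset.sum_congr rfl fun u _ => ?_
  rw [← Finset.sum_add_distrib]
  refine Finset.sum_congr rfl fun v _ => ?_
  have h₁ : u ∈ Z → u ∉ Z' := fun h h' => Finset.disjoint_left.1 hd h h'
  have h₂ : v ∈ Z → v ∉ Z' := fun h h' => Finset.disjoint_left.1 hd h h'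
  have h₃ : u ∈ Z → v ∈ Z' → c u v = 0 := fun h h' => h0 u h v h'
  have h₄ : u ∈ Z' → v ∈ Z → c u v = 0 := fun h h' => by rw [hc]; exact h0 v h' u h
  by_cases h : u ∈ p ∧ v ∉ p
  · by_cases huZ : u ∈ Z <;> by_cases hvZ : v ∈ Z <;> by_cases huZ' : u ∈ Z' <;>
      by_cases hvZ' : v ∈ Z' <;> simp_all
  · simp [h]

/-- Forgetting `v` adds the edges from `v` to the outside of `Z` that the cut contains. -/
theorem partCost_insert {Z : Finset (Fin n)} {v : Fin n} (hc : ∀ u v, c u v = c v u)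
    (hv : v ∉ Z) (p : Finset (Fin n)) :
    partCost c a b (insert v Z) p =
      (if v ∈ p then a v + ∑ u ∈ Finset.univ.filter (fun u => u ∉ p ∧ u ∉ Z), c v u
        else b v + ∑ u ∈ Finset.univ.filter (fun u => u ∈ p ∧ u ∉ Z), c v u) +
      partCost c a b Z p := by
  have e : (∑ u, ∑ w, if (u ∈ p ∧ w ∉ p) ∧ (u ∈ insert v Z ∨ w ∈ insert v Z) then c u w else 0) =
      (∑ u, ∑ w, if (u ∈ p ∧ w ∉ p) ∧ (u ∈ Z ∨ w ∈ Z) then c u w else 0) +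
      if v ∈ p then ∑ u ∈ Finset.univ.filter (fun u => u ∉ p ∧ u ∉ Z), c v u
        else ∑ u ∈ Finset.univ.filter (fun u => u ∈ p ∧ u ∉ Z), c v u := by
    have h₁ : ∀ u w, (if (u ∈ p ∧ w ∉ p) ∧ (u ∈ insert v Z ∨ w ∈ insert v Z) then c u w else 0) =
        (if (u ∈ p ∧ w ∉ p) ∧ (u ∈ Z ∨ w ∈ Z) then c u w else 0) +
        ((if u = v then if v ∈ p ∧ w ∉ p ∧ w ∉ Z then c v w else 0 else 0) +
        if w = v then if v ∉ p ∧ u ∈ p ∧ u ∉ Z then c v u else 0 else 0) := by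
      intro u w
      by_cases huv : u = v
      · subst huv
        by_cases hwv : w = u
        · subst hwv
          by_cases h : w ∈ p <;> simp [h]
        · by_cases h₁ : u ∈ p <;> by_cases h₂ : w ∈ p <;> by_cases h₃ : w ∈ Z <;>
            simp [h₁, h₂, h₃, hwv, hv]
      · by_cases hwv : w = v
        · subst hwv
          by_cases h₁ : u ∈ p <;> by_cases h₂ : w ∈ p <;> by_cases h₃ : u ∈ Z <;>
            simp [h₁, h₂, h₃, huv, hv, hc u w]
        · simp [huv, hwv]
    simp only [h₁, Finset.sum_add_distrib]
    congr 1
    rw [Finset.sum_comm (f := fun u w =>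
      if u = v then if v ∈ p ∧ w ∉ p ∧ w ∉ Z then c v w else 0 else (0 : M))]
    simp only [Finset.sum_ite_eq', Finset.mem_univ, if_true, Finset.sum_filter]
    by_cases hvp : v ∈ p <;> simp [hvp]
  unfold partCost
  rw [e, Finset.sum_insert hv]
  split_ifs <;> abel
end

/-! ### The costs of the cuts of an instance -/

section
variable {n d : ℕ} (I : CutInstance n d)

open Classical in
/-- The cost of the edge between two vertices, and zero if there is none. -/
noncomputable def CutInstance.weight (x y : Vert n) : Fin d → ℝ :=
  if I.graph.Adj x y then I.cost s(x, y) else 0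

theorem CutInstance.weight_comm (x y : Vert n) : I.weight x y = I.weight y x := by
  by_cases h : I.graph.Adj x y
  · rw [weight, weight, if_pos h, if_pos h.symm, Sym2.eq_swap]
  · rw [weight, weight, if_neg h, if_neg fun h' => h h'.symm]

/-- The part of the cost of a cut of `I` that is due to the edges with an end in `Z`. -/
noncomputable def CutInstance.partCost (Z p : Finset (Fin n)) : Fin d → ℝ :=
  ParetoCut.partCost (fun u v => I.weight (.inl u) (.inl v)) (fun u => I.weight (.inl u) snk)
    (fun u => I.weight src (.inl u)) Z p

theorem mem_srcSide_inl {S : Finset (Fin n)} {v : Fin n} : Sum.inl v ∈ srcSide S ↔ v ∈ S := by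
  simp [srcSide, src]

theorem mem_snkSide_inl {S : Finset (Fin n)} {v : Fin n} : Sum.inl v ∈ snkSide S ↔ v ∉ S := by
  simp [snkSide, snk]

theorem mem_srcSide_inr {S : Finset (Fin n)} {b : Bool} :
    Sum.inr b ∈ srcSide S ↔ b = false := by
  simp [srcSide, src]

theorem mem_snkSide_inr {S : Finset (Fin n)} {b : Bool} : Sum.inr b ∈ snkSide S ↔ b = true := by
  simp [snkSide, snk]

theorem disjoint_sides {S : Finset (Fin n)} {x : Vert n} (h : x ∈ srcSide S) :
    x ∉ snkSide S := by
  cases x with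
  | inl v => rw [mem_snkSide_inl, not_not]; exact mem_srcSide_inl.1 h
  | inr b => rw [mem_snkSide_inr, mem_srcSide_inr.1 h]; simp

open Classical in
theorem CutInstance.cutCost_eq_sum (S : Finset (Fin n)) :
    I.cutCost S =
      ∑ x, ∑ y, if x ∈ srcSide S ∧ y ∈ snkSide S then I.weight x y else 0 := by
  rw [← Finset.sum_product', Finset.univ_product_univ]
  have e : I.cutEdges S = (Finset.univ.filter fun q : Vert n × Vert n =>
      (q.1 ∈ srcSide S ∧ q.2 ∈ snkSide S) ∧ I.graph.Adj q.1 q.2).image fun q => s(q.1, q.2) := by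
    ext e
    simp only [cutEdges, Finset.mem_filter, Finset.mem_univ, true_and, Finset.mem_image,
      Prod.exists]
    constructor
    · rintro ⟨he, u, hu, v, hv, rfl⟩
      exact ⟨u, v, ⟨⟨hu, hv⟩, he⟩, rfl⟩
    · rintro ⟨u, v, ⟨⟨hu, hv⟩, he⟩, rfl⟩
      exact ⟨he, u, hu, v, hv, rfl⟩
  rw [cutCost, e, Finset.sum_image]
  · rw [Finset.sum_filter]
    refine Finset.sum_congr rfl fun q _ => ?_
    rw [ite_and]
    rfl
  · rintro ⟨u, v⟩ h ⟨u', v'⟩ h' he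
    simp only [Finset.coe_filter, Finset.mem_univ, true_and, Set.mem_ofPred_eq] at h h'
    rcases Sym2.eq_iff.1 he with ⟨rfl, rfl⟩ | ⟨rfl, rfl⟩
    · rfl
    · exact absurd h.1.2 (disjoint_sides h'.1.1)

/-- Only the edge between source and sink has no end in `V`, and all cuts contain it. -/
theorem CutInstance.cutCost_eq (S : Finset (Fin n)) :
    I.cutCost S = I.partCost Finset.univ S + I.weight src snk := by
  classical
  rw [cutCost_eq_sum, partCost, ParetoCut.partCost]
  simp only [Fintype.sum_sum_type, Fintype.sum_bool, mem_srcSide_inl, mem_snkSide_inl,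
    mem_srcSide_inr, mem_snkSide_inr, Finset.mem_univ, or_true, and_true, Finset.sum_add_distrib]
  simp [src, snk, Finset.sum_ite, Finset.filter_not]
  abel

theorem dominates_iff_lt {x y : Fin d → ℝ} : Dominates x y ↔ x < y := Pi.lt_def.symm

/-! ### Pareto-optimal solutions of the subproblems -/

open NiceTree

/-- The part of the cost of the solution `r ∪ S` of the subproblem `(U, S)` that is due to edges
with a forgotten end. -/
noncomputable def CutInstance.subCost (U : NiceTree n) (S r : Finset (Fin n)) : Fin d → ℝ :=
  I.partCost U.forgotten (r ∪ S)

/-- `r ∪ S` is Pareto-optimal for the subproblem `(U, S)`. -/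
def CutInstance.IsFront (U : NiceTree n) (S r : Finset (Fin n)) : Prop :=
  r ⊆ U.forgotten ∧ ∀ q ⊆ U.forgotten, ¬ I.subCost U S q < I.subCost U S r

/-- Two cuts that differ only in `Z` are compared by their costs due to `Z`. -/
theorem cutCost_lt_iff {Z p q : Finset (Fin n)} (h : ∀ v ∉ Z, v ∈ p ↔ v ∈ q) :
    I.cutCost p < I.cutCost q ↔ I.partCost Z p < I.partCost Z q := by
  have := partCost_univ_sub (fun u v => I.weight (.inl u) (.inl v))
    (fun u => I.weight (.inl u) snk) (fun u => I.weight src (.inl u)) h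
  change I.partCost Finset.univ p - I.partCost Z p = I.partCost Finset.univ q - I.partCost Z q
    at this
  have h₁ : I.cutCost p = I.partCost Z p + (I.partCost Finset.univ q - I.partCost Z q +
      I.weight src snk) := by rw [I.cutCost_eq, ← this]; abel
  have h₂ : I.cutCost q = I.partCost Z q + (I.partCost Finset.univ q - I.partCost Z q +
      I.weight src snk) := by rw [I.cutCost_eq]; abel
  rw [h₁, h₂, add_lt_add_iff_right]

theorem mem_feasible {U : NiceTree n} {S p : Finset (Fin n)} :
    p ∈ feasible U S ↔ p ⊆ U.verts ∧ p ∩ U.bag = S := by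
  simp [feasible]

theorem union_mem_feasible {U : NiceTree n} {S r : Finset (Fin n)} (hS : S ⊆ U.bag)
    (hr : r ⊆ U.forgotten) : r ∪ S ∈ feasible U S := by
  rw [mem_feasible]
  refine ⟨Finset.union_subset (hr.trans Finset.sdiff_subset) (hS.trans (bag_subset_verts U)), ?_⟩
  ext x
  have := @hr x
  have := @hS x
  simp only [forgotten, Finset.mem_sdiff, Finset.mem_inter, Finset.mem_union] at *
  tauto

theorem CutInstance.IsFront.union_mem_paretoSet {U : NiceTree n} {S r : Finset (Fin n)}
    (hS : S ⊆ U.bag) (hr : I.IsFront U S r) : r ∪ S ∈ paretoSet I U S := by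
  simp only [paretoSet, Finset.mem_filter]
  refine ⟨union_mem_feasible hS hr.1, fun q hq hdom => ?_⟩
  rw [mem_feasible] at hq
  have hq' : q = q \ U.bag ∪ S := by rw [← hq.2, Finset.sdiff_union_inter]
  rw [dominates_iff_lt, cutCost_lt_iff I (Z := U.forgotten)] at hdom
  · rw [hq'] at hdom
    exact hr.2 (q \ U.bag) (Finset.sdiff_subset_sdiff hq.1 subset_rfl) hdom
  · intro v hv
    have h₁ := @hq.1 v
    have h₂ : v ∈ q ∩ U.bag ↔ v ∈ S := by rw [hq.2]
    have h₃ := @hr.1 v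
    simp only [forgotten, Finset.mem_sdiff, Finset.mem_inter, Finset.mem_union] at *
    tauto

/-- The costs due to forgotten vertices depend on a solution only within the subtree. -/
theorem partCost_forgotten_congr {U : NiceTree n} (hU : U.Separated I.innerGraph)
    {p q : Finset (Fin n)} (h : ∀ v ∈ U.verts, v ∈ p ↔ v ∈ q) :
    I.partCost U.forgotten p = I.partCost U.forgotten q := by
  refine partCost_congr _ _ _ (fun u v => I.weight_comm _ _) Finset.sdiff_subset
    (fun u hu v hv => ?_) h
  refine hU.mem_verts_of_adj hu ?_
  by_contra hadj
  exact hv (if_neg hadj)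

end

section
variable {n d : ℕ} (I : CutInstance n d)

open NiceTree

theorem NiceTree.IsNiceTreeDecomposition.separated_of_mem {T U : NiceTree n}
    {G : SimpleGraph (Fin n)} (hT : T.IsNiceTreeDecomposition G) (hU : U ∈ T.nodes) :
    U.Separated G := by
  obtain ⟨a, ha⟩ := mem_nodes_iff.1 hU
  exact hT.separated_of_at? U a ha (hT.wellFormed.of_mem_nodes hU)

/-- Exchange argument: replacing the part of a cut below a node by a better solution of the
subproblem gives a better cut. -/
theorem inter_mem_paretoSet {T U : NiceTree n} (hT : T.IsNiceTreeDecomposition I.innerGraph)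
    (hU : U ∈ T.nodes) {p : Finset (Fin n)} (hp : I.IsParetoCut p) :
    p ∩ U.verts ∈ paretoSet I U (p ∩ U.bag) := by
  have hsep := hT.separated_of_mem hU
  have hsub := bag_subset_verts U
  simp only [paretoSet, Finset.mem_filter]
  refine ⟨mem_feasible.2 ⟨Finset.inter_subset_right, ?_⟩, fun q hq hdom => ?_⟩
  · rw [Finset.inter_assoc, Finset.inter_eq_right.2 hsub]
  · rw [mem_feasible] at hq
    have hqX : ∀ v, v ∈ U.bag → (v ∈ q ↔ v ∈ p) := fun v hv => by
      have : v ∈ q ∩ U.bag ↔ v ∈ p ∩ U.bag := by rw [hq.2]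
      simpa [hv] using this
    have h₁ : ∀ v ∉ U.forgotten, v ∈ q ↔ v ∈ p ∩ U.verts := by
      intro v hv
      have := @hq.1 v
      have := hqX v
      simp only [forgotten, Finset.mem_sdiff, Finset.mem_inter] at *
      tauto
    have h₂ : ∀ v ∉ U.forgotten, v ∈ p \ U.verts ∪ q ↔ v ∈ p := by
      intro v hv
      have := @hq.1 v
      have := hqX v
      simp only [forgotten, Finset.mem_sdiff, Finset.mem_union] at *
      tauto
    refine hp (p \ U.verts ∪ q) ?_
    rw [dominates_iff_lt, cutCost_lt_iff I h₁] at hdom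
    rw [dominates_iff_lt, cutCost_lt_iff I h₂,
      partCost_forgotten_congr I hsep (q := q) (fun v hv => by simp [hv]),
      partCost_forgotten_congr I hsep (p := p) (q := p ∩ U.verts) (fun v hv => by simp [hv])]
    exact hdom

/-! ### Bounds -/

theorem le_foldr_max {l : List ℕ} {x : ℕ} (h : x ∈ l) : x ≤ l.foldr max 0 := by
  induction l with
  | nil => simp at h
  | cons y l ih =>
    rcases List.mem_cons.1 h with rfl | h
    · exact le_max_left _ _
    · exact (ih h).trans (le_max_right _ _)

theorem card_paretoSet_le_pMax {T U : NiceTree n} (hU : U ∈ T.nodes) {S : Finset (Fin n)}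
    (hS : S ⊆ U.bag) : (paretoSet I U S).card ≤ pMax I T :=
  (Finset.le_sup (f := fun S => (paretoSet I U S).card) (Finset.mem_powerset.2 hS)).trans
    (le_foldr_max (List.mem_map_of_mem hU))

theorem card_bag_le {T U : NiceTree n} (hU : U ∈ T.nodes) : U.bag.card ≤ T.width + 1 := by
  have : U.bag.card ≤ (T.nodes.map fun U => U.bag.card).foldr max 0 :=
    le_foldr_max (List.mem_map_of_mem (f := fun U : NiceTree n => U.bag.card) hU)
  rw [width]
  omega

theorem exists_isFront_le (U : NiceTree n) (S : Finset (Fin n)) {r : Finset (Fin n)}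
    (hr : r ⊆ U.forgotten) : ∃ q, I.IsFront U S q ∧ I.subCost U S q ≤ I.subCost U S r := by
  classical
  obtain ⟨b, hb, hmin⟩ := (U.forgotten.powerset.image (I.subCost U S)).exists_le_minimal
    (Finset.mem_image_of_mem _ (Finset.mem_powerset.2 hr))
  obtain ⟨q, hq, rfl⟩ := Finset.mem_image.1 hmin.1
  refine ⟨q, ⟨Finset.mem_powerset.1 hq, fun q' hq' hlt => ?_⟩, hb⟩
  exact hmin.not_lt (Finset.mem_image_of_mem _ (Finset.mem_powerset.2 hq')) hlt

theorem one_le_pMax (T : NiceTree n) : 1 ≤ pMax I T := by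
  obtain ⟨q, hq, -⟩ := exists_isFront_le I T ∅ (Finset.empty_subset _)
  have hT : T ∈ T.nodes := mem_nodes_iff.2 ⟨[], at?_nil T⟩
  exact (Finset.card_pos.2 ⟨_, hq.union_mem_paretoSet I (Finset.empty_subset _)⟩).trans_le
    (card_paretoSet_le_pMax I hT (Finset.empty_subset _))

/-! ### The recursion over the tree decomposition -/

/-- The set represented by an expression. -/
def STree.set (t : STree n) : Finset (Fin n) := t.toList.toFinset

/-- `s` represents a solution of the subproblem `(U, S)`, without the vertices of the bag. The bound
on the size of the expression is for the time that writing out the solution takes. -/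
structure IsSol (U : NiceTree n) (S : Finset (Fin n)) (s : Sol n d) : Prop where
  nodup : s.2.toList.Nodup
  size : s.2.size ≤ 4 * U.nodes.length
  subset : s.2.set ⊆ U.forgotten
  cost : s.1 = I.subCost U S s.2.set

/-- `A` lists the Pareto-optimal solutions of the subproblem `(U, S)`. -/
structure IsFrontList (U : NiceTree n) (S : Finset (Fin n)) (A : List (Sol n d)) : Prop where
  nodup : (A.map fun s => s.2.set).Nodup
  isSol : ∀ s ∈ A, IsSol I U S s
  isFront : ∀ s ∈ A, I.IsFront U S s.2.set
  complete : ∀ r, I.IsFront U S r → ∃ s ∈ A, s.2.set = r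

variable {I}

theorem IsFrontList.length_le {T U : NiceTree n} (hU : U ∈ T.nodes) {S : Finset (Fin n)}
    (hS : S ⊆ U.bag) {A : List (Sol n d)} (hA : IsFrontList I U S A) :
    A.length ≤ pMax I T := by
  refine le_trans ?_ (card_paretoSet_le_pMax I hU hS)
  rw [← List.length_map (f := fun s : Sol n d => s.2.set), ← List.toFinset_card_of_nodup hA.nodup]
  refine Finset.card_le_card_of_injOn (fun r => r ∪ S) ?_ ?_
  · intro r hr
    simp only [List.coe_toFinset, List.mem_map, Set.mem_ofPred_eq] at hr
    obtain ⟨s, hs, rfl⟩ := hr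
    exact (hA.isFront s hs).union_mem_paretoSet I hS
  · have key : ∀ r ∈ ((A.map fun s => s.2.set).toFinset : Set (Finset (Fin n))),
        (r ∪ S) \ U.bag = r := by
      intro r hr
      simp only [List.coe_toFinset, List.mem_map, Set.mem_ofPred_eq] at hr
      obtain ⟨s, hs, rfl⟩ := hr
      ext v
      have := @(hA.isFront s hs).1 v
      have := @hS v
      simp only [forgotten, Finset.mem_sdiff, Finset.mem_union] at *
      tauto
    intro r hr r' hr' h
    rw [← key r hr, ← key r' hr']
    exact congrArg (· \ U.bag) h

/-- Candidates that contain all Pareto-optimal solutions, and for each solution one that is at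
least as good, suffice for the computation of the Pareto-optimal solutions. -/
theorem IsFrontList.of_candidates {U : NiceTree n} {S : Finset (Fin n)} {C r : List (Sol n d)}
    (hnd : (C.map fun s => s.2.set).Nodup) (hC : ∀ s ∈ C, IsSol I U S s)
    (hle : ∀ q ⊆ U.forgotten, ∃ s ∈ C, s.1 ≤ I.subCost U S q)
    (hcomp : ∀ q, I.IsFront U S q → ∃ s ∈ C, s.2.set = q) (hr : r.Perm (paretoL C)) :
    IsFrontList I U S r := by
  have hmem : ∀ s, s ∈ r ↔ s ∈ C ∧ ∀ a ∈ C, ¬ a.1 < s.1 := by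
    intro s
    rw [hr.mem_iff, paretoL, List.mem_filter]
    simp [dominates_iff_lt]
  refine ⟨?_, fun s hs => hC s ((hmem s).1 hs).1, fun s hs => ?_, fun q hq => ?_⟩
  · rw [(hr.map _).nodup_iff]
    exact hnd.sublist (List.filter_sublist.map _)
  · obtain ⟨hs, h⟩ := (hmem s).1 hs
    refine ⟨(hC s hs).subset, fun q hq hlt => ?_⟩
    obtain ⟨a, ha, hle⟩ := hle q hq
    exact h a ha (hle.trans_lt (by rwa [(hC s hs).cost]))
  · obtain ⟨s, hs, rfl⟩ := hcomp q hq
    refine ⟨s, (hmem s).2 ⟨hs, fun a ha hlt => ?_⟩, rfl⟩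
    rw [(hC s hs).cost, (hC a ha).cost] at hlt
    exact hq.2 _ (hC a ha).subset hlt

theorem IsFrontList.leaf : IsFrontList I .leaf ∅ [(0, .empty)] := by
  have h0 : I.subCost .leaf ∅ ∅ = 0 := partCost_empty _ _ _ _
  have hZ : (NiceTree.leaf : NiceTree n).forgotten = ∅ := rfl
  have hset : (STree.empty : STree n).set = ∅ := rfl
  refine ⟨by simp, ?_, ?_, ?_⟩
  · simp only [List.mem_singleton, forall_eq]
    exact ⟨by simp [STree.toList], by simp [STree.size, nodes], by simp [hset], by rw [hset, h0]⟩
  · simp only [List.mem_singleton, forall_eq, hset]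
    refine ⟨Finset.empty_subset _, fun q hq => ?_⟩
    rw [hZ, Finset.subset_empty] at hq
    rw [hq]
    exact lt_irrefl _
  · intro r hr
    have := hr.1
    rw [hZ, Finset.subset_empty] at this
    exact ⟨_, List.mem_singleton_self _, this.symm ▸ hset⟩

theorem forgotten_introduce {v : Fin n} {T : NiceTree n} (hv : v ∉ T.verts) :
    (introduce v T).forgotten = T.forgotten := by
  ext x
  simp only [forgotten, verts, bag, Finset.mem_sdiff, Finset.mem_insert, not_or]
  constructor
  · rintro ⟨rfl | h, h₁, h₂⟩
    · exact absurd rfl h₁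
    · exact ⟨h, h₂⟩
  · rintro ⟨h, h₂⟩
    exact ⟨.inr h, fun e => hv (e ▸ h), h₂⟩

theorem IsFrontList.introduce {v : Fin n} {T : NiceTree n}
    (hsep : (introduce v T).Separated I.innerGraph) {S : Finset (Fin n)} {A : List (Sol n d)}
    (hA : IsFrontList I T (S.erase v) A) : IsFrontList I (introduce v T) S A := by
  have hv : v ∉ T.verts := hsep.2.1
  have hZ := forgotten_introduce hv
  have hcost : ∀ r, I.subCost (.introduce v T) S r = I.subCost T (S.erase v) r := by
    intro r
    rw [CutInstance.subCost, CutInstance.subCost, hZ]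
    refine partCost_forgotten_congr I hsep.2.2 fun x hx => ?_
    have : x ≠ v := fun e => hv (e ▸ hx)
    simp [this]
  have hF : ∀ r, I.IsFront (.introduce v T) S r ↔ I.IsFront T (S.erase v) r := by
    intro r
    simp only [CutInstance.IsFront, hZ, hcost]
  refine ⟨hA.nodup, fun s hs => ?_, fun s hs => (hF _).2 (hA.isFront s hs), fun r hr =>
    hA.complete r ((hF r).1 hr)⟩
  obtain ⟨h₁, h₂, h₃, h₄⟩ := hA.isSol s hs
  refine ⟨h₁, h₂.trans ?_, by rwa [hZ], by rwa [hcost]⟩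
  simp only [nodes, List.length_cons]
  omega

theorem forgotten_forget {v : Fin n} {T : NiceTree n} (hv : v ∈ T.bag) :
    (forget v T).forgotten = insert v T.forgotten := by
  ext x
  have := bag_subset_verts T hv
  simp only [forgotten, verts, bag, Finset.mem_sdiff, Finset.mem_erase, Finset.mem_insert]
  by_cases h : x = v
  · subst h; simp [this]
  · simp [h]

theorem weight_ne_zero {u v : Fin n} (h : I.weight (.inl u) (.inl v) ≠ 0) :
    I.innerGraph.Adj u v := by
  by_contra h'
  exact h (if_neg h')

section forget

variable {v : Fin n} {T : NiceTree n} (hsep : (forget v T).Separated I.innerGraph)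
  {S : Finset (Fin n)} (hS : S ⊆ T.bag.erase v)
include hsep hS

theorem subCost_forget_without {r : Finset (Fin n)} (hr : r ⊆ T.forgotten) :
    I.subCost (forget v T) S r = I.weight src (.inl v) +
      ∑ u ∈ S, I.weight (.inl v) (.inl u) + I.subCost T S r := by
  have hvb : v ∈ T.bag := hsep.2.1
  have hvZ : v ∉ T.forgotten := fun h => (Finset.mem_sdiff.1 h).2 hvb
  have hv : v ∉ r ∪ S := by
    rw [Finset.mem_union, not_or]
    exact ⟨fun h => hvZ (hr h), fun h => Finset.notMem_erase v _ (hS h)⟩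
  rw [CutInstance.subCost, CutInstance.subCost, forgotten_forget hvb, CutInstance.partCost,
    partCost_insert _ _ _ (fun u v => I.weight_comm _ _) hvZ, if_neg hv]
  congr 2
  refine Finset.sum_congr ?_ fun _ _ => rfl
  ext u
  have h₁ := @hr u
  have h₂ := @hS u
  simp only [forgotten, Finset.mem_sdiff, Finset.mem_filter, Finset.mem_univ, true_and,
    Finset.mem_union, Finset.mem_erase] at *
  tauto

omit hS in
theorem subCost_forget_with {r : Finset (Fin n)} (hr : r ⊆ T.forgotten) :
    I.subCost (forget v T) S (insert v r) = I.weight (.inl v) snk +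
      ∑ u ∈ T.bag.erase v \ S, I.weight (.inl v) (.inl u) + I.subCost T (insert v S) r := by
  have hvb : v ∈ T.bag := hsep.2.1
  have hvZ : v ∉ T.forgotten := fun h => (Finset.mem_sdiff.1 h).2 hvb
  have e : insert v r ∪ S = r ∪ insert v S := by
    rw [Finset.insert_union, Finset.union_insert]
  rw [CutInstance.subCost, CutInstance.subCost, forgotten_forget hvb, CutInstance.partCost,
    partCost_insert _ _ _ (fun u v => I.weight_comm _ _) hvZ, e, if_pos (by simp)]
  congr 2
  symm
  refine Finset.sum_subset_zero_on_sdiff ?_ ?_ fun _ _ => rfl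
  · intro u hu
    have h₁ := @hr u
    simp only [forgotten, Finset.mem_sdiff, Finset.mem_filter, Finset.mem_univ, true_and,
      Finset.mem_union, Finset.mem_erase, Finset.mem_insert] at *
    tauto
  · intro u hu
    by_contra h0
    have hadj := weight_ne_zero h0
    have huv : u ≠ v := fun e => hadj.ne e.symm
    have hbv : v ∈ T.verts := bag_subset_verts T hvb
    have := hsep.1 v hbv (Finset.notMem_erase v _) u hadj
    simp only [forgotten, verts, Finset.mem_sdiff, Finset.mem_filter, Finset.mem_univ, true_and,
      Finset.mem_union, Finset.mem_erase, Finset.mem_insert] at *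
    tauto

theorem IsFrontList.forget {A B r : List (Sol n d)} (hA : IsFrontList I T S A)
    (hB : IsFrontList I T (insert v S) B)
    (hr : r.Perm (paretoL
      (A.map (Sol.add (I.weight src (.inl v) + ∑ u ∈ S, I.weight (.inl v) (.inl u), .empty)) ++
        B.map (Sol.add (I.weight (.inl v) snk +
          ∑ u ∈ T.bag.erase v \ S, I.weight (.inl v) (.inl u), .single v))))) :
    IsFrontList I (.forget v T) S r := by
  have hvb : v ∈ T.bag := hsep.2.1
  have hvZ : v ∉ T.forgotten := fun h => (Finset.mem_sdiff.1 h).2 hvb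
  have hZ := forgotten_forget hvb
  have eA : ∀ (x : Fin d → ℝ) (s : Sol n d), (Sol.add (x, .empty) s).2.set = s.2.set := by
    intro x s; simp [Sol.add, STree.set, STree.toList]
  have eB : ∀ (x : Fin d → ℝ) (s : Sol n d),
      (Sol.add (x, .single v) s).2.set = insert v s.2.set := by
    intro x s; simp [Sol.add, STree.set, STree.toList]
  have costA := fun {r} => subCost_forget_without hsep hS (r := r)
  have costB := fun {r} => subCost_forget_with hsep (S := S) (r := r)
  have hins : ∀ {q}, q ⊆ insert v T.forgotten → q.erase v ⊆ T.forgotten := fun h =>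
    Finset.subset_insert_iff.1 h
  have hsub : ∀ {q}, q ⊆ insert v T.forgotten → v ∉ q → q ⊆ T.forgotten := fun h hv =>
    (Finset.subset_insert_iff_of_notMem hv).1 h
  refine IsFrontList.of_candidates ?_ ?_ ?_ ?_ hr
  · rw [List.map_append, List.map_map, List.map_map]
    simp only [Function.comp_def, eA, eB]
    rw [List.nodup_append]
    refine ⟨hA.nodup, ?_, ?_⟩
    · have : (B.map fun s => insert v s.2.set) =
          (B.map fun s => s.2.set).map fun q => insert v q := by
        rw [List.map_map]; rfl
      rw [this]
      refine hB.nodup.map_on fun q hq q' hq' h => ?_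
      obtain ⟨s, hs, rfl⟩ := List.mem_map.1 hq
      obtain ⟨s', hs', rfl⟩ := List.mem_map.1 hq'
      have h₁ : v ∉ s.2.set := fun h => hvZ ((hB.isSol s hs).subset h)
      have h₂ : v ∉ s'.2.set := fun h => hvZ ((hB.isSol s' hs').subset h)
      rw [← Finset.erase_insert h₁, ← Finset.erase_insert h₂, h]
    · intro q hq q' hq' e
      obtain ⟨s, hs, rfl⟩ := List.mem_map.1 hq
      obtain ⟨s', hs', rfl⟩ := List.mem_map.1 hq'
      exact hvZ ((hA.isSol s hs).subset (e ▸ Finset.mem_insert_self _ _))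
  · intro s hs
    rcases List.mem_append.1 hs with hs | hs
    · obtain ⟨a, ha, rfl⟩ := List.mem_map.1 hs
      obtain ⟨h₁, h₂, h₃, h₄⟩ := hA.isSol a ha
      refine ⟨h₁, ?_, ?_, ?_⟩
      · simp only [Sol.add, STree.size, nodes, List.length_cons]
        omega
      · rw [eA, hZ]
        exact h₃.trans (Finset.subset_insert _ _)
      · rw [eA, costA h₃, ← h₄]
        rfl
    · obtain ⟨a, ha, rfl⟩ := List.mem_map.1 hs
      obtain ⟨h₁, h₂, h₃, h₄⟩ := hB.isSol a ha
      refine ⟨?_, ?_, ?_, ?_⟩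
      · simp only [Sol.add, STree.toList, List.singleton_append, List.nodup_cons]
        exact ⟨fun h => hvZ (h₃ (List.mem_toFinset.2 h)), h₁⟩
      · simp only [Sol.add, STree.size, nodes, List.length_cons]
        omega
      · rw [eB, hZ]
        exact Finset.insert_subset_insert _ h₃
      · rw [eB, costB h₃, ← h₄]
        rfl
  · intro q hq
    rw [hZ] at hq
    by_cases hvq : v ∈ q
    · obtain ⟨r, hr, hle⟩ := exists_isFront_le I T (insert v S) (hins hq)
      obtain ⟨s, hs, rfl⟩ := hB.complete r hr
      refine ⟨_, List.mem_append_right _ (List.mem_map_of_mem hs), ?_⟩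
      rw [← Finset.insert_erase hvq, costB (hins hq)]
      simp only [Sol.add]
      rw [(hB.isSol s hs).cost]
      gcongr
    · obtain ⟨r, hr, hle⟩ := exists_isFront_le I T S (hsub hq hvq)
      obtain ⟨s, hs, rfl⟩ := hA.complete r hr
      refine ⟨_, List.mem_append_left _ (List.mem_map_of_mem hs), ?_⟩
      rw [costA (hsub hq hvq)]
      simp only [Sol.add]
      rw [(hA.isSol s hs).cost]
      gcongr
  · rintro q ⟨hq, hmin⟩
    rw [hZ] at hq hmin
    by_cases hvq : v ∈ q
    · obtain ⟨s, hs, e⟩ := hB.complete (q.erase v) ⟨hins hq, fun q' hq' hlt => by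
        refine hmin (insert v q') (Finset.insert_subset_insert _ hq') ?_
        rw [← Finset.insert_erase hvq, costB hq', costB (hins hq)]
        gcongr⟩
      exact ⟨_, List.mem_append_right _ (List.mem_map_of_mem hs), by
        rw [eB, e, Finset.insert_erase hvq]⟩
    · obtain ⟨s, hs, e⟩ := hA.complete q ⟨hsub hq hvq, fun q' hq' hlt => by
        refine hmin q' (hq'.trans (Finset.subset_insert _ _)) ?_
        rw [costA hq', costA (hsub hq hvq)]
        gcongr⟩
      exact ⟨_, List.mem_append_left _ (List.mem_map_of_mem hs), by rw [eA, e]⟩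

end forget

section join

variable {T₁ T₂ : NiceTree n} (hsep : (join T₁ T₂).Separated I.innerGraph)
include hsep

theorem forgotten_join : (join T₁ T₂).forgotten = T₁.forgotten ∪ T₂.forgotten := by
  have h₁ : T₁.bag = T₂.bag := hsep.2.1
  simp only [forgotten, verts, bag, ← h₁, Finset.union_sdiff_distrib]

theorem notMem_verts_of_mem_forgotten_left {v : Fin n} (hv : v ∈ T₁.forgotten) : v ∉ T₂.verts :=
  fun h => (Finset.mem_sdiff.1 hv).2
    (hsep.2.2.1 (Finset.mem_inter.2 ⟨(Finset.mem_sdiff.1 hv).1, h⟩))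

theorem notMem_verts_of_mem_forgotten_right {v : Fin n} (hv : v ∈ T₂.forgotten) :
    v ∉ T₁.verts :=
  fun h => (Finset.mem_sdiff.1 hv).2 (hsep.2.1 ▸
    hsep.2.2.1 (Finset.mem_inter.2 ⟨h, (Finset.mem_sdiff.1 hv).1⟩))

theorem subCost_join {S r₁ r₂ : Finset (Fin n)} (h₁ : r₁ ⊆ T₁.forgotten)
    (h₂ : r₂ ⊆ T₂.forgotten) :
    I.subCost (.join T₁ T₂) S (r₁ ∪ r₂) = I.subCost T₁ S r₁ + I.subCost T₂ S r₂ := by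
  have hl := fun v => notMem_verts_of_mem_forgotten_left hsep (v := v)
  have hr := fun v => notMem_verts_of_mem_forgotten_right hsep (v := v)
  rw [CutInstance.subCost, forgotten_join hsep, CutInstance.partCost,
    partCost_union _ _ _ (fun u v => I.weight_comm _ _)]
  · congr 1
    · refine partCost_forgotten_congr I hsep.2.2.2.1 fun v hv => ?_
      have : v ∉ r₂ := fun h => hr v (h₂ h) hv
      simp [this]
    · refine partCost_forgotten_congr I hsep.2.2.2.2 fun v hv => ?_
      have : v ∉ r₁ := fun h => hl v (h₁ h) hv
      simp [this]
  · exact Finset.disjoint_left.2 fun v hv hv' => hl v hv (Finset.mem_sdiff.1 hv').1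
  · intro u hu v hv
    by_contra h0
    exact hr v hv (hsep.2.2.2.1.mem_verts_of_adj hu (weight_ne_zero h0))

theorem IsFrontList.join {S : Finset (Fin n)} {A B r : List (Sol n d)}
    (hA : IsFrontList I T₁ S A) (hB : IsFrontList I T₂ S B) (hr : r.Perm (paretoL (crossL A B))) :
    IsFrontList I (.join T₁ T₂) S r := by
  have hZ := forgotten_join hsep
  have hdis : Disjoint T₁.forgotten T₂.forgotten := Finset.disjoint_left.2 fun v hv hv' =>
    notMem_verts_of_mem_forgotten_left hsep hv (Finset.mem_sdiff.1 hv').1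
  have hcost := fun {r₁ r₂} => subCost_join hsep (S := S) (r₁ := r₁) (r₂ := r₂)
  have hset : ∀ a b : Sol n d, (Sol.add a b).2.set = a.2.set ∪ b.2.set := by
    intro a b; simp [Sol.add, STree.set, STree.toList]
  have hcross : crossL A B = (A ×ˢ B).map fun q => q.1.add q.2 := by
    rw [crossL]
    change _ = List.map _ (A.flatMap fun a => B.map (Prod.mk a))
    rw [List.map_flatMap]
    simp [Function.comp_def]
  have hmem : ∀ {a b}, a ∈ A → b ∈ B → a.add b ∈ crossL A B := by
    intro a b ha hb
    rw [hcross]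
    exact List.mem_map.2 ⟨(a, b), List.mem_product.2 ⟨ha, hb⟩, rfl⟩
  have hi : ∀ {q Z : Finset (Fin n)}, q ∩ Z ⊆ Z := by
    intro q Z
    exact Finset.inter_subset_right
  have hq' : ∀ {q}, q ⊆ T₁.forgotten ∪ T₂.forgotten →
      q ∩ T₁.forgotten ∪ q ∩ T₂.forgotten = q := by
    intro q hq
    rw [← Finset.inter_union_distrib_left]
    exact Finset.inter_eq_left.2 hq
  refine IsFrontList.of_candidates ?_ ?_ ?_ ?_ hr
  · rw [hcross, List.map_map]
    refine List.Nodup.map_on ?_ (hA.nodup.of_map.product hB.nodup.of_map)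
    rintro ⟨a, b⟩ hab ⟨a', b'⟩ hab' h
    obtain ⟨ha, hb⟩ := List.mem_product.1 hab
    obtain ⟨ha', hb'⟩ := List.mem_product.1 hab'
    simp only [Function.comp_apply, hset] at h
    have h₁ := (hA.isSol a ha).subset
    have h₂ := (hB.isSol b hb).subset
    have h₁' := (hA.isSol a' ha').subset
    have h₂' := (hB.isSol b' hb').subset
    have hdis' := hdis.symm
    have hl : ∀ {r₁ r₂ Z₁ Z₂ : Finset (Fin n)}, r₁ ⊆ Z₁ → r₂ ⊆ Z₂ → Disjoint Z₁ Z₂ →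
        (r₁ ∪ r₂) ∩ Z₁ = r₁ := fun {r₁ r₂ Z₁ Z₂} h₁ h₂ hd => by
      rw [Finset.union_inter_distrib_right, Finset.inter_eq_left.2 h₁,
        Finset.disjoint_iff_inter_eq_empty.1 (hd.symm.mono_left h₂), Finset.union_empty]
    have e₁ : a.2.set = a'.2.set := by
      rw [← hl h₁ h₂ hdis, h, hl h₁' h₂' hdis]
    have e₂ : b.2.set = b'.2.set := by
      rw [Finset.union_comm, Finset.union_comm a'.2.set] at h
      rw [← hl h₂ h₁ hdis', h, hl h₂' h₁' hdis']
    rw [Prod.mk.injEq]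
    exact ⟨List.inj_on_of_nodup_map hA.nodup ha ha' e₁,
      List.inj_on_of_nodup_map hB.nodup hb hb' e₂⟩
  · intro s hs
    rw [hcross] at hs
    obtain ⟨⟨a, b⟩, hab, rfl⟩ := List.mem_map.1 hs
    obtain ⟨ha, hb⟩ := List.mem_product.1 hab
    have h₁ := hA.isSol a ha
    have h₂ := hB.isSol b hb
    refine ⟨?_, ?_, ?_, ?_⟩
    · simp only [Sol.add, STree.toList]
      refine h₁.nodup.append h₂.nodup fun v hv hv' => ?_
      exact Finset.disjoint_left.1 hdis (h₁.subset (List.mem_toFinset.2 hv))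
        (h₂.subset (List.mem_toFinset.2 hv'))
    · have := h₁.size
      have := h₂.size
      simp only [Sol.add, STree.size, nodes, List.length_cons, List.length_append]
      omega
    · rw [hset, hZ]
      exact Finset.union_subset_union h₁.subset h₂.subset
    · rw [hset, hcost h₁.subset h₂.subset, ← h₁.cost, ← h₂.cost]
      rfl
  · intro q hq
    rw [hZ] at hq
    obtain ⟨r₁, hr₁, hle₁⟩ := exists_isFront_le I T₁ S (hi (q := q))
    obtain ⟨r₂, hr₂, hle₂⟩ := exists_isFront_le I T₂ S (hi (q := q))
    obtain ⟨a, ha, rfl⟩ := hA.complete _ hr₁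
    obtain ⟨b, hb, rfl⟩ := hB.complete _ hr₂
    refine ⟨_, hmem ha hb, ?_⟩
    rw [← hq' hq, hcost hi hi]
    simp only [Sol.add]
    rw [(hA.isSol a ha).cost, (hB.isSol b hb).cost]
    gcongr
  · rintro q ⟨hq, hmin⟩
    rw [hZ] at hq hmin
    have hq₁ : I.IsFront T₁ S (q ∩ T₁.forgotten) := ⟨hi, fun q' hq₁ hlt => by
      refine hmin (q' ∪ q ∩ T₂.forgotten) (Finset.union_subset_union hq₁ hi) ?_
      conv_rhs => rw [← hq' hq]
      rw [hcost hq₁ hi, hcost hi hi]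
      gcongr⟩
    have hq₂ : I.IsFront T₂ S (q ∩ T₂.forgotten) := ⟨hi, fun q' hq₂ hlt => by
      refine hmin (q ∩ T₁.forgotten ∪ q') (Finset.union_subset_union hi hq₂) ?_
      conv_rhs => rw [← hq' hq]
      rw [hcost hi hq₂, hcost hi hi]
      gcongr⟩
    obtain ⟨a, ha, ea⟩ := hA.complete _ hq₁
    obtain ⟨b, hb, eb⟩ := hB.complete _ hq₂
    exact ⟨_, hmem ha hb, by rw [hset, ea, eb, hq' hq]⟩

end join

end

/-! ### Running the program -/

section
variable {n d : ℕ} (I : CutInstance n d)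

open NiceTree

theorem isEntry_entry (x y : Vert n) : IsEntry (I.entry x y) (I.weight x y) := by
  by_cases h : I.graph.Adj x y
  · right
    rw [CutInstance.entry, CutInstance.weight, if_pos h, if_pos h, encR, List.map_ofFn]
    rfl
  · exact .inl ⟨if_neg h, if_neg h⟩

theorem padVec_zero {J : ℕ} (hd : d ≤ J + 3) :
    padVec J (0 : Fin d → ℝ) = List.replicate (J + 3) 0 := by
  have : List.ofFn (0 : Fin d → ℝ) = List.replicate d 0 := List.ofFn_const d 0
  rw [padVec, this, List.replicate_append_replicate, Nat.add_sub_cancel' hd]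

/-- The time that the program spends on a node of a tree decomposition of width `w`. -/
def nodeCost (J p t w : ℕ) : ℕ :=
  (leafCost J p t + 200 * (J + 10)) * 2 ^ (w + 2) + 200 * (J + 10)

variable (J : ℕ) (hd : d ≤ J + 3)
include hd

/-- The table of a node `U` holds, for every subset `S` of the bag, the Pareto-optimal solutions of
the subproblem `(U, S)`, with their costs due to the forgotten vertices. -/
theorem spec_solve (T : NiceTree n) (t : ℕ) (ht : 4 * pMax I T ^ 2 ≤ 2 ^ t) (U : NiceTree n) :
    U ∈ T.nodes → U.Separated I.innerGraph →
    ∃ (l : List (Fin n)) (t' : Tbl n d), l.Pairwise (· < ·) ∧ l.toFinset = U.bag ∧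
      t'.Holds l (IsFrontList I U) ∧
      Spec (program J) Fn.solve (.pair I.encode U.encode) (t'.enc J)
        (nodeCost J (pMax I T) t T.width * U.nodes.length) := by
  have hp := one_le_pMax I T
  have hchild : ∀ {U V : NiceTree n} {c : Bool}, U ∈ T.nodes → U.at? [c] = some V →
      V ∈ T.nodes := by
    intro U V c hU hV
    obtain ⟨a, ha⟩ := mem_nodes_iff.1 hU
    exact mem_nodes_iff.2 ⟨a ++ [c], by rw [at?_append, ha]; exact hV⟩
  have hcost : ∀ {U : NiceTree n} {l : List (Fin n)} {c : ℕ}, U ∈ T.nodes → l.Pairwise (· < ·) →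
      l.toFinset = U.bag → c ≤ leafCost J (pMax I T) t + 200 * (J + 10) →
      tblCost c l.length + 200 * (J + 10) ≤ nodeCost J (pMax I T) t T.width := by
    intro U l c hU hl hlU hc
    have h₁ := card_bag_le hU
    rw [← hlU, List.toFinset_card_of_nodup (hl.imp ne_of_lt)] at h₁
    rw [nodeCost]
    refine Nat.add_le_add_right ((tblCost_le _ _).trans (Nat.mul_le_mul hc ?_)) _
    exact Nat.pow_le_pow_right (by omega) (by omega)
  induction U with
  | leaf =>
    intro _ _
    refine ⟨[], .leaf [(0, .empty)], by simp, rfl, IsFrontList.leaf, ?_⟩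
    have : 200 * (J + 10) ≤ nodeCost J (pMax I T) t T.width := Nat.le_add_left _ _
    apply Spec.of_wp (body := Body.solve (J + 3)) rfl
    simp [Body.solve, wp, wp_zeros, NiceTree.encode, nodes, Tbl.enc, encSol, encItem,
      padVec_zero hd, STree.enc]
    omega
  | introduce v U ih =>
    intro hU hsep
    have hU' := hchild (V := U) (c := false) hU (by simp [at?, at?_nil])
    obtain ⟨l, t₁, hl, hlU, h, c⟩ := ih hU' hsep.2.2
    have hv : v ∉ l := fun h => hsep.2.1 (bag_subset_verts U (hlU ▸ List.mem_toFinset.2 h))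
    obtain ⟨l', t₂, hl', hlU', h', c'⟩ := spec_ins J v l _ t₁ hl hv h
    refine ⟨l', t₂, hl', by rw [hlU', hlU]; rfl, h'.congr fun S _ A hA => hA.introduce hsep, ?_⟩
    have := hcost (c := 50) hU' hl hlU (by omega)
    apply Spec.of_wp (body := Body.solve (J + 3)) rfl
    simp [Body.solve, wp, NiceTree.encode, nodes]
    refine .mk c fun k hk => ?_
    refine .mk c' fun k' hk' => ⟨rfl, ?_⟩
    rw [Nat.mul_add (nodeCost _ _ _ _)]
    omega
  | forget v U ih =>
    intro hU hsep
    have hU' := hchild (V := U) (c := false) hU (by simp [at?, at?_nil])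
    obtain ⟨l, t₁, hl, hlU, h, c⟩ := ih hU' hsep.2.2
    have hnd : l.Nodup := hl.imp ne_of_lt
    have hv : v ∈ l := List.mem_toFinset.1 (hlU ▸ hsep.2.1)
    have c₁ := spec_addVec_entry J hd (isEntry_entry I src (.inl v)) 0
    have c₂ := spec_addVec_entry J hd (isEntry_entry I snk (.inl v)) 0
    rw [zero_add] at c₁ c₂
    rw [I.weight_comm snk] at c₂
    set f : ℕ → Val := fun j => if h : j < n then I.entry (.inl v) (.inl ⟨j, h⟩) else .nil with hf₀
    have hf : ∀ u ∈ l, IsEntry (f u) (I.weight (.inl v) (.inl u)) := by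
      intro u _
      simp only [hf₀, u.isLt, dif_pos]
      exact isEntry_entry I _ _
    obtain ⟨t₂, h', c'⟩ := spec_forget J hd (pMax I T) t hp ht f
      (fun u => I.weight (.inl v) (.inl u)) v l (IsFrontList I U) (IsFrontList I (.forget v U)) t₁
      (I.weight src (.inl v)) (I.weight (.inl v) snk) hf hl hv h (by
        intro S hS A B hA hB
        rw [hlU] at hS
        refine ⟨hA.length_le hU' (hS.trans (Finset.erase_subset _ _)), hB.length_le hU' ?_,
          fun r hr => ?_⟩
        · exact Finset.insert_subset hsep.2.1 (hS.trans (Finset.erase_subset _ _))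
        · rw [hlU] at hr
          exact IsFrontList.forget hsep hS hA hB hr)
    refine ⟨l.erase v, t₂, hl.sublist List.erase_sublist, ?_, h', ?_⟩
    · ext u
      rw [List.mem_toFinset, hnd.mem_erase_iff, bag, Finset.mem_erase, ← hlU, List.mem_toFinset]
    have := hcost (c := leafCost J (pMax I T) t + 200 * (J + 10)) hU' hl hlU le_rfl
    rw [padVec_zero hd] at c₁ c₂
    apply Spec.of_wp (body := Body.solve (J + 3)) rfl
    simp [Body.solve, wp, wp_zeros, NiceTree.encode, nodes, CutInstance.encode, CutInstance.row]
    rw [CutInstance.encode] at c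
    refine .mk c₁ fun k₁ hk₁ => ?_
    refine .mk c₂ fun k₂ hk₂ => ?_
    refine .mk c fun k hk => ?_
    refine .mk c' fun k' hk' => ⟨rfl, ?_⟩
    rw [Nat.mul_add (nodeCost _ _ _ _)]
    omega
  | join U₁ U₂ ih₁ ih₂ =>
    intro hU hsep
    have hU₁ := hchild (V := U₁) (c := false) hU (by simp [at?, at?_nil])
    have hU₂ := hchild (V := U₂) (c := true) hU (by simp [at?, at?_nil])
    obtain ⟨l, t₁, hl, hlU, h₁, c₁⟩ := ih₁ hU₁ hsep.2.2.2.1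
    obtain ⟨l', t₂, hl', hlU', h₂, c₂⟩ := ih₂ hU₂ hsep.2.2.2.2
    obtain rfl : l = l' := eq_of_toFinset_eq hl hl' (by rw [hlU, hlU', hsep.2.1])
    obtain ⟨t', h', c'⟩ := spec_join J hd (pMax I T) t hp ht l _ _ (IsFrontList I (.join U₁ U₂))
      t₁ t₂ h₁ h₂ (by
        intro S hS A B hA hB
        exact ⟨hA.length_le hU₁ (hlU ▸ hS), hB.length_le hU₂ (hlU' ▸ hS),
          fun r hr => hA.join hsep hB hr⟩)
    refine ⟨l, t', hl, hlU, h', ?_⟩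
    have := hcost (c := leafCost J (pMax I T) t + 100) hU₁ hl hlU (by omega)
    apply Spec.of_wp (body := Body.solve (J + 3)) rfl
    simp [Body.solve, wp, NiceTree.encode, nodes]
    refine .mk c₁ fun k₁ hk₁ => ?_
    refine .mk c₂ fun k₂ hk₂ => ?_
    refine .mk c' fun k' hk' => ⟨rfl, ?_⟩
    rw [Nat.mul_add, Nat.mul_add]
    omega

omit hd

theorem spec_flatten (t : STree n) : ∀ l : List (Fin n),
    Spec (program J) Fn.flatten (.pair t.enc (encL (fun v : Fin n => Val.label v) l))
      (encL (fun v : Fin n => Val.label v) (t.toList ++ l)) (50 * t.size) := by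
  induction t with
  | empty =>
    intro l
    apply Spec.of_wp (body := Body.flatten) rfl
    simp [Body.flatten, wp, STree.enc, STree.toList, STree.size]
  | single v =>
    intro l
    apply Spec.of_wp (body := Body.flatten) rfl
    simp [Body.flatten, wp, STree.enc, STree.toList, STree.size]
  | union s t ihs iht =>
    intro l
    apply Spec.of_wp (body := Body.flatten) rfl
    simp [Body.flatten, wp, STree.enc, STree.toList, STree.size]
    refine .mk (iht l) fun k hk => ?_
    refine .mk (ihs _) fun k' hk' => ⟨rfl, ?_⟩
    omega

theorem spec_out (N : ℕ) (A : List (Sol n d)) (hA : ∀ s ∈ A, s.2.size ≤ N) :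
    Spec (program J) Fn.out (encL (encSol J) A)
      (encL (fun s : Sol n d => encL (fun v : Fin n => Val.label v) s.2.toList) A)
      (50 * (N + 1) * (A.length + 1)) := by
  induction A with
  | nil =>
    apply Spec.of_wp (body := Body.out) rfl
    simp [Body.out, wp]
    omega
  | cons s A ih =>
    apply Spec.of_wp (body := Body.out) rfl
    have c := spec_flatten J s.2 []
    have hs := hA s (by simp)
    simp at c
    simp [Body.out, wp, encSol, encItem]
    refine .mk c fun k hk => ?_
    refine .mk (ih fun s hs => hA s (by simp [hs])) fun k' hk' => ⟨⟨rfl, rfl⟩, ?_⟩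
    nlinarith

/-- At the root, all vertices have been forgotten. -/
theorem isParetoCut_iff {T : NiceTree n} (hT : T.IsNiceTreeDecomposition I.innerGraph)
    (S : Finset (Fin n)) : I.IsParetoCut S ↔ I.IsFront T ∅ S := by
  have hZ : T.forgotten = Finset.univ := by
    ext v
    simp only [forgotten, hT.root_bag, Finset.sdiff_empty, Finset.mem_univ, iff_true]
    exact mem_verts_iff.2 (hT.vertex_covered v)
  simp only [CutInstance.IsParetoCut, CutInstance.IsFront, CutInstance.subCost, hZ,
    Finset.subset_univ, true_and, forall_true_left, Finset.union_empty, dominates_iff_lt,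
    I.cutCost_eq, add_lt_add_iff_right]

include hd in
theorem program_runs {T : NiceTree n} (hT : T.IsNiceTreeDecomposition I.innerGraph) (t : ℕ)
    (ht : 4 * pMax I T ^ 2 ≤ 2 ^ t) :
    ∃ (out : Val) (steps : ℕ), (program J).Runs (.pair I.encode T.encode) out steps ∧
      Enumerates out I.IsParetoCut ∧
      steps ≤ nodeCost J (pMax I T) t T.width * T.nodes.length +
        50 * (4 * T.nodes.length + 1) * (pMax I T + 1) + 50 := by
  have hTT : T ∈ T.nodes := mem_nodes_iff.2 ⟨[], at?_nil T⟩
  obtain ⟨l, t', -, hlT, h, c⟩ := spec_solve I J hd T t ht T hTT hT.separated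
  obtain rfl : l = [] := by rwa [hT.root_bag, List.toFinset_eq_empty_iff] at hlT
  match t', h with
  | .leaf A, hA =>
    have hA : IsFrontList I T ∅ A := hA
    have c' := spec_out J (4 * T.nodes.length) A fun s hs => (hA.isSol s hs).size
    have hlen := hA.length_le hTT (Finset.empty_subset _)
    have hmain : wp (program J) (.call 0 (.var 0)) [.pair I.encode T.encode] fun b k =>
        b = encL (fun s : Sol n d => encL (fun v : Fin n => Val.label v) s.2.toList) A ∧
        k ≤ nodeCost J (pMax I T) t T.width * T.nodes.length +
          50 * (4 * T.nodes.length + 1) * (A.length + 1) + 50 := by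
      have : Spec (program J) 0 (.pair I.encode T.encode)
          (encL (fun s : Sol n d => encL (fun v : Fin n => Val.label v) s.2.toList) A)
          (nodeCost J (pMax I T) t T.width * T.nodes.length +
          50 * (4 * T.nodes.length + 1) * (A.length + 1) + 40) := by
        apply Spec.of_wp (body := Body.main) rfl
        simp [Body.main, wp]
        refine .mk c fun k hk => ?_
        simp [Tbl.enc]
        refine .mk c' fun k' hk' => ⟨rfl, ?_⟩
        omega
      simp [wp]
      refine .mk this fun k hk => ⟨rfl, ?_⟩
      omega
    obtain ⟨b, k, he, rfl, hk⟩ := wp_sound _ _ _ _ hmain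
    refine ⟨_, k, he, ⟨A.map fun s => s.2.toList, ?_, ?_, ?_, ?_⟩, ?_⟩
    · simp [encL, Function.comp_def, ← List.map_eq_flatMap]
    · intro l hl
      obtain ⟨s, hs, rfl⟩ := List.mem_map.1 hl
      exact (hA.isSol s hs).nodup
    · rw [List.map_map]
      exact hA.nodup
    · intro S
      rw [isParetoCut_iff I hT, List.map_map, List.mem_map]
      constructor
      · rintro ⟨s, hs, rfl⟩
        exact hA.isFront s hs
      · intro hS
        exact hA.complete S hS
    · refine hk.trans ?_
      gcongr

end

/-! ### The total running time -/

/-- The lists that are filtered have length at most `2 * p ^ 2`, which makes at most `4 * p ^ 2`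
victims and killers; the bound `t` for the binary logarithm of that is of the order of the logarithm
in the theorem. -/
theorem exists_two_pow {p : ℕ} (hp : 1 ≤ p) :
    ∃ t : ℕ, 4 * p ^ 2 ≤ 2 ^ t ∧ (t + 1 : ℝ) ≤ 6 * max 1 (Real.log ((p : ℝ) ^ 2)) := by
  set x := Real.log ((p : ℝ) ^ 2) with hx
  have hp' : (1 : ℝ) ≤ (p : ℝ) ^ 2 := one_le_pow₀ (by exact_mod_cast hp)
  have hx0 : 0 ≤ x := Real.log_nonneg hp'
  -- The factor `2` makes up for `log 2 < 1`.
  refine ⟨2 + ⌈2 * x⌉₊, ?_, ?_⟩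
  · have h₁ : (p : ℝ) ^ 2 ≤ 2 ^ ⌈2 * x⌉₊ := by
      rw [← Real.log_le_log_iff (by linarith) (by positivity), ← hx, Real.log_pow]
      have h₂ := Nat.le_ceil (2 * x)
      have h₃ := Real.log_two_gt_d9
      nlinarith
    rw [pow_add]
    have : p ^ 2 ≤ 2 ^ ⌈2 * x⌉₊ := by exact_mod_cast h₁
    omega
  · have h₁ := (Nat.ceil_lt_add_one (mul_nonneg zero_le_two hx0)).le
    have h₂ : (1 : ℝ) ≤ max 1 x := le_max_left _ _
    have h₃ : x ≤ max 1 x := le_max_right _ _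
    push_cast
    linarith

/-- The constant in the running time, apart from the dependence on the number of nodes. -/
def totalConst (J : ℕ) : ℕ := 8 * paretoConst J + 6000 * (J + 10)

theorem totalCost_le (J p t w N : ℕ) (hp : 1 ≤ p) (hN : 1 ≤ N) :
    nodeCost J p t w * N + 50 * (4 * N + 1) * (p + 1) + 50 ≤
      totalConst J * (p ^ 2 * (t + 1) ^ (J + 1) * 2 ^ w * N) := by
  set X := p ^ 2 * (t + 1) ^ (J + 1) with hX
  set W := 2 ^ w with hW
  have hT : 1 ≤ (t + 1) ^ (J + 1) := Nat.one_le_pow _ _ (by omega)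
  have hpX : p ≤ X := (Nat.le_self_pow (by omega) p).trans (Nat.le_mul_of_pos_right _ hT)
  have hW1 : 1 ≤ W := Nat.one_le_two_pow
  have h₁ : nodeCost J p t w * N ≤
      (8 * paretoConst J + 5000 * (J + 10)) * (X * W * N) := by
    have e : 1 ≤ X * W := Nat.mul_pos (by omega) hW1
    calc nodeCost J p t w * N =
        ((2 * paretoConst J + 1000 * (J + 10)) * X * W * 4 + 200 * (J + 10) * 1 * W * 4 +
          200 * (J + 10) * 1) * N := by
          rw [nodeCost, leafCost, pow_add 2, ← hX, ← hW]; ring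
      _ ≤ ((2 * paretoConst J + 1000 * (J + 10)) * X * W * 4 + 200 * (J + 10) * X * W * 4 +
          200 * (J + 10) * (X * W)) * N := by gcongr; omega
      _ = (8 * paretoConst J + 5000 * (J + 10)) * (X * W * N) := by ring
  have h₂ : 50 * (4 * N + 1) * (p + 1) + 50 ≤ 1000 * (J + 10) * (X * W * N) := by
    calc 50 * (4 * N + 1) * (p + 1) + 50 ≤ 50 * (5 * N) * (2 * X) + 50 * (X * N) := by
          gcongr
          · omega
          · omega
          · exact Nat.le_mul_of_pos_right _ (Nat.mul_pos (by omega) hN)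
      _ = 550 * (X * 1 * N) := by ring
      _ ≤ 1000 * (J + 10) * (X * W * N) := by gcongr; omega
  calc _ ≤ (8 * paretoConst J + 5000 * (J + 10)) * (X * W * N) +
        1000 * (J + 10) * (X * W * N) := by omega
    _ = _ := by rw [totalConst]; ring


end ParetoCut

theorem theorem1 (d : ℕ) :
    (∃ P : ParetoCut.Program, ∀ K : ℕ, ∃ C : ℝ,
      ∀ (n : ℕ) (I : ParetoCut.CutInstance n d) (T : ParetoCut.NiceTree n),
        T.IsNiceTreeDecomposition I.innerGraph →
        T.nodes.length ≤ K * (max n 1 * max T.width 1) →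
        ∃ (out : ParetoCut.Val) (steps : ℕ),
          P.Runs (.pair I.encode T.encode) out steps ∧
          ParetoCut.Enumerates out I.IsParetoCut ∧
          (steps : ℝ) ≤ C * ((max n 1 : ℕ) * (max T.width 1 : ℕ) * 2 ^ T.width *
            (ParetoCut.pMax I T : ℝ) ^ 2 *
            (max 1 (Real.log ((ParetoCut.pMax I T : ℝ) ^ 2))) ^ max (d - 2) 1)) ∧
    (∀ (n : ℕ) (I : ParetoCut.CutInstance n d) (T : ParetoCut.NiceTree n),
      T.IsNiceTreeDecomposition I.innerGraph →
      ∀ p : Finset (Fin n), I.IsParetoCut p →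
      ∀ U ∈ T.nodes, p ∩ U.verts ∈ ParetoCut.paretoSet I U (p ∩ U.bag)) := by
  -- The truncated subtraction makes the number of coordinates `d - 3 + 3 = max d 3`.
  refine ⟨⟨ParetoCut.program (d - 3), fun K =>
    ⟨ParetoCut.totalConst (d - 3) * K * 6 ^ max (d - 2) 1, fun n I T hT hN => ?_⟩⟩,
    fun n I T hT p hp U hU => ParetoCut.inter_mem_paretoSet I hT hU hp⟩
  have hp := ParetoCut.one_le_pMax I T
  obtain ⟨t, ht, ht'⟩ := ParetoCut.exists_two_pow hp
  obtain ⟨out, steps, hrun, henum, hsteps⟩ :=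
    ParetoCut.program_runs I (d - 3) (by omega) hT t ht
  refine ⟨out, steps, hrun, henum, ?_⟩
  have hN1 : 1 ≤ T.nodes.length := List.length_pos_of_mem
    (ParetoCut.NiceTree.mem_nodes_iff.2 ⟨[], ParetoCut.NiceTree.at?_nil T⟩)
  have h := hsteps.trans (ParetoCut.totalCost_le (d - 3) (ParetoCut.pMax I T) t T.width _ hp hN1)
  rw [show d - 3 + 1 = max (d - 2) 1 by omega] at h
  set e := max (d - 2) 1
  set ℓ := max 1 (Real.log ((ParetoCut.pMax I T : ℝ) ^ 2))
  calc (steps : ℝ) ≤ ParetoCut.totalConst (d - 3) *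
        ((ParetoCut.pMax I T : ℝ) ^ 2 * (t + 1) ^ e * 2 ^ T.width * T.nodes.length) := by
        exact_mod_cast h
    _ ≤ ParetoCut.totalConst (d - 3) * ((ParetoCut.pMax I T : ℝ) ^ 2 * (6 * ℓ) ^ e *
        2 ^ T.width * (K * ((max n 1 : ℕ) * (max T.width 1 : ℕ)))) := by
        gcongr
        exact_mod_cast hN
    _ = _ := by rw [mul_pow]; ring
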